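/- Let $k$ be an algebraically closed field of characteristic zero, $S=k[x_1,\dots,x_d]$, $n\ge 1$, $\zeta\in k$ a primitive $n$-th root of unity, and let $G\subset \mathrm{SL}_d(k)$ be the cyclic group generated by $g=\mathrm{diag}(\zeta^{a_1},\dots,\zeta^{a_d})$, where the integers $a_j$ satisfy (B1) $0<a_j<n$ and $\gcd(n,a_j)=1$ for all $j$, and (B2) $a_1+\cdots+a_d=n$. Let $G$ act on $S$ by $g\cdot x_j=\zeta^{a_j}x_j$. Give $x_j$ weight $a_j$. For $0\le i<n$ let $T^i\subset S$ be the span of the monomials of weight congruent to $i$ modulo $n$; it is a graded $S^G$-module whose part of degree $\ell$ is spanned by the monomials of weight $\ell n+i$. Put $T=\bigoplus_{i=0}^{n-1}T^i$ (so $T=S$ as an $S^G$-module) and $B=\mathrm{End}_{S^G}(T)$, graded by letting $B_\ell$ be the endomorphisms that raise degrees by $\ell$. Let $e_i\in B$ $(i\in\mathbb Z/n)$ be the projection onto $T^i$, let $x_j^i\in B$ be multiplication by $x_j$ on $T^i$ and zero on the other summands, and $L=\bigoplus_i ke_i$. Let $Q$ be the quiver with vertices $\mathbb Z/n$ and arrows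 $x_j=x_j^i:i\to i+a_j$ $(1\le j\le d)$; paths are composed from right to left. Let $U_\ell$ be the quotient of the space $kQ_\ell$ spanned by the paths of length $\ell$ by all $v\otimes x_i\otimes x_j\otimes v'+v\otimes x_j\otimes x_i\otimes v'$, and write $x_{j_1}\wedge\cdots\wedge x_{j_\ell}$ for the class of a path. It is an $L$-bimodule through the end points of paths. An arrow $i\to i'$ has degree $0$ if $i<i'$ and degree $1$ if $i>i'$ (for representatives in $\{0,\dots,n-1\}$); the degree of a wedge is the sum of the degrees of its arrows. Let $P_\ell=B\otimes_L U_\ell\otimes_L B$ with the induced grading. Then: (0) The map $S*G\to B$, $s\gamma\mapsto (t\mapsto s\cdot\gamma(t))$, is an isomorphism from the skew group algebra onto $B$, and $B=\bigoplus_{\ell\ge 0}B_\ell$ is a positively graded algebra. (1) The formulas $$\delta_\ell\bigl(b\otimes (x_{j_1}\wedge\cdots\wedge x_{j_\ell})\otimes b'\bigr)=\sum_{i=1}^{\ell}(-1)^{i-1}\bigl(bx_{j_i}\otimes(x_{j_1}\wedge\cdots\widehat{x_{j_i}}\cdots\wedge x_{j_\ell})\otimes b'-b\otimes(x_{j_1}\wedge\cdots\widehat{x_{j_i}}\cdots\wedge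 x_{j_\ell})\otimes x_{j_i}b'\bigr)$$ and $\varepsilon(b\otimes e_s\otimes b')=be_sb'$ are well defined and make $P_\bullet=(P_d\to\cdots\to P_1\to P_0)$ with $\varepsilon:P_0\to B$ a resolution of the graded $B$-bimodule $B$ by finitely generated graded projective $B$-bimodules, with all maps homogeneous of degree $0$ and $P_\ell=0$ for $\ell>d$. (2) $P_\bullet\simeq P_\bullet^\vee[d](-1)$ as complexes of graded $B$-bimodules, where $(-)^\vee=\mathrm{Hom}_{B^{\mathrm e}}(-,B^{\mathrm e})$, $B^{\mathrm e}$ is the enveloping algebra, and $M(-1)_m=M_{m-1}$. (3) In particular $B$ is bimodule $d$-Calabi–Yau of Gorenstein parameter $1$: $d\ge 2$, and the bimodule $B$ has a bounded resolution $X_\bullet$ by finitely generated graded projective bimodules with $X_\bullet\simeq X_\bullet^\vee[d](-1)$ as complexes of graded bimodules. -/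

import Mathlib

open scoped TensorProduct

/-! ## Graded bimodules over a graded algebra -/

section Bimodules

universe u

/-- The enveloping algebra of `B`.  A left module over it is a `B`-`B`-bimodule on which `k` acts
centrally: `b ⊗ₜ op c` acts by `x ↦ b x c`. -/
def Env (k B : Type u) [Field k] [Ring B] [Algebra k B] : Type u := B ⊗[k] Bᵐᵒᵖ

noncomputable instance (k B : Type u) [Field k] [Ring B] [Algebra k B] : Ring (Env k B) :=
  inferInstanceAs (Ring (B ⊗[k] Bᵐᵒᵖ))

noncomputable instance (k B : Type u) [Field k] [Ring B] [Algebra k B] : Algebra k (Env k B) :=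
  inferInstanceAs (Algebra k (B ⊗[k] Bᵐᵒᵖ))

variable {k : Type u} [Field k] {B : Type u} [Ring B] [Algebra k B]

/-- The element `b ⊗ c` of the enveloping algebra. -/
noncomputable def envTmul (k : Type u) [Field k] {B : Type u} [Ring B] [Algebra k B] (b c : B) : Env k B :=
  b ⊗ₜ[k] MulOpposite.op c

/-- The subspaces `𝒜 m`, `m ∈ ℤ`, make `B` a positively graded algebra: `B = ⨁_{m ≥ 0} 𝒜 m`. -/
structure IsPositivelyGradedAlgebra (𝒜 : ℤ → Submodule k B) : Prop where
  internal : DirectSum.IsInternal 𝒜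
  one_mem : (1 : B) ∈ 𝒜 0
  mul_mem : ∀ i j : ℤ, ∀ b ∈ 𝒜 i, ∀ c ∈ 𝒜 j, b * c ∈ 𝒜 (i + j)
  eq_bot_of_neg : ∀ i : ℤ, i < 0 → 𝒜 i = ⊥

/-- The induced grading of the enveloping algebra. -/
noncomputable def envGrading (𝒜 : ℤ → Submodule k B) (m : ℤ) : Submodule k (Env k B) :=
  Submodule.span k {z | ∃ i j : ℤ, i + j = m ∧ ∃ b ∈ 𝒜 i, ∃ c ∈ 𝒜 j, z = envTmul k b c}

/-- The data `X 0 ← X 1 ← X 2 ← ⋯` with differentials `δ`, gradings `gr` and augmentation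
`ε : X 0 → B` form a bounded resolution of the graded bimodule `B` by finitely generated graded
projective bimodules, all maps being bimodule maps homogeneous of degree `0`. -/
structure IsGradedProjectiveResolution (𝒜 : ℤ → Submodule k B) {X : ℕ → Type u}
    [∀ l, AddCommGroup (X l)] [∀ l, Module k (X l)] [∀ l, Module (Env k B) (X l)]
    [∀ l, IsScalarTower k (Env k B) (X l)]
    (gr : ∀ l, ℤ → Submodule k (X l)) (δ : ∀ l, X (l + 1) →ₗ[Env k B] X l)
    (ε : X 0 →ₗ[k] B) : Prop where
  internal : ∀ l, DirectSum.IsInternal (gr l)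
  smul_mem : ∀ l, ∀ i m j : ℤ, ∀ b ∈ 𝒜 i, ∀ x ∈ gr l m, ∀ c ∈ 𝒜 j,
    envTmul k b c • x ∈ gr l (i + m + j)
  finite : ∀ l, Module.Finite (Env k B) (X l)
  projective : ∀ l, Module.Projective (Env k B) (X l)
  bounded : ∃ N, ∀ l, N < l → Subsingleton (X l)
  δ_mem : ∀ l m, ∀ x ∈ gr (l + 1) m, δ l x ∈ gr l m
  ε_mem : ∀ m, ∀ x ∈ gr 0 m, ε x ∈ 𝒜 m
  ε_smul : ∀ (b c : B) (x : X 0), ε (envTmul k b c • x) = b * ε x * c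
  ε_surjective : Function.Surjective ε
  exact_zero : Function.Exact (δ 0) ε
  exact_succ : ∀ l, Function.Exact (δ (l + 1)) (δ l)

/-- The degree `m` part of the dual bimodule `M^∨ = Hom_{B^e}(M, B^e)`: the bimodule maps that
raise degrees by `m`. -/
def dualGrading (𝒜 : ℤ → Submodule k B) {M : Type u} [AddCommGroup M] [Module k M]
    [Module (Env k B) M] (gr : ℤ → Submodule k M) (m : ℤ) : Set (M →ₗ[Env k B] Env k B) :=
  {f | ∀ i : ℤ, ∀ y ∈ gr i, f y ∈ envGrading 𝒜 (i + m)}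

/-- An isomorphism of complexes of graded bimodules `X ≅ X^∨[d](-1)`, where
`X^∨ = Hom_{B^e}(X, B^e)`.  In homological degree `p` the complex `X^∨[d]` is `(X q)^∨` with
`p + q = d`; it vanishes for `p > d`.  Its differential is `(-1) ^ d` times the transpose of `δ`.
The bimodule structure of `(X q)^∨` comes from the right multiplication of `B^e` on itself through
the canonical isomorphism `(B^e)ᵒᵖ ≅ B^e`, that is `(b f c)(y) = f(y) (c ⊗ b)`.  The twist is
`M(-1)_m = M_{m-1}`. -/
structure ShiftedSelfDuality (d : ℕ) (𝒜 : ℤ → Submodule k B) {X : ℕ → Type u}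
    [∀ l, AddCommGroup (X l)] [∀ l, Module k (X l)] [∀ l, Module (Env k B) (X l)]
    (gr : ∀ l, ℤ → Submodule k (X l)) (δ : ∀ l, X (l + 1) →ₗ[Env k B] X l) where
  vanish : ∀ l, d < l → Subsingleton (X l)
  φ : ∀ p q : ℕ, p + q = d → (X p ≃+ (X q →ₗ[Env k B] Env k B))
  φ_smul : ∀ p q h (b c : B) (x : X p) (y : X q),
    φ p q h (envTmul k b c • x) y = φ p q h x y * envTmul k c b
  φ_mem_iff : ∀ p q h (m : ℤ) (x : X p),
    φ p q h x ∈ dualGrading 𝒜 (gr q) (m - 1) ↔ x ∈ gr p m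
  φ_comm : ∀ (p q : ℕ) (h : p + 1 + q = d) (x : X (p + 1)),
    φ p (q + 1) (by omega) (δ p x) = (-1 : ℤ) ^ d • (φ (p + 1) q h x).comp (δ q)

/-- The positively graded algebra `B = ⨁ 𝒜 m` is bimodule `d`-Calabi-Yau of Gorenstein
parameter `1`: the bimodule `B` has a graded projective resolution `X` in `C^b(grproj B^e)`
(so that `B` is a perfect bimodule) with `X ≅ X^∨[d](-1)`. -/
def IsBimoduleCalabiYauGorensteinOne (d : ℕ) (𝒜 : ℤ → Submodule k B) : Prop :=
  2 ≤ d ∧ IsPositivelyGradedAlgebra 𝒜 ∧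
  ∃ (X : ℕ → Type u) (_ : ∀ l, AddCommGroup (X l)) (_ : ∀ l, Module k (X l))
    (_ : ∀ l, Module (Env k B) (X l)) (_ : ∀ l, IsScalarTower k (Env k B) (X l))
    (gr : ∀ l, ℤ → Submodule k (X l)) (δ : ∀ l, X (l + 1) →ₗ[Env k B] X l) (ε : X 0 →ₗ[k] B),
    IsGradedProjectiveResolution 𝒜 gr δ ε ∧ Nonempty (ShiftedSelfDuality d 𝒜 gr δ)

end Bimodules

/-! ## The McKay quiver and the Koszul-type bimodule complex -/

namespace McKay

universe u

variable {d : ℕ}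

/-- A path of length `l` in the McKay quiver, whose vertices are `ZMod n` and whose arrows are
`x_j : i ⟶ i + a j`: a starting vertex, and a word `x_{c 0} x_{c 1} ⋯ x_{c (l-1)}` written in the
order of composition, so that `x_{c (l-1)}` is the first arrow and `x_{c 0}` the last one. -/
structure QPath (n d l : ℕ) where
  src : ZMod n
  word : Fin l → Fin d

/-- The end vertex of a path. -/
def QPath.tgt {n l : ℕ} (a : Fin d → ℕ) (p : QPath n d l) : ZMod n :=
  p.src + ∑ r, (a (p.word r) : ZMod n)

/-- The degree of the arrow `x_j : i ⟶ i'`: it is `0` if `i < i'` and `1` otherwise, for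
representatives in `0, …, n - 1`. -/
def arrowDeg {n : ℕ} (a : Fin d → ℕ) (i : ZMod n) (j : Fin d) : ℤ :=
  if i.val < (i + (a j : ZMod n)).val then 0 else 1

/-- The degree of a path: the sum of the degrees of its arrows. The arrow `x_{c r}` starts where
the arrows `x_{c r'}`, `r' > r`, have led. -/
def QPath.deg {n l : ℕ} (a : Fin d → ℕ) (p : QPath n d l) : ℤ :=
  ∑ r, arrowDeg a (p.src + ∑ r' ∈ Finset.univ.filter (fun r' => r < r'), (a (p.word r') : ZMod n))
    (p.word r)

/-- The subspace of `kQ_l` generated by all `v ⊗ x_i ⊗ x_j ⊗ v' + v ⊗ x_j ⊗ x_i ⊗ v'`: two adjacent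
letters of a path are exchanged. -/
noncomputable def wedgeRel (k : Type u) [Field k] (n d l : ℕ) : Submodule k (QPath n d l →₀ k) :=
  Submodule.span k {z | ∃ (i : ZMod n) (c : Fin l → Fin d) (r : ℕ) (h : r + 1 < l),
    z = Finsupp.single ⟨i, c⟩ 1 +
      Finsupp.single ⟨i, c ∘ Equiv.swap ⟨r, Nat.lt_of_succ_lt h⟩ ⟨r + 1, h⟩⟩ 1}

/-- The space `U_l`, the quotient of `kQ_l` by the relations above. -/
abbrev U (k : Type u) [Field k] (n d l : ℕ) : Type u := (QPath n d l →₀ k) ⧸ wedgeRel k n d l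

/-- The class `x_{c 0} ∧ ⋯ ∧ x_{c (l-1)}` in `U_l` of a path. -/
noncomputable def wedge (k : Type u) [Field k] {n d l : ℕ} (p : QPath n d l) : U k n d l :=
  (wedgeRel k n d l).mkQ (Finsupp.single p 1)

section Complex

variable {k : Type u} [Field k] {B : Type u} [Ring B] [Algebra k B] {n : ℕ}

/-- The relations `b e_s ⊗ u ⊗ c = b ⊗ e_s u ⊗ c` and `b ⊗ u ⊗ e_s c = b ⊗ u e_s ⊗ c` that define
`B ⊗_L U_l ⊗_L B` as a quotient of the bimodule `B ⊗_k U_l ⊗_k B = B^e ⊗_k U_l`. Here `L = kQ_0` has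
the basis `e_s`, `s : ZMod n`, and acts on `U_l` through the end points of paths. -/
noncomputable def tensorRel (e : ZMod n → B) (a : Fin d → ℕ) (l : ℕ) :
    Submodule (Env k B) (Env k B ⊗[k] U k n d l) :=
  Submodule.span (Env k B)
    ({z | ∃ (s : ZMod n) (p : QPath n d l), z = envTmul k (e s) 1 ⊗ₜ[k] wedge k p -
        envTmul k 1 1 ⊗ₜ[k] (if s = p.tgt a then wedge k p else 0)} ∪
     {z | ∃ (s : ZMod n) (p : QPath n d l), z = envTmul k 1 (e s) ⊗ₜ[k] wedge k p -
        envTmul k 1 1 ⊗ₜ[k] (if s = p.src then wedge k p else 0)})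

/-- The bimodule `P_l = B ⊗_L U_l ⊗_L B`, for an algebra `B` with elements `e s`, the images of the
trivial paths. -/
abbrev P (k : Type u) [Field k] {B : Type u} [Ring B] [Algebra k B] (e : ZMod n → B)
    (a : Fin d → ℕ) (l : ℕ) : Type u :=
  (Env k B ⊗[k] U k n d l) ⧸ tensorRel (k := k) e a l

/-- The element `b ⊗ x_{c 0} ∧ ⋯ ∧ x_{c (l-1)} ⊗ b'` of `P_l`. -/
noncomputable def P.tmul (e : ZMod n → B) (a : Fin d → ℕ) {l : ℕ} (b : B) (p : QPath n d l) (b' : B) :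
    P k e a l :=
  (tensorRel (k := k) e a l).mkQ (envTmul k b b' ⊗ₜ[k] wedge k p)

/-- The grading of `P_l`: the generator given by a path `p` has degree `p.deg a`. -/
noncomputable def P.grading (𝒜 : ℤ → Submodule k B) (e : ZMod n → B) (a : Fin d → ℕ) (l : ℕ) (m : ℤ) :
    Submodule k (P k e a l) :=
  Submodule.span k {z | ∃ (i j : ℤ) (p : QPath n d l), i + p.deg a + j = m ∧
    ∃ b ∈ 𝒜 i, ∃ b' ∈ 𝒜 j, z = P.tmul e a b p b'}

/-- `δ l : P_{l+1} ⟶ P_l` is given by the formula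
`b ⊗ (x_{c 0} ∧ ⋯ ∧ x_{c l}) ⊗ b' ↦ ∑ i, (-1) ^ i (b x_{c i} ⊗ (⋯ omit x_{c i} ⋯) ⊗ b' -
b ⊗ (⋯ omit x_{c i} ⋯) ⊗ x_{c i} b')`.
The element `x s j` of `B` is the arrow `x_j : s ⟶ s + a j`. In the first term the arrow `x_{c i}`
is the last one, so it starts where the other arrows have led; in the second term it is the first
one, and the remaining path starts at its end. -/
def IsKoszulDifferential (e : ZMod n → B) (x : ZMod n → Fin d → B) (a : Fin d → ℕ)
    (δ : ∀ l, P k e a (l + 1) →ₗ[Env k B] P k e a l) : Prop :=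
  ∀ (l : ℕ) (b b' : B) (p : QPath n d (l + 1)),
    δ l (P.tmul e a b p b') = ∑ i : Fin (l + 1), (-1 : ℤ) ^ (i : ℕ) •
      (P.tmul e a (b * x (p.src + ∑ r, (a (p.word (i.succAbove r)) : ZMod n)) (p.word i))
          ⟨p.src, p.word ∘ i.succAbove⟩ b' -
        P.tmul e a b ⟨p.src + (a (p.word i) : ZMod n), p.word ∘ i.succAbove⟩
          (x p.src (p.word i) * b'))

/-- `ε : P_0 = B ⊗_L B ⟶ B` is the multiplication `b ⊗ e_s ⊗ b' ↦ b e_s b'`. -/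
def IsAugmentation (e : ZMod n → B) (a : Fin d → ℕ) (ε : P k e a 0 →ₗ[k] B) : Prop :=
  ∀ (b b' : B) (p : QPath n d 0), ε (P.tmul e a b p b') = b * e p.src * b'

end Complex

end McKay

/-! ## Cyclic quotient singularities -/

section LinearAction

variable {k : Type*} [Field k] {d : ℕ}

/-- The algebra endomorphism of the polynomial ring given by a matrix `A`, acting linearly on the
span of the variables: `x_j ↦ ∑ i, A i j x_i`. -/
noncomputable def matrixSubst (A : Matrix (Fin d) (Fin d) k) :
    MvPolynomial (Fin d) k →ₐ[k] MvPolynomial (Fin d) k :=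
  MvPolynomial.aeval fun j => ∑ i, MvPolynomial.C (A i j) * MvPolynomial.X i

theorem matrixSubst_X (A : Matrix (Fin d) (Fin d) k) (j : Fin d) :
    matrixSubst A (MvPolynomial.X j) = ∑ i, MvPolynomial.C (A i j) * MvPolynomial.X i := by
  simp [matrixSubst]

theorem matrixSubst_one : matrixSubst (1 : Matrix (Fin d) (Fin d) k) = AlgHom.id k _ := by
  apply MvPolynomial.algHom_ext
  intro j
  rw [matrixSubst_X, Finset.sum_eq_single j]
  · simp
  · intro i _ hij
    simp [Matrix.one_apply_ne hij]
  · simp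

theorem matrixSubst_mul (A A' : Matrix (Fin d) (Fin d) k) :
    matrixSubst (A * A') = (matrixSubst A).comp (matrixSubst A') := by
  apply MvPolynomial.algHom_ext
  intro j
  simp only [AlgHom.comp_apply, matrixSubst_X, map_sum, map_mul, Matrix.mul_apply,
    MvPolynomial.algHom_C, MvPolynomial.algebraMap_eq, Finset.mul_sum, Finset.sum_mul]
  rw [Finset.sum_comm]
  refine Finset.sum_congr rfl fun i _ => Finset.sum_congr rfl fun l _ => ?_
  ring

/-- The action of `SL_d(k)` on `S = k[x_1, …, x_d]` by linear substitutions. -/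
noncomputable instance slAction :
    MulSemiringAction (Matrix.SpecialLinearGroup (Fin d) k) (MvPolynomial (Fin d) k) where
  smul γ f := matrixSubst γ.1 f
  one_smul f := by
    change matrixSubst (1 : Matrix (Fin d) (Fin d) k) f = f
    rw [matrixSubst_one]; rfl
  mul_smul γ γ' f := by
    change matrixSubst (γ.1 * γ'.1) f = matrixSubst γ.1 (matrixSubst γ'.1 f)
    rw [matrixSubst_mul]; rfl
  smul_zero γ := map_zero (matrixSubst γ.1)
  smul_add γ := map_add (matrixSubst γ.1)
  smul_one γ := map_one (matrixSubst γ.1)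
  smul_mul γ := map_mul (matrixSubst γ.1)

theorem sl_smul_def (γ : Matrix.SpecialLinearGroup (Fin d) k) (f : MvPolynomial (Fin d) k) :
    γ • f = matrixSubst γ.1 f := rfl

instance slAction_smulCommClass (G : Subgroup (Matrix.SpecialLinearGroup (Fin d) k)) :
    SMulCommClass G k (MvPolynomial (Fin d) k) where
  smul_comm γ c f := map_smul (matrixSubst γ.1.1) c f

end LinearAction

/-- The data `1/n (a_1, …, a_d)` with a primitive `n`-th root of unity, satisfying
`0 < a_j < n` and `gcd(n, a_j) = 1` for all `j`, and `a_1 + ⋯ + a_d = n`. -/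
structure CyclicDatum (k : Type*) [Field k] (d n : ℕ) where
  n_pos : 0 < n
  ζ : k
  isPrimitiveRoot : IsPrimitiveRoot ζ n
  a : Fin d → ℕ
  pos : ∀ j, 0 < a j
  lt : ∀ j, a j < n
  coprime : ∀ j, Nat.Coprime n (a j)
  sum_eq : ∑ j, a j = n

namespace CyclicDatum

universe u

variable {k : Type u} [Field k] {d n : ℕ} (D : CyclicDatum k d n)

/-- The element `g = diag(ζ ^ a_1, …, ζ ^ a_d)` of `SL_d(k)`. -/
def g : Matrix.SpecialLinearGroup (Fin d) k :=
  ⟨Matrix.diagonal fun j => D.ζ ^ D.a j, by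
    rw [Matrix.det_diagonal, Finset.prod_pow_eq_pow_sum, D.sum_eq, D.isPrimitiveRoot.pow_eq_one]⟩

/-- The cyclic group `G` generated by `g`. -/
def G : Subgroup (Matrix.SpecialLinearGroup (Fin d) k) := Subgroup.zpowers D.g

/-- The invariant ring `R = S^G`. -/
noncomputable abbrev R : Subalgebra k (MvPolynomial (Fin d) k) :=
  FixedPoints.subalgebra k (MvPolynomial (Fin d) k) D.G

/-- The algebra `B = End_{S^G}(T)`. As an `S^G`-module `T = ⨁_{0 ≤ i < n} T^i` is `S`, the summand
`T^i` being spanned by the monomials of weight congruent to `i` modulo `n`, where `x_j` has weight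
`a j` (so its degree in the grading of `S` by `ℤ/n` is `a_j / n`). -/
abbrev B : Type u := Module.End D.R (MvPolynomial (Fin d) k)

/-- The weight of the monomial with exponent `u`. -/
noncomputable def wt (u : Fin d →₀ ℕ) : ℕ := Finsupp.weight D.a u

/-- The degree `m` part of the graded module `T`: the degree `m` part of `T^i` is spanned by the
monomials of weight `m n + i`, and `0 ≤ i < n`. -/
noncomputable def Tdeg (m : ℤ) : Submodule k (MvPolynomial (Fin d) k) :=
  Submodule.span k {f | ∃ u : Fin d →₀ ℕ, ∃ i : ℕ, i < n ∧ (D.wt u : ℤ) = m * n + i ∧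
    f = MvPolynomial.monomial u 1}

/-- The grading of `B = End_{S^G}(T)`: the degree `m` part consists of the endomorphisms that raise
degrees by `m`. -/
noncomputable def gradingB (m : ℤ) : Submodule k D.B where
  carrier := {f | ∀ i : ℤ, ∀ t ∈ D.Tdeg i, f t ∈ D.Tdeg (i + m)}
  zero_mem' := fun _ _ _ => Submodule.zero_mem _
  add_mem' := fun hf hf' i t ht => Submodule.add_mem _ (hf i t ht) (hf' i t ht)
  smul_mem' := fun c _ hf i t ht => Submodule.smul_mem _ c (hf i t ht)

open Classical in
/-- The `k`-linear projection of `S` onto the span `T^i` of the monomials of weight congruent to `i`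
modulo `n`. -/
noncomputable def projLin (i : ZMod n) :
    MvPolynomial (Fin d) k →ₗ[k] MvPolynomial (Fin d) k :=
  (MvPolynomial.basisMonomials (Fin d) k).constr k fun u =>
    if (D.wt u : ZMod n) = i then MvPolynomial.monomial u 1 else 0

theorem projLin_monomial (i : ZMod n) (u : Fin d →₀ ℕ) (c : k) :
    D.projLin i (MvPolynomial.monomial u c) =
      if (D.wt u : ZMod n) = i then MvPolynomial.monomial u c else 0 := by
  have h : MvPolynomial.monomial u c
      = c • (MvPolynomial.basisMonomials (Fin d) k) u := by
    simp [MvPolynomial.smul_monomial]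
  rw [h, map_smul, projLin, Module.Basis.constr_basis]
  split_ifs <;> simp

theorem matrixSubst_g_monomial (u : Fin d →₀ ℕ) (c : k) :
    matrixSubst D.g.1 (MvPolynomial.monomial u c) =
      MvPolynomial.monomial u (D.ζ ^ D.wt u * c) := by
  have hX : ∀ j, matrixSubst D.g.1 (MvPolynomial.X j) =
      MvPolynomial.C (D.ζ ^ D.a j) * MvPolynomial.X j := by
    intro j
    rw [matrixSubst_X, Finset.sum_eq_single j]
    · simp [g]
    · intro i _ hij
      simp [g, Matrix.diagonal_apply_ne _ hij]
    · simp
  rw [MvPolynomial.monomial_eq, MvPolynomial.monomial_eq, Finsupp.prod_fintype _ _ (by simp)]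
  simp only [map_mul, map_prod, map_pow, hX, MvPolynomial.algHom_C, MvPolynomial.algebraMap_eq,
    mul_pow, Finset.prod_mul_distrib]
  have hw : ∏ j, ((MvPolynomial.C D.ζ : MvPolynomial (Fin d) k) ^ D.a j) ^ u j =
      MvPolynomial.C D.ζ ^ D.wt u := by
    rw [wt, Finsupp.weight_apply, Finsupp.sum_fintype _ _ (by simp), ← Finset.prod_pow_eq_pow_sum]
    refine Finset.prod_congr rfl fun j _ => ?_
    rw [← pow_mul, smul_eq_mul, mul_comm]
  rw [hw]
  ring

theorem coeff_matrixSubst_g (r : MvPolynomial (Fin d) k) (u : Fin d →₀ ℕ) :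
    MvPolynomial.coeff u (matrixSubst D.g.1 r) = D.ζ ^ D.wt u * MvPolynomial.coeff u r := by
  classical
  induction r using MvPolynomial.induction_on' with
  | monomial v c =>
    rw [matrixSubst_g_monomial, MvPolynomial.coeff_monomial, MvPolynomial.coeff_monomial]
    split_ifs with h
    · rw [h]
    · simp
  | add p q hp hq => rw [map_add, MvPolynomial.coeff_add, hp, hq, MvPolynomial.coeff_add, mul_add]

/-- The monomials of an invariant polynomial have weight divisible by `n`. -/
theorem wt_eq_zero_of_mem (r : MvPolynomial (Fin d) k) (hr : r ∈ D.R) (u : Fin d →₀ ℕ)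
    (hu : MvPolynomial.coeff u r ≠ 0) : (D.wt u : ZMod n) = 0 := by
  have h1 : matrixSubst D.g.1 r = r := hr ⟨D.g, Subgroup.mem_zpowers D.g⟩
  have h2 := D.coeff_matrixSubst_g r u
  rw [h1] at h2
  have h3 : D.ζ ^ D.wt u = 1 := by
    have : (D.ζ ^ D.wt u - 1) * MvPolynomial.coeff u r = 0 := by
      rw [sub_mul, ← h2, one_mul, sub_self]
    rcases mul_eq_zero.1 this with h | h
    · exact sub_eq_zero.1 h
    · exact absurd h hu
  exact (ZMod.natCast_eq_zero_iff _ _).2 ((D.isPrimitiveRoot.pow_eq_one_iff_dvd _).1 h3)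

theorem projLin_mul (i : ZMod n) (r f : MvPolynomial (Fin d) k) (hr : r ∈ D.R) :
    D.projLin i (r * f) = r * D.projLin i f := by
  have key : ∀ u : Fin d →₀ ℕ, MvPolynomial.coeff u r ≠ 0 → ∀ f : MvPolynomial (Fin d) k,
      D.projLin i (MvPolynomial.monomial u (MvPolynomial.coeff u r) * f) =
        MvPolynomial.monomial u (MvPolynomial.coeff u r) * D.projLin i f := by
    intro u hu f
    induction f using MvPolynomial.induction_on' with
    | monomial v c =>
      have hw : (D.wt (u + v) : ZMod n) = D.wt v := by
        have h0 := D.wt_eq_zero_of_mem r hr u hu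
        rw [wt, map_add, Nat.cast_add]
        rw [wt] at h0
        rw [h0, zero_add, wt]
      rw [MvPolynomial.monomial_mul, projLin_monomial, projLin_monomial, hw]
      split_ifs
      · rw [MvPolynomial.monomial_mul]
      · rw [mul_zero]
    | add p q hp hq => rw [mul_add, map_add, hp, hq, map_add, mul_add]
  calc D.projLin i (r * f)
      = D.projLin i ((∑ u ∈ r.support, MvPolynomial.monomial u (MvPolynomial.coeff u r)) * f) := by
        rw [← MvPolynomial.as_sum]
    _ = (∑ u ∈ r.support, MvPolynomial.monomial u (MvPolynomial.coeff u r)) * D.projLin i f := by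
        rw [Finset.sum_mul, map_sum, Finset.sum_mul]
        exact Finset.sum_congr rfl fun u hu => key u (MvPolynomial.mem_support_iff.1 hu) f
    _ = r * D.projLin i f := by rw [← MvPolynomial.as_sum]

/-- The idempotent `e_i` of `B` associated with the direct summand `T^i` of `T`. -/
noncomputable def e (i : ZMod n) : D.B where
  toFun := D.projLin i
  map_add' := map_add _
  map_smul' := fun r f => D.projLin_mul i r.1 f r.2

/-- The arrow `x_j : i ⟶ i + a_j` as an element of `B`: multiplication by `x_j` on `T^i`, and zero
on the other summands of `T`. -/
noncomputable def arrow (i : ZMod n) (j : Fin d) : D.B :=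
  LinearMap.mulLeft D.R (MvPolynomial.X j) * D.e i

end CyclicDatum

/-! The algebra `B` is reduced to polynomials first. As every `a_j` is invertible modulo `n`, each
summand `T^i` contains a power of every variable. An `S^G`-linear map `f` satisfies `f(s) t = f(t)
s` for `s, t` in the same `T^i`, because one monomial brings both into `S^G`; so on `T^i` it is
multiplication by a fraction. Its denominator may be taken to be a power of either of two different
variables, and `d ≥ 2`, so the fraction is a polynomial (`exists_mul_of_end`). Hence `B = ⨁ S e_i`
with basis the maps `x^u e_i`. The map from `S * G` is injective by Dedekind's independence of
characters, and surjective because the `e_i` are Fourier averages of powers of `g`.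

All degrees are controlled by one formula. For `x^u e_i`, for an arrow and for a path, `n * degree =
weight + val(source) - val(target)` (`monDeg_spec`, `arrowDeg_spec`, `deg_spec`). Degree is
therefore additive under composition and insensitive to the order of the letters, which makes the
differential homogeneous. A closed path that uses every variable once has weight `n`, hence degree
`1`; this is the Gorenstein parameter.

For exactness, the vertices are summed away: the element `wgen w`, the sum of the generators with
word `w` over all starting vertices, depends only on a word. As a vector space `P_l` is then the sum
over `t` of copies of `(S ⊗ S) ⊗ Λ^l`, embedded by the maps `T t w` (`tmul_eq_sum_T`,
`exists_k_lift`). In this description `δ` is the Koszul differential of the elements `z_j = x_j ⊗ 1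
- 1 ⊗ x_j`, and `S ⊗ S` is a polynomial ring in the `z_j` over its second factor. The de Rham
operator `h = ∑ ∂_j (x_j ∧ -)` satisfies Cartan's formula `δ h + h δ = l + ∑ z_j ∂_j`
(`diff_homot_add`). Its eigenvalue on the part of wedge degree `l` and polynomial degree `r` in the
`z_j` is `l + r`. In characteristic zero this is invertible except for `l = r = 0`, where the part
that remains is `B`, seen through the augmentation.

For the duality, `P_p` is paired with `P_q`, `p + q = d`, by sending two words to the sign of their
concatenation (`orient`), times the sum `Om` of the idempotents `e_s ⊗ e_{s'}` that match the end
points. Increasing words generate, and complementary increasing words are dual to each other, so the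
pairing is perfect. Compatibility with `δ` is the Laplace expansion of a determinant with two equal
columns (`sum_wordDet_succAbove`), and the shift of the degrees is `deg_add_deg`. -/

section HomogeneousBases

/-! ### Direct sum decompositions detected by projections -/

variable {k M : Type*} [Field k] [AddCommGroup M] [Module k M]

theorem iSupIndep_of_proj {gr : ℤ → Submodule k M} (π : ℤ → M →ₗ[k] M)
    (h : ∀ m m' x, x ∈ gr m → π m' x = if m = m' then x else 0) : iSupIndep gr := by
  rw [iSupIndep_def]
  intro i
  rw [Submodule.disjoint_def]
  intro x hx hx'
  have h1 : π i x = x := by rw [h i i x hx, if_pos rfl]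
  have h2 : (⨆ j, ⨆ (_ : j ≠ i), gr j) ≤ LinearMap.ker (π i) := by
    refine iSup₂_le fun j hj y hy => ?_
    rw [LinearMap.mem_ker, h j i y hy, if_neg hj]
  rw [← h1]
  exact h2 hx'

theorem isInternal_of_proj {gr : ℤ → Submodule k M} (π : ℤ → M →ₗ[k] M)
    (h : ∀ m m' x, x ∈ gr m → π m' x = if m = m' then x else 0)
    (htop : ⨆ m, gr m = ⊤) : DirectSum.IsInternal gr :=
  (DirectSum.isInternal_submodule_iff_iSupIndep_and_iSup_eq_top gr).2
    ⟨iSupIndep_of_proj π h, htop⟩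

theorem isInternal_span_basis {ι : Type*} (b : Module.Basis ι k M) (deg : ι → ℤ) :
    DirectSum.IsInternal fun m => Submodule.span k (b '' {i | deg i = m}) := by
  refine isInternal_of_proj (fun m => b.constr k fun i => if deg i = m then b i else 0) ?_ ?_
  · intro m m' x hx
    induction hx using Submodule.span_induction with
    | mem x hx =>
      obtain ⟨i, hi, rfl⟩ := hx
      rw [Module.Basis.constr_basis, show deg i = m from hi]
    | zero => simp
    | add x y _ _ hx hy => rw [map_add, hx, hy]; split_ifs <;> simp
    | smul c x _ hx => rw [map_smul, hx]; split_ifs <;> simp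
  · rw [eq_top_iff, ← b.span_eq, Submodule.span_le]
    rintro _ ⟨i, rfl⟩
    exact Submodule.mem_iSup_of_mem (deg i) (Submodule.subset_span ⟨i, rfl, rfl⟩)

end HomogeneousBases

namespace CyclicDatum

open MvPolynomial

universe u

variable {k : Type u} [Field k] {d n : ℕ} (D : CyclicDatum k d n)

/-! ### Elementary properties of the datum -/

/-- An empty sum is not the positive number `n`, and a single weight `a_0 = n` contradicts `a_0 <
n`. The two variables obtained here are what makes fractions polynomial in `exists_mul_of_end`. -/
theorem two_le_d (D : CyclicDatum k d n) : 2 ≤ d := by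
  have hs := D.sum_eq
  have hn := D.n_pos
  match d, D, hs with
  | 0, D, hs => simp at hs; omega
  | 1, D, hs => have := D.lt 0; simp at hs; omega
  | d + 2, _, _ => omega

theorem wt_add (u v : Fin d →₀ ℕ) : D.wt (u + v) = D.wt u + D.wt v := by
  simp [wt]

theorem wt_single (j : Fin d) (m : ℕ) : D.wt (Finsupp.single j m) = m * D.a j := by
  simp [wt, Finsupp.weight_single]

theorem wt_zero : D.wt 0 = 0 := by simp [wt]

theorem sum_a_cast : ∑ j, (D.a j : ZMod n) = 0 := by
  rw [← Nat.cast_sum, D.sum_eq, ZMod.natCast_self]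

/-! ### The projections onto the summands -/

/-- Weights add under multiplication, so a factor in `T^t` reaches `T^s` only through the part of
weight `s - t` of the other factor. -/
theorem projLin_mul_projLin (s t : ZMod n) (g f : MvPolynomial (Fin d) k) :
    D.projLin s (g * D.projLin t f) = D.projLin (s - t) g * D.projLin t f := by
  induction g using MvPolynomial.induction_on' with
  | add p q hp hq => rw [add_mul, map_add, hp, hq, map_add, add_mul]
  | monomial u c =>
    induction f using MvPolynomial.induction_on' with
    | add p q hp hq => rw [map_add, mul_add, map_add, hp, hq, mul_add]
    | monomial v c' =>
      rw [projLin_monomial, projLin_monomial]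
      by_cases hv : (D.wt v : ZMod n) = t
      · have : ((D.wt (u + v) : ℕ) : ZMod n) = s ↔ (D.wt u : ZMod n) = s - t := by
          rw [wt_add, Nat.cast_add, hv, eq_sub_iff_add_eq]
        rw [if_pos hv, monomial_mul, projLin_monomial]
        simp only [this]
        split_ifs
        · rw [monomial_mul]
        · rw [zero_mul]
      · rw [if_neg hv, mul_zero, map_zero, mul_zero]

theorem projLin_projLin (s t : ZMod n) (f : MvPolynomial (Fin d) k) :
    D.projLin s (D.projLin t f) = if s = t then D.projLin t f else 0 := by
  induction f using MvPolynomial.induction_on' with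
  | add p q hp hq => rw [map_add, map_add, hp, hq]; split_ifs <;> simp
  | monomial v c' =>
    rw [projLin_monomial]
    by_cases hv : (D.wt v : ZMod n) = t
    · rw [if_pos hv, projLin_monomial, hv]
      simp only [eq_comm]
    · simp [if_neg hv]

theorem projLin_X_mul (s : ZMod n) (j : Fin d) (f : MvPolynomial (Fin d) k) :
    D.projLin (s + D.a j) (X j * f) = X j * D.projLin s f := by
  induction f using MvPolynomial.induction_on' with
  | add p q hp hq => rw [mul_add, map_add, hp, hq, map_add, mul_add]
  | monomial v c =>
    have h : (X j : MvPolynomial (Fin d) k) * monomial v c =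
        monomial (Finsupp.single j 1 + v) c := by
      rw [X, monomial_mul, one_mul]
    have h2 : ((D.wt (Finsupp.single j 1 + v) : ℕ) : ZMod n) = s + D.a j ↔ (D.wt v : ZMod n) = s := by
      rw [wt_add, wt_single, one_mul, Nat.cast_add, add_comm, add_left_inj]
    rw [h, projLin_monomial, projLin_monomial]
    simp only [h2]
    split_ifs
    · rw [h]
    · rw [mul_zero]

section

variable [NeZero n]

theorem sum_projLin (f : MvPolynomial (Fin d) k) : ∑ i, D.projLin i f = f := by
  induction f using MvPolynomial.induction_on' with
  | add p q hp hq => simp only [map_add, Finset.sum_add_distrib, hp, hq]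
  | monomial v c => simp [projLin_monomial]

end

theorem e_apply (i : ZMod n) (f : MvPolynomial (Fin d) k) : D.e i f = D.projLin i f := rfl

theorem e_mul_e (i j : ZMod n) : D.e i * D.e j = if i = j then D.e j else 0 := by
  refine LinearMap.ext fun f => ?_
  rw [Module.End.mul_apply, e_apply, e_apply, projLin_projLin]
  split_ifs <;> rfl

theorem sum_e [NeZero n] : ∑ i, D.e i = 1 := by
  refine LinearMap.ext fun f => ?_
  rw [LinearMap.sum_apply]
  exact D.sum_projLin f

/-- Multiplication by a polynomial, as an element of `B`. -/
noncomputable def mulL : MvPolynomial (Fin d) k →ₗ[k] D.B where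
  toFun f := LinearMap.mulLeft D.R f
  map_add' f g := LinearMap.ext fun t => add_mul f g t
  map_smul' c f := LinearMap.ext fun t => smul_mul_assoc c f t

theorem mulL_one : D.mulL 1 = 1 := LinearMap.ext fun t => one_mul t

theorem mulL_mul (f g : MvPolynomial (Fin d) k) : D.mulL (f * g) = D.mulL f * D.mulL g :=
  LinearMap.ext fun t => mul_assoc f g t

theorem arrow_eq (i : ZMod n) (j : Fin d) : D.arrow i j = D.mulL (X j) * D.e i := rfl

theorem arrow_eq' (i : ZMod n) (j : Fin d) : D.arrow i j = D.e (i + D.a j) * D.mulL (X j) :=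
  LinearMap.ext fun t => (D.projLin_X_mul i j t).symm

theorem e_mul_mulL_mul_e (s t : ZMod n) (g : MvPolynomial (Fin d) k) :
    D.e s * (D.mulL g * D.e t) = D.mulL (D.projLin (s - t) g) * D.e t :=
  LinearMap.ext fun f => D.projLin_mul_projLin s t g f

theorem e_mul_arrow (s i : ZMod n) (j : Fin d) :
    D.e s * D.arrow i j = if s = i + D.a j then D.arrow i j else 0 := by
  rw [arrow_eq', ← mul_assoc, e_mul_e, ite_mul, zero_mul]

/-! ### Endomorphisms are given by multiplications -/

/-- The generator `g` scales a monomial of weight `w` by `ζ ^ w`, which is `1` when `n` divides `w`.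
The stabilizer of `f` is a subgroup containing `g`, hence contains `G`. -/
theorem mem_R_of_projLin (f : MvPolynomial (Fin d) k) (hf : D.projLin 0 f = f) : f ∈ D.R := by
  have h1 : matrixSubst D.g.1 f = f := by
    rw [← hf]
    clear hf
    induction f using MvPolynomial.induction_on' with
    | add p q hp hq => rw [map_add, map_add, hp, hq]
    | monomial v c =>
      rw [projLin_monomial]
      split_ifs with h
      · rw [matrixSubst_g_monomial, (D.isPrimitiveRoot.pow_eq_one_iff_dvd _).2
          ((ZMod.natCast_eq_zero_iff _ _).1 h), one_mul]
      · exact map_zero _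
  have h2 : D.G ≤ MulAction.stabilizer (Matrix.SpecialLinearGroup (Fin d) k) f := by
    rw [G, Subgroup.zpowers_le]
    exact h1
  exact fun γ => h2 γ.2

/-- Coprimality of `a_j` and `n` is used here: the exponent solves `m a_j = i` in `ZMod n`. -/
theorem exists_pow_mem (i : ZMod n) [NeZero n] (j : Fin d) :
    ∃ m : ℕ, D.projLin i (X j ^ m) = (X j ^ m : MvPolynomial (Fin d) k) := by
  refine ⟨(i * (D.a j : ZMod n)⁻¹).val, ?_⟩
  rw [X_pow_eq_monomial, projLin_monomial, if_pos]
  rw [wt_single, Nat.cast_mul, ZMod.natCast_zmod_val, mul_assoc, mul_comm _ (D.a j : ZMod n),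
    ZMod.coe_mul_inv_eq_one _ (D.coprime j).symm, mul_one]

/-- A monomial `r` of weight `-i` makes `r s` and `r t` invariant. Computing `f(r s t)` with either
invariant taken out gives `r s f(t) = r t f(s)`, and `r` cancels. This says that `f` acts on `T^i`
by a fraction. -/
theorem apply_mul_comm [NeZero n] (f : D.B) (i : ZMod n) {s t : MvPolynomial (Fin d) k}
    (hs : D.projLin i s = s) (ht : D.projLin i t = t) : f s * t = f t * s := by
  obtain ⟨m, hm⟩ := D.exists_pow_mem (-i) (⟨0, by have := D.two_le_d; omega⟩ : Fin d)
  set r : MvPolynomial (Fin d) k := X ⟨0, by have := D.two_le_d; omega⟩ ^ m with hr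
  have hr0 : r ≠ 0 := pow_ne_zero _ (X_ne_zero _)
  have key : ∀ s : MvPolynomial (Fin d) k, D.projLin i s = s → r * s ∈ D.R := by
    intro s hs
    refine D.mem_R_of_projLin _ ?_
    rw [← hs, projLin_mul_projLin, zero_sub, hm]
  have h1 : f ((r * s) * t) = (r * s) * f t := f.map_smul ⟨r * s, key s hs⟩ t
  have h2 : f ((r * t) * s) = (r * t) * f s := f.map_smul ⟨r * t, key t ht⟩ s
  rw [mul_right_comm, h2] at h1
  refine mul_left_cancel₀ hr0 ?_
  linear_combination h1

/-- The multiplier of `f` on `T^i` is the fraction `f(x_0^{m0}) / x_0^{m0}`, and also `f(x_1^{m1}) /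
x_1^{m1}`. The two denominators have no common factor, so the fraction is a polynomial. -/
theorem exists_mul_of_end [NeZero n] (f : D.B) (i : ZMod n) :
    ∃ h : MvPolynomial (Fin d) k, f * D.e i = D.mulL h * D.e i := by
  have hd := D.two_le_d
  let j0 : Fin d := ⟨0, by omega⟩
  let j1 : Fin d := ⟨1, by omega⟩
  obtain ⟨m0, h0⟩ := D.exists_pow_mem i j0
  obtain ⟨m1, h1⟩ := D.exists_pow_mem i j1
  have hX : Prime (X j0 : MvPolynomial (Fin d) k) := X_prime
  have hndvd : ¬ (X j0 : MvPolynomial (Fin d) k) ∣ X j1 ^ m1 := by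
    intro h
    have := X_dvd_X.1 (hX.dvd_of_dvd_pow h)
    simp [j0, j1] at this
  -- From `f(x_0^{m0}) x_1^{m1} = f(x_1^{m1}) x_0^{m0}`, where the prime `x_0` does not divide
  -- `x_1^{m1}`.
  have hdvd : (X j0 : MvPolynomial (Fin d) k) ^ m0 ∣ f (X j0 ^ m0) :=
    hX.pow_dvd_of_dvd_mul_right m0 hndvd
      ⟨f (X j1 ^ m1), by rw [D.apply_mul_comm f i h0 h1, mul_comm]⟩
  obtain ⟨h, hh⟩ := hdvd
  refine ⟨h, LinearMap.ext fun t => ?_⟩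
  change f (D.projLin i t) = h * D.projLin i t
  have ht : D.projLin i (D.projLin i t) = D.projLin i t := by rw [projLin_projLin, if_pos rfl]
  have h2 := D.apply_mul_comm f i ht h0
  refine mul_left_cancel₀ (pow_ne_zero m0 (X_ne_zero j0)) ?_
  rw [mul_comm, h2, hh, mul_assoc]

/-- Evaluation at one nonzero element of `T^i` suffices, as `S` is a domain. -/
theorem mulL_mul_e_injective [NeZero n] {i : ZMod n} {h h' : MvPolynomial (Fin d) k}
    (heq : D.mulL h * D.e i = D.mulL h' * D.e i) : h = h' := by
  obtain ⟨m, hm⟩ := D.exists_pow_mem i (⟨0, by have := D.two_le_d; omega⟩ : Fin d)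
  have := LinearMap.congr_fun heq (X ⟨0, by have := D.two_le_d; omega⟩ ^ m)
  change h * D.projLin i _ = h' * D.projLin i _ at this
  rw [hm] at this
  exact mul_right_cancel₀ (pow_ne_zero m (X_ne_zero _)) this

/-! ### The algebra `B` as families of polynomials indexed by `ℤ/n` -/

section Comp

variable [NeZero n]

/-- The endomorphism that multiplies the summand `T^i` by the polynomial `h i`. -/
noncomputable def ofComp : (ZMod n → MvPolynomial (Fin d) k) →ₗ[k] D.B where
  toFun h := ∑ i, D.mulL (h i) * D.e i
  map_add' h h' := by simp only [Pi.add_apply, map_add, add_mul, Finset.sum_add_distrib]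
  map_smul' c h := by
    simp only [Pi.smul_apply, map_smul, smul_mul_assoc, Finset.smul_sum, RingHom.id_apply]

theorem ofComp_apply (h : ZMod n → MvPolynomial (Fin d) k) :
    D.ofComp h = ∑ i, D.mulL (h i) * D.e i := rfl

theorem ofComp_mul_e (h : ZMod n → MvPolynomial (Fin d) k) (i : ZMod n) :
    D.ofComp h * D.e i = D.mulL (h i) * D.e i := by
  rw [ofComp_apply, Finset.sum_mul, Finset.sum_eq_single i]
  · rw [mul_assoc, e_mul_e, if_pos rfl]
  · intro j _ hj
    rw [mul_assoc, e_mul_e, if_neg hj, mul_zero]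
  · simp

theorem ofComp_bijective : Function.Bijective D.ofComp := by
  refine ⟨fun h h' heq => funext fun i => ?_, fun f => ?_⟩
  · apply D.mulL_mul_e_injective (i := i)
    rw [← ofComp_mul_e, heq, ofComp_mul_e]
  · choose h hh using D.exists_mul_of_end f
    refine ⟨h, ?_⟩
    rw [ofComp_apply, ← Finset.sum_congr rfl fun i _ => hh i, ← Finset.mul_sum, sum_e, mul_one]

/-- `B` is the space of families of polynomials indexed by `ℤ/n`. -/
noncomputable def compEquiv : (ZMod n → MvPolynomial (Fin d) k) ≃ₗ[k] D.B :=
  LinearEquiv.ofBijective D.ofComp D.ofComp_bijective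

/-- The polynomial by which `f` multiplies the summand `T^i`. -/
noncomputable def comp (i : ZMod n) : D.B →ₗ[k] MvPolynomial (Fin d) k :=
  (LinearMap.proj i).comp D.compEquiv.symm.toLinearMap

theorem sum_comp (f : D.B) : ∑ i, D.mulL (D.comp i f) * D.e i = f :=
  D.compEquiv.apply_symm_apply f

theorem mulL_comp_mul_e (f : D.B) (i : ZMod n) : D.mulL (D.comp i f) * D.e i = f * D.e i := by
  conv_rhs => rw [← D.sum_comp f]
  exact (D.ofComp_mul_e (fun i => D.comp i f) i).symm

theorem comp_eq_of {f : D.B} {i : ZMod n} {h : MvPolynomial (Fin d) k}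
    (hf : f * D.e i = D.mulL h * D.e i) : D.comp i f = h := by
  apply D.mulL_mul_e_injective (i := i)
  rw [mulL_comp_mul_e, hf]

theorem comp_mulL (h : MvPolynomial (Fin d) k) (i : ZMod n) : D.comp i (D.mulL h) = h :=
  D.comp_eq_of rfl

theorem comp_mul_e (f : D.B) (i s : ZMod n) :
    D.comp i (f * D.e s) = if i = s then D.comp s f else 0 := by
  apply D.comp_eq_of
  rw [mul_assoc, e_mul_e]
  by_cases h : i = s
  · subst h
    rw [if_pos rfl, if_pos rfl, mulL_comp_mul_e]
  · rw [if_neg (Ne.symm h), if_neg h, map_zero, mul_zero, zero_mul]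

theorem comp_e_mul (f : D.B) (i s : ZMod n) :
    D.comp i (D.e s * f) = D.projLin (s - i) (D.comp i f) := by
  apply D.comp_eq_of
  rw [mul_assoc, ← mulL_comp_mul_e, e_mul_mulL_mul_e]

end Comp

/-! ### The skew group algebra -/

/-- The algebra of endomorphisms given by an element of the group. -/
noncomputable def actB : D.G →* D.B where
  toFun γ :=
    { toFun := fun t => γ • t
      map_add' := fun s t => smul_add γ s t
      map_smul' := fun r t => by
        change γ • (r.1 * t) = r.1 * γ • t
        rw [smul_mul', r.2 γ] }
  map_one' := LinearMap.ext fun t => one_smul _ t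
  map_mul' γ γ' := LinearMap.ext fun t => mul_smul γ γ' t

/-- Multiplication by polynomials as a ring homomorphism. -/
noncomputable def mulRingHom : MvPolynomial (Fin d) k →+* D.B where
  toFun := D.mulL
  map_one' := D.mulL_one
  map_mul' := D.mulL_mul
  map_zero' := map_zero _
  map_add' := map_add _

/-- The action of the skew group algebra on the polynomial ring. -/
noncomputable def skewHom : SkewMonoidAlgebra (MvPolynomial (Fin d) k) D.G →+* D.B :=
  SkewMonoidAlgebra.liftNCRingHom D.mulRingHom D.actB fun {f γ} =>
    LinearMap.ext fun t => (smul_mul' γ f t).symm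

theorem skewHom_single (γ : D.G) (s t : MvPolynomial (Fin d) k) :
    D.skewHom (SkewMonoidAlgebra.single γ s) t = s * (γ • t) := by
  have : D.skewHom (SkewMonoidAlgebra.single γ s) = D.mulL s * D.actB γ :=
    SkewMonoidAlgebra.liftNC_single _ _ _ _
  rw [this]
  rfl

/-- The entries of the matrix are the linear coefficients of the images of the variables. -/
theorem smul_injective {γ γ' : D.G}
    (h : ∀ t : MvPolynomial (Fin d) k, γ • t = γ' • t) : γ = γ' := by
  apply Subtype.ext
  apply Subtype.ext
  ext i j
  have h1 := h (X j)
  change matrixSubst γ.1.1 (X j) = matrixSubst γ'.1.1 (X j) at h1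
  rw [matrixSubst_X, matrixSubst_X] at h1
  have h2 := congrArg (coeff (Finsupp.single i 1)) h1
  simpa [coeff_sum, coeff_C_mul, coeff_X, Finsupp.single_left_inj] using h2

/-- Distinct elements of `G` act by distinct multiplicative maps from `S` to the domain `S`. By
Dedekind's theorem these are linearly independent over `S`, and `x.coeff` is a relation among them.
-/
theorem skewHom_injective : Function.Injective D.skewHom := by
  rw [injective_iff_map_eq_zero]
  intro x hx
  have hli : LinearIndependent (MvPolynomial (Fin d) k)
      (fun γ : D.G => ((fun t => γ • t) : MvPolynomial (Fin d) k → MvPolynomial (Fin d) k)) :=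
    (linearIndependent_monoidHom (MvPolynomial (Fin d) k) (MvPolynomial (Fin d) k)).comp
      (fun γ : D.G => MulSemiringAction.toRingHom D.G _ γ |>.toMonoidHom)
      fun γ γ' h => D.smul_injective fun t => DFunLike.congr_fun h t
  rw [linearIndependent_iff] at hli
  have h0 : x.coeff = 0 := by
    apply hli
    funext t
    have h1 := LinearMap.congr_fun hx t
    rw [← SkewMonoidAlgebra.sum_single x, SkewMonoidAlgebra.sum, map_finsuppSum] at h1
    rw [Finsupp.linearCombination_apply, Finsupp.sum, Finset.sum_apply]
    rw [Finsupp.sum, LinearMap.sum_apply] at h1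
    simp only [skewHom_single] at h1
    exact h1
  exact SkewMonoidAlgebra.ext fun a => by rw [h0]; rfl

theorem smul_g_pow_monomial (i : ℕ) (u : Fin d →₀ ℕ) (c : k) :
    ((⟨D.g, Subgroup.mem_zpowers D.g⟩ : D.G) ^ i) • monomial u c =
      monomial u ((D.ζ ^ D.wt u) ^ i * c) := by
  induction i with
  | zero => simp
  | succ i ih =>
    rw [pow_succ', mul_smul, ih]
    change matrixSubst D.g.1 _ = _
    rw [matrixSubst_g_monomial, pow_succ', mul_assoc]

/-- This is Fourier inversion on the cyclic group: on a monomial of weight `w` the sum is the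
average of the powers of `ω = ζ^(w - j)`, which is `1` if `ω = 1` and otherwise `0` as a geometric
sum. It requires `n` to be invertible in `k`. -/
theorem e_eq_sum [CharZero k] (j : ℕ) :
    D.e (j : ZMod n) = ∑ i ∈ Finset.range n, D.skewHom (SkewMonoidAlgebra.single
      ((⟨D.g, Subgroup.mem_zpowers D.g⟩ : D.G) ^ i) (C ((n : k)⁻¹ * (D.ζ⁻¹ ^ j) ^ i))) := by
  have hn : (n : k) ≠ 0 := Nat.cast_ne_zero.2 D.n_pos.ne'
  have hζ : D.ζ ≠ 0 := D.isPrimitiveRoot.ne_zero D.n_pos.ne'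
  refine LinearMap.ext fun t => ?_
  rw [LinearMap.sum_apply, e_apply]
  simp only [skewHom_single]
  induction t using MvPolynomial.induction_on' with
  | add p q hp hq => simp only [map_add, smul_add, mul_add, Finset.sum_add_distrib, hp, hq]
  | monomial u c =>
    simp only [smul_g_pow_monomial, C_mul_monomial]
    rw [← map_sum, projLin_monomial]
    have h1 : ∀ i, (n : k)⁻¹ * (D.ζ⁻¹ ^ j) ^ i * ((D.ζ ^ D.wt u) ^ i * c) =
        (n : k)⁻¹ * c * (D.ζ⁻¹ ^ j * D.ζ ^ D.wt u) ^ i := by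
      intro i; rw [mul_pow]; ring
    simp only [h1]
    rw [← Finset.mul_sum]
    set ω := D.ζ⁻¹ ^ j * D.ζ ^ D.wt u with hω
    have hωn : ω ^ n = 1 := by
      rw [hω, mul_pow, ← pow_mul, ← pow_mul, mul_comm j, mul_comm (D.wt u), pow_mul, pow_mul,
        inv_pow, D.isPrimitiveRoot.pow_eq_one]
      simp
    have hiff : (D.wt u : ZMod n) = j ↔ ω = 1 := by
      have h2 : ω = D.ζ ^ ((D.wt u : ℤ) - (j : ℤ)) := by
        rw [hω, zpow_sub₀ hζ, zpow_natCast, zpow_natCast, inv_pow, div_eq_inv_mul]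
      rw [h2, D.isPrimitiveRoot.zpow_eq_one_iff_dvd, ← ZMod.intCast_zmod_eq_zero_iff_dvd _ n]
      push_cast
      rw [sub_eq_zero]
    by_cases h : ω = 1
    · rw [if_pos (hiff.2 h), h]
      simp only [one_pow, Finset.sum_const, Finset.card_range, nsmul_eq_mul, mul_one]
      rw [mul_right_comm, inv_mul_cancel₀ hn, one_mul]
    · rw [if_neg (mt hiff.1 h)]
      have : (∑ i ∈ Finset.range n, ω ^ i) = 0 := by
        have h2 := mul_neg_geom_sum ω n
        rw [hωn, sub_self] at h2
        exact (mul_eq_zero.1 h2).resolve_left (sub_ne_zero.2 (Ne.symm h))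
      rw [this, mul_zero, map_zero]

/-- By `sum_comp`, `B` is generated by multiplications by polynomials and the idempotents `e_i`, and
both lie in the image. -/
theorem skewHom_surjective [CharZero k] : Function.Surjective D.skewHom := by
  have : NeZero n := ⟨D.n_pos.ne'⟩
  rw [← RingHom.range_eq_top, eq_top_iff]
  intro f _
  rw [← D.sum_comp f]
  refine Subring.sum_mem _ fun i _ => Subring.mul_mem _ ?_ ?_
  · refine ⟨SkewMonoidAlgebra.single 1 (D.comp i f), LinearMap.ext fun t => ?_⟩
    rw [skewHom_single, one_smul]
    rfl
  · rw [← ZMod.natCast_zmod_val i, e_eq_sum]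
    exact Subring.sum_mem _ fun i _ => ⟨_, rfl⟩

theorem exists_skew_equiv [CharZero k] :
    ∃ Φ : SkewMonoidAlgebra (MvPolynomial (Fin d) k) D.G ≃+* D.B,
      ∀ (γ : D.G) (s t : MvPolynomial (Fin d) k),
        Φ (SkewMonoidAlgebra.single γ s) t = s * (γ • t) :=
  ⟨RingEquiv.ofBijective D.skewHom ⟨D.skewHom_injective, D.skewHom_surjective⟩, D.skewHom_single⟩

end CyclicDatum

namespace CyclicDatum

open MvPolynomial

universe u

variable {k : Type u} [Field k] {d n : ℕ} (D : CyclicDatum k d n)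

/-! ### The grading of `B` -/

/-- The degree of a monomial is the quotient of its weight by `n`; the remainder is the index of its
summand. -/
theorem mem_Tdeg_iff (m : ℤ) (f : MvPolynomial (Fin d) k) :
    f ∈ D.Tdeg m ↔ ∀ u, coeff u f ≠ 0 → ((D.wt u / n : ℕ) : ℤ) = m := by
  have h : D.Tdeg m = restrictSupport k {u | ((D.wt u / n : ℕ) : ℤ) = m} := by
    rw [restrictSupport_eq_span, Tdeg]
    congr 1
    ext f
    constructor
    · rintro ⟨u, i, hi, hu, rfl⟩
      refine ⟨u, ?_, rfl⟩
      have : (D.wt u : ℤ) / n = m := by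
        rw [hu, mul_comm, Int.add_comm, Int.add_mul_ediv_left _ _ (by omega),
          Int.ediv_eq_zero_of_lt (by omega) (by omega), zero_add]
      rw [Set.mem_ofPred_eq, Int.natCast_div, this]
    · rintro ⟨u, hu, rfl⟩
      refine ⟨u, D.wt u % n, Nat.mod_lt _ D.n_pos, ?_, rfl⟩
      rw [← show ((D.wt u / n : ℕ) : ℤ) = m from hu, mul_comm]
      exact_mod_cast (Nat.div_add_mod (D.wt u) n).symm
  rw [h, mem_restrictSupport_iff]
  simp only [Set.subset_def, Finset.mem_coe, mem_support_iff, Set.mem_ofPred_eq]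

theorem monomial_mem_Tdeg (u : Fin d →₀ ℕ) (c : k) :
    monomial u c ∈ D.Tdeg ((D.wt u / n : ℕ) : ℤ) := by
  classical
  rw [mem_Tdeg_iff]
  intro v hv
  rw [coeff_monomial] at hv
  by_cases h : u = v
  · rw [h]
  · simp [h] at hv

/-- The degree of the endomorphism that multiplies `T^i` by the monomial with exponent `u`. -/
noncomputable def monDeg (i : ZMod n) (u : Fin d →₀ ℕ) : ℤ := ((i.val + D.wt u) / n : ℕ)

/-- The endomorphism that multiplies `T^i` by the monomial with exponent `u` and vanishes on the
other summands. -/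
noncomputable def mon (i : ZMod n) (u : Fin d →₀ ℕ) : D.B := D.mulL (monomial u 1) * D.e i

/-- The remainder of `wt v` is `i.val`, so the quotient grows by the carry of `i.val + wt u`,
whichever `v` in `T^i` is taken. For this reason `x^u e_i` is homogeneous. -/
theorem wt_div_add_monDeg (i : ZMod n) (u v : Fin d →₀ ℕ) (hv : (D.wt v : ZMod n) = i) :
    ((D.wt (u + v) / n : ℕ) : ℤ) = ((D.wt v / n : ℕ) : ℤ) + D.monDeg i u := by
  have h1 : i.val = D.wt v % n := by rw [← hv, ZMod.val_natCast]
  rw [monDeg, wt_add, h1, ← Nat.cast_add]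
  congr 1
  conv_lhs => rw [← Nat.div_add_mod (D.wt v) n]
  rw [show D.wt u + (n * (D.wt v / n) + D.wt v % n) = (D.wt v % n + D.wt u) + n * (D.wt v / n) by ring,
    Nat.add_mul_div_left _ _ D.n_pos, add_comm]

theorem mon_mem (i : ZMod n) (u : Fin d →₀ ℕ) : D.mon i u ∈ D.gradingB (D.monDeg i u) := by
  intro q t ht
  induction ht using Submodule.span_induction with
  | zero => rw [map_zero]; exact Submodule.zero_mem _
  | add x y _ _ hx hy => rw [map_add]; exact Submodule.add_mem _ hx hy
  | smul c x _ hx =>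
    rw [LinearMap.map_smul_of_tower]
    exact Submodule.smul_mem _ c hx
  | mem f hf =>
    have hf' : f ∈ D.Tdeg q := Submodule.subset_span hf
    obtain ⟨v, j, hj, hv, rfl⟩ := hf
    change monomial u 1 * D.projLin i (monomial v 1) ∈ _
    rw [projLin_monomial]
    split_ifs with h
    · rw [monomial_mul, one_mul]
      have hq := (D.mem_Tdeg_iff q _).1 hf' v (by simp)
      rw [← hq, ← wt_div_add_monDeg D i u v h]
      exact D.monomial_mem_Tdeg _ _
    · rw [mul_zero]; exact Submodule.zero_mem _

theorem mulL_mul_e_eq_sum (h : MvPolynomial (Fin d) k) (i : ZMod n) :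
    D.mulL h * D.e i = ∑ u ∈ h.support, coeff u h • D.mon i u := by
  conv_lhs => rw [h.as_sum, map_sum, Finset.sum_mul]
  refine Finset.sum_congr rfl fun u _ => ?_
  rw [mon, ← smul_mul_assoc, ← map_smul, smul_monomial, smul_eq_mul, mul_one]

theorem mul_mem_gradingB {i j : ℤ} {b c : D.B} (hb : b ∈ D.gradingB i) (hc : c ∈ D.gradingB j) :
    b * c ∈ D.gradingB (i + j) := by
  intro q t ht
  have := hb _ _ (hc q t ht)
  rwa [add_assoc, add_comm j i] at this

section

variable [NeZero n]

theorem comp_mon (i s : ZMod n) (u : Fin d →₀ ℕ) :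
    D.comp s (D.mon i u) = if s = i then monomial u 1 else 0 := by
  rw [mon, comp_mul_e, comp_mulL]

/-- One test monomial `x^v` of `T^i` is enough: `f` multiplies it by the polynomial `comp i f`, so
each term of that polynomial survives as a separate monomial `x^(u + v)`, whose degree is known. -/
theorem monDeg_eq_of_mem {m : ℤ} {f : D.B} (hf : f ∈ D.gradingB m) (i : ZMod n) (u : Fin d →₀ ℕ)
    (hu : coeff u (D.comp i f) ≠ 0) : D.monDeg i u = m := by
  have hd := D.two_le_d
  obtain ⟨v, hv⟩ : ∃ v : Fin d →₀ ℕ, (D.wt v : ZMod n) = i := by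
    refine ⟨Finsupp.single ⟨0, by omega⟩ (i * (D.a ⟨0, by omega⟩ : ZMod n)⁻¹).val, ?_⟩
    rw [wt_single, Nat.cast_mul, ZMod.natCast_zmod_val, mul_assoc, mul_comm _ (Nat.cast _),
      ZMod.coe_mul_inv_eq_one _ (D.coprime _).symm, mul_one]
  have h1 := hf _ _ (D.monomial_mem_Tdeg v 1)
  have h2 : f (monomial v 1) = D.comp i f * monomial v 1 := by
    have h3 := LinearMap.congr_fun (D.mulL_comp_mul_e f i) (monomial v 1)
    change D.comp i f * D.projLin i _ = f (D.projLin i _) at h3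
    rw [projLin_monomial, if_pos hv] at h3
    exact h3.symm
  rw [h2, mem_Tdeg_iff] at h1
  have h4 := h1 (u + v) (by rwa [coeff_mul_monomial, mul_one])
  rw [wt_div_add_monDeg D i u v hv] at h4
  linarith

/-- The basis of `B` consisting of the multiplications of summands by monomials. -/
noncomputable def basisB : Module.Basis (Σ _ : ZMod n, Fin d →₀ ℕ) k D.B :=
  (Pi.basis fun _ : ZMod n => MvPolynomial.basisMonomials (Fin d) k).map D.compEquiv

theorem basisB_apply (x : Σ _ : ZMod n, Fin d →₀ ℕ) : D.basisB x = D.mon x.1 x.2 := by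
  have h : D.basisB x = D.ofComp (Pi.single x.1 (monomial x.2 1)) := by
    rw [basisB, Module.Basis.map_apply, Pi.basis_apply, coe_basisMonomials]
    rfl
  rw [h, ofComp_apply, Finset.sum_eq_single x.1]
  · rw [Pi.single_eq_same, mon]
  · intro i _ hi
    rw [Pi.single_eq_of_ne hi, map_zero, zero_mul]
  · simp

theorem gradingB_eq_span (m : ℤ) :
    D.gradingB m = Submodule.span k (D.basisB '' {x | D.monDeg x.1 x.2 = m}) := by
  apply le_antisymm
  · intro f hf
    rw [← D.sum_comp f]
    refine Submodule.sum_mem _ fun i _ => ?_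
    rw [mulL_mul_e_eq_sum]
    refine Submodule.sum_mem _ fun u hu => Submodule.smul_mem _ _ (Submodule.subset_span ?_)
    exact ⟨⟨i, u⟩, D.monDeg_eq_of_mem hf i u (mem_support_iff.1 hu), D.basisB_apply _⟩
  · rw [Submodule.span_le]
    rintro _ ⟨x, hx, rfl⟩
    rw [basisB_apply, ← show D.monDeg x.1 x.2 = m from hx]
    exact D.mon_mem _ _

theorem gradingB_induction {m : ℤ} {p : D.B → Prop} (hzero : p 0)
    (hadd : ∀ x y, p x → p y → p (x + y)) (hsmul : ∀ (c : k) x, p x → p (c • x))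
    (hmon : ∀ i u, D.monDeg i u = m → p (D.mon i u)) {f : D.B} (hf : f ∈ D.gradingB m) : p f := by
  rw [gradingB_eq_span] at hf
  induction hf using Submodule.span_induction with
  | zero => exact hzero
  | add x y _ _ hx hy => exact hadd x y hx hy
  | smul c x _ hx => exact hsmul c x hx
  | mem x hx =>
    obtain ⟨y, hy, rfl⟩ := hx
    rw [basisB_apply]
    exact hmon _ _ hy

theorem isPositivelyGraded : IsPositivelyGradedAlgebra D.gradingB where
  internal := by
    have h : D.gradingB = fun m => Submodule.span k (D.basisB '' {x | D.monDeg x.1 x.2 = m}) :=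
      funext D.gradingB_eq_span
    rw [h]
    exact isInternal_span_basis D.basisB fun x => D.monDeg x.1 x.2
  one_mem := fun i t ht => by rw [add_zero]; exact ht
  mul_mem := fun i j b hb c hc => D.mul_mem_gradingB hb hc
  eq_bot_of_neg := fun m hm => by
    rw [gradingB_eq_span, Submodule.span_eq_bot]
    rintro _ ⟨x, hx, rfl⟩
    have h1 : D.monDeg x.1 x.2 = m := hx
    have h2 : 0 ≤ D.monDeg x.1 x.2 := Int.natCast_nonneg _
    omega

theorem e_mem (i : ZMod n) : D.e i ∈ D.gradingB 0 := by
  have h := D.mon_mem i 0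
  have h1 : D.mon i 0 = D.e i := by
    rw [mon, show (monomial 0 1 : MvPolynomial (Fin d) k) = 1 from rfl, mulL_one, one_mul]
  rwa [h1, monDeg, wt_zero, add_zero, Nat.div_eq_of_lt (ZMod.val_lt i), Nat.cast_zero] at h

/-- Degree is weight divided by `n`, corrected by the difference of the function `val` at the two
end points. In this form identities between degrees follow by telescoping, after multiplication by
`n`. -/
theorem monDeg_spec (i : ZMod n) (u : Fin d →₀ ℕ) :
    n * D.monDeg i u = i.val + D.wt u - (i + (D.wt u : ZMod n)).val := by
  have h1 : (i + (D.wt u : ZMod n)).val = (i.val + D.wt u) % n := by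
    rw [← ZMod.val_natCast, Nat.cast_add, ZMod.natCast_zmod_val]
  rw [h1, monDeg]
  have h2 := Nat.div_add_mod (i.val + D.wt u) n
  have h3 : (n : ℤ) * ((i.val + D.wt u) / n : ℕ) + ((i.val + D.wt u) % n : ℕ) = i.val + D.wt u := by
    exact_mod_cast h2
  linarith

/-- As `0 < a_j < n`, an arrow passes the vertex `0` at most once, and it does so exactly when `val`
decreases. -/
theorem arrowDeg_spec (i : ZMod n) (j : Fin d) :
    n * McKay.arrowDeg D.a i j = i.val + D.a j - (i + (D.a j : ZMod n)).val := by
  have hi := ZMod.val_lt i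
  have hlt := D.lt j
  have hpos := D.pos j
  have h1 : (i + (D.a j : ZMod n)).val = (i.val + D.a j) % n := by
    rw [← ZMod.val_natCast, Nat.cast_add, ZMod.natCast_zmod_val]
  rw [McKay.arrowDeg, h1]
  by_cases h : i.val + D.a j < n
  · rw [Nat.mod_eq_of_lt h, if_pos (by omega)]
    push_cast; ring
  · have h2 : (i.val + D.a j) % n = i.val + D.a j - n := by
      rw [Nat.mod_eq_sub_mod (by omega), Nat.mod_eq_of_lt (by omega)]
    rw [h2, if_neg (by omega)]
    push_cast [Nat.cast_sub (show n ≤ i.val + D.a j by omega)]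
    ring

theorem arrow_mem (i : ZMod n) (j : Fin d) : D.arrow i j ∈ D.gradingB (McKay.arrowDeg D.a i j) := by
  have h : D.monDeg i (Finsupp.single j 1) = McKay.arrowDeg D.a i j := by
    have hn : (n : ℤ) ≠ 0 := by exact_mod_cast D.n_pos.ne'
    apply mul_left_cancel₀ hn
    rw [monDeg_spec, arrowDeg_spec, wt_single, one_mul]
  rw [← h]
  exact D.mon_mem i _

end

end CyclicDatum

/-! ### The enveloping algebra and its flip -/

section EnvelopingAlgebra

universe u

variable {k : Type u} [Field k] {B : Type u} [Ring B] [Algebra k B]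

theorem envTmul_mul (b c b' c' : B) :
    envTmul k b c * envTmul k b' c' = envTmul k (b * b') (c' * c) := by
  exact Algebra.TensorProduct.tmul_mul_tmul b b' (MulOpposite.op c) (MulOpposite.op c')

theorem envTmul_one : envTmul k (1 : B) 1 = 1 := rfl

/-- The `k`-bilinear map `(b, c) ↦ b ⊗ c`. -/
noncomputable def envMk (k : Type u) [Field k] (B : Type u) [Ring B] [Algebra k B] :
    B →ₗ[k] B →ₗ[k] Env k B :=
  (TensorProduct.mk k B Bᵐᵒᵖ).compl₂ (MulOpposite.opLinearEquiv k).toLinearMap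

theorem envMk_apply (b c : B) : envMk k B b c = envTmul k b c := rfl

/-- The `k`-linear map on the enveloping algebra given by a bilinear map. -/
noncomputable def envLift₂ {N : Type*} [AddCommGroup N] [Module k N] (f : B →ₗ[k] B →ₗ[k] N) :
    Env k B →ₗ[k] N :=
  TensorProduct.lift (f.compl₂ (MulOpposite.opLinearEquiv k).symm.toLinearMap)

theorem envLift₂_envTmul {N : Type*} [AddCommGroup N] [Module k N] (f : B →ₗ[k] B →ₗ[k] N)
    (b c : B) : envLift₂ f (envTmul k b c) = f b c :=
  TensorProduct.lift.tmul b (MulOpposite.op c)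

theorem env_induction {p : Env k B → Prop} (X : Env k B) (h0 : p 0)
    (hadd : ∀ X Y, p X → p Y → p (X + Y)) (htmul : ∀ b c, p (envTmul k b c)) : p X :=
  TensorProduct.induction_on X h0 (fun b c => htmul b c.unop) hadd

/-- The anti-automorphism `b ⊗ c ↦ c ⊗ b` of the enveloping algebra. -/
noncomputable def envFlip : Env k B →ₗ[k] Env k B := envLift₂ (envMk k B).flip

theorem envFlip_envTmul (b c : B) : envFlip (envTmul k b c) = envTmul k c b :=
  envLift₂_envTmul _ _ _

theorem envFlip_mul (X Y : Env k B) : envFlip (X * Y) = envFlip Y * envFlip X := by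
  induction X using env_induction with
  | h0 => simp
  | hadd X X' hX hX' => rw [add_mul, map_add, hX, hX', map_add, mul_add]
  | htmul b c =>
    induction Y using env_induction with
    | h0 => simp
    | hadd X X' hX hX' => rw [mul_add, map_add, hX, hX', map_add, add_mul]
    | htmul b' c' => simp only [envTmul_mul, envFlip_envTmul]

theorem envFlip_envFlip (X : Env k B) : envFlip (envFlip X) = X := by
  induction X using env_induction with
  | h0 => simp
  | hadd X X' hX hX' => rw [map_add, map_add, hX, hX']
  | htmul b c => simp only [envFlip_envTmul]

end EnvelopingAlgebra

/-! ### Alternating families indexed by words -/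

section Alternating

variable {d l : ℕ} {N : Type*} [AddCommGroup N]

/-- A family indexed by words that changes its sign when two adjacent letters are exchanged. -/
def IsAltFamily (f : (Fin l → Fin d) → N) : Prop :=
  ∀ (c : Fin l → Fin d) (r : ℕ) (h : r + 1 < l),
    f c + f (c ∘ Equiv.swap ⟨r, Nat.lt_of_succ_lt h⟩ ⟨r + 1, h⟩) = 0

/-- Adjacent transpositions generate the symmetric group, and both sides are multiplicative in `σ`.
-/
theorem IsAltFamily.comp_perm {f : (Fin l → Fin d) → N} (hf : IsAltFamily f)
    (c : Fin l → Fin d) (σ : Equiv.Perm (Fin l)) :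
    f (c ∘ σ) = (Equiv.Perm.sign σ : ℤ) • f c := by
  match l, f, hf, c, σ with
  | 0, f, hf, c, σ =>
    rw [Subsingleton.elim σ 1]
    simp
  | l + 1, f, hf, c, σ =>
    have hσ : σ ∈ Submonoid.closure
        (Set.range fun i : Fin l => Equiv.swap i.castSucc i.succ) := by
      rw [Equiv.Perm.mclosure_swap_castSucc_succ]; trivial
    induction hσ using Submonoid.closure_induction generalizing c with
    | mem σ h =>
      obtain ⟨i, rfl⟩ := h
      dsimp only
      rw [Equiv.Perm.sign_swap (Fin.castSucc_lt_succ).ne]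
      have := hf c i (by omega)
      rw [show f (c ∘ Equiv.swap i.castSucc i.succ) = -f c from eq_neg_of_add_eq_zero_right this]
      simp
    | one => simp
    | mul σ τ _ _ hσ hτ =>
      rw [Equiv.Perm.coe_mul, ← Function.comp_assoc, hτ, hσ, smul_smul, map_mul, mul_comm,
        Units.val_mul]

theorem IsAltFamily.comp_swap {f : (Fin l → Fin d) → N} (hf : IsAltFamily f)
    (c : Fin l → Fin d) {i j : Fin l} (hij : i ≠ j) : f (c ∘ Equiv.swap i j) = - f c := by
  rw [hf.comp_perm, Equiv.Perm.sign_swap hij]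
  simp

/-- The relations only give `2 f(c) = 0` for a word with a repeated letter, so `2` must be
invertible. -/
theorem IsAltFamily.eq_zero {k : Type*} [Field k] [CharZero k] [Module k N]
    {f : (Fin l → Fin d) → N} (hf : IsAltFamily f)
    {c : Fin l → Fin d} (hc : ¬ Function.Injective c) : f c = 0 := by
  simp only [Function.Injective, not_forall] at hc
  obtain ⟨i, j, hcij, hij⟩ := hc
  have h1 := hf.comp_swap c hij
  have h2 : c ∘ Equiv.swap i j = c := by
    funext r
    rw [Function.comp_apply, Equiv.swap_apply_def]
    split_ifs with h h'
    · rw [h, hcij]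
    · rw [h', hcij]
    · rfl
  rw [h2, eq_neg_iff_add_eq_zero, ← two_smul k] at h1
  exact (smul_eq_zero.1 h1).resolve_left two_ne_zero

/-- Moving the letter at position `i` to the front is a cycle of length `i + 1`, of sign `(-1)^i`.
-/
theorem IsAltFamily.cons {f : (Fin (l + 1) → Fin d) → N} (hf : IsAltFamily f)
    (c : Fin (l + 1) → Fin d) (i : Fin (l + 1)) :
    f (Fin.cons (c i) (c ∘ i.succAbove)) = (-1 : ℤ) ^ (i : ℕ) • f c := by
  have h := Fin.cons_removeNth_eq_comp_cycleRange_symm c i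
  have h2 : (Fin.cons (c i) (c ∘ i.succAbove) : Fin (l + 1) → Fin d) =
      c ∘ (Equiv.symm i.cycleRange) := h
  rw [h2, hf.comp_perm, Equiv.Perm.sign_symm, Fin.sign_cycleRange]
  simp

/-- This makes the Koszul differential well defined on wedges. After one sum is reindexed by the
transposition, the terms that omit one of the two exchanged letters are compared with each other and
have opposite signs; in every other term the shorter word undergoes a transposition. -/
theorem isAltFamily_sum_succAbove {f : Fin d → (Fin l → Fin d) → N} (hf : ∀ j, IsAltFamily (f j)) :
    IsAltFamily fun c : Fin (l + 1) → Fin d =>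
      ∑ i : Fin (l + 1), (-1 : ℤ) ^ (i : ℕ) • f (c i) (c ∘ i.succAbove) := by
  intro c r h
  dsimp only
  set p : Fin (l + 1) := ⟨r, Nat.lt_of_succ_lt h⟩ with hp
  set q : Fin (l + 1) := ⟨r + 1, h⟩ with hq
  have hpq : p ≠ q := by simp [hp, hq]
  rw [← Equiv.sum_comp (Equiv.swap p q) fun i : Fin (l + 1) => (-1 : ℤ) ^ (i : ℕ) •
    f ((c ∘ Equiv.swap p q) i) ((c ∘ Equiv.swap p q) ∘ i.succAbove), ← Finset.sum_add_distrib]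
  refine Finset.sum_eq_zero fun i _ => ?_
  rw [Function.comp_apply, Equiv.swap_apply_self]
  by_cases hip : i = p
  · subst hip
    have h1 : (c ∘ Equiv.swap p q) ∘ q.succAbove = c ∘ p.succAbove := by
      funext x
      simp only [Function.comp_apply]
      congr 1
      rcases lt_trichotomy (x : ℕ) r with hx | hx | hx
      · rw [Fin.succAbove_of_castSucc_lt q x (by simp [Fin.lt_def, hq]; omega),
          Fin.succAbove_of_castSucc_lt p x (by simp [Fin.lt_def, hp]; omega)]
        apply Equiv.swap_apply_of_ne_of_ne <;> simp [Fin.ext_iff, hp, hq] <;> omega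
      · rw [Fin.succAbove_of_castSucc_lt q x (by simp [Fin.lt_def, hq]; omega),
          Fin.succAbove_of_le_castSucc p x (by simp [Fin.le_def, hp]; omega)]
        rw [show x.castSucc = p by simp [Fin.ext_iff, hp, hx], Equiv.swap_apply_left]
        simp [Fin.ext_iff, hq, hx]
      · rw [Fin.succAbove_of_le_castSucc q x (by simp [Fin.le_def, hq]; omega),
          Fin.succAbove_of_le_castSucc p x (by simp [Fin.le_def, hp]; omega)]
        apply Equiv.swap_apply_of_ne_of_ne <;> simp [Fin.ext_iff, hp, hq] <;> omega
    rw [Equiv.swap_apply_left, h1, ← add_smul, show (q : ℕ) = (p : ℕ) + 1 from rfl, pow_succ]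
    simp
  · by_cases hiq : i = q
    · subst hiq
      have h1 : (c ∘ Equiv.swap p q) ∘ p.succAbove = c ∘ q.succAbove := by
        funext x
        simp only [Function.comp_apply]
        congr 1
        rcases lt_trichotomy (x : ℕ) r with hx | hx | hx
        · rw [Fin.succAbove_of_castSucc_lt q x (by simp [Fin.lt_def, hq]; omega),
            Fin.succAbove_of_castSucc_lt p x (by simp [Fin.lt_def, hp]; omega)]
          apply Equiv.swap_apply_of_ne_of_ne <;> simp [Fin.ext_iff, hp, hq] <;> omega
        · rw [Fin.succAbove_of_castSucc_lt q x (by simp [Fin.lt_def, hq]; omega),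
            Fin.succAbove_of_le_castSucc p x (by simp [Fin.le_def, hp]; omega)]
          rw [show x.succ = q by simp [Fin.ext_iff, hq, hx], Equiv.swap_apply_right]
          simp [Fin.ext_iff, hp, hx]
        · rw [Fin.succAbove_of_le_castSucc q x (by simp [Fin.le_def, hq]; omega),
            Fin.succAbove_of_le_castSucc p x (by simp [Fin.le_def, hp]; omega)]
          apply Equiv.swap_apply_of_ne_of_ne <;> simp [Fin.ext_iff, hp, hq] <;> omega
      rw [Equiv.swap_apply_right, h1, ← add_smul, show (q : ℕ) = (p : ℕ) + 1 from rfl, pow_succ]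
      simp
    · obtain ⟨a, ha⟩ := Fin.exists_succAbove_eq (Ne.symm hip)
      obtain ⟨b, hb⟩ := Fin.exists_succAbove_eq (Ne.symm hiq)
      have hab : a ≠ b := by rintro rfl; exact hpq (ha.symm.trans hb)
      have h1 : (c ∘ Equiv.swap p q) ∘ i.succAbove = (c ∘ i.succAbove) ∘ Equiv.swap a b := by
        funext x
        simp only [Function.comp_apply]
        rw [← ha, ← hb, (Fin.succAbove_right_injective).swap_apply]
      rw [Equiv.swap_apply_of_ne_of_ne hip hiq, h1, (hf _).comp_swap _ hab, smul_neg,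
        add_neg_cancel]

/-- The combinatorial form of `δ² = 0`: the involution that exchanges the order in which two letters
are omitted reverses the sign. -/
theorem sum_succAbove_succAbove {f : Fin d → Fin d → (Fin l → Fin d) → N}
    (hf : ∀ i j c, f i j c = f j i c) (c : Fin (l + 2) → Fin d) :
    ∑ i : Fin (l + 2), (-1 : ℤ) ^ (i : ℕ) • ∑ j : Fin (l + 1), (-1 : ℤ) ^ (j : ℕ) •
      f (c i) (c (i.succAbove j)) (c ∘ i.succAbove ∘ j.succAbove) = 0 := by
  simp only [Finset.smul_sum, smul_smul]
  rw [← Fintype.sum_prod_type' fun (i : Fin (l + 2)) (j : Fin (l + 1)) =>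
    ((-1 : ℤ) ^ (i : ℕ) * (-1) ^ (j : ℕ)) •
      f (c i) (c (i.succAbove j)) (c ∘ i.succAbove ∘ j.succAbove)]
  refine Finset.sum_involution (fun x _ => (x.1.succAbove x.2, x.2.predAbove x.1)) ?_ ?_ ?_ ?_
  · rintro ⟨i, j⟩ _
    have h : c ∘ (i.succAbove j).succAbove ∘ (j.predAbove i).succAbove =
        c ∘ i.succAbove ∘ j.succAbove := by
      funext x
      simp only [Function.comp_apply, Fin.succAbove_succAbove_succAbove_predAbove]
    dsimp only
    rw [h, Fin.succAbove_succAbove_predAbove, hf (c (i.succAbove j)), ← add_smul, ← pow_add,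
      ← pow_add, Fin.neg_one_pow_succAbove_add_predAbove, add_neg_cancel, zero_smul]
  · rintro ⟨i, j⟩ _ _ h
    exact Fin.succAbove_ne i j (Prod.ext_iff.1 h).1
  · exact fun _ _ => Finset.mem_univ _
  · rintro ⟨i, j⟩ _
    exact Prod.ext (Fin.succAbove_succAbove_predAbove i j) (Fin.predAbove_predAbove_succAbove i j)

end Alternating

namespace CyclicDatum

open MvPolynomial McKay

universe u

variable {k : Type u} [Field k] {d n : ℕ} (D : CyclicDatum k d n)

/-! ### The bimodules `P_l` and their universal properties -/

/-- The sum of the weights of the letters of a word. -/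
def wsum {l : ℕ} (w : Fin l → Fin d) : ZMod n := ∑ r, (D.a (w r) : ZMod n)

theorem wsum_succAbove {l : ℕ} (w : Fin (l + 1) → Fin d) (i : Fin (l + 1)) :
    D.wsum (w ∘ i.succAbove) + D.a (w i) = D.wsum w := by
  rw [wsum, wsum, Fin.sum_univ_succAbove _ i, add_comm]
  rfl

theorem wsum_comp_perm {l : ℕ} (w : Fin l → Fin d) (σ : Equiv.Perm (Fin l)) :
    D.wsum (w ∘ σ) = D.wsum w :=
  Equiv.sum_comp σ fun r => (D.a (w r) : ZMod n)

/-- The bimodule `P_l`. -/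
abbrev PP (l : ℕ) : Type u := P k D.e D.a l

/-- The generator of `P_l` given by a path. -/
noncomputable def gen {l : ℕ} (p : QPath n d l) : D.PP l := P.tmul D.e D.a 1 p 1

theorem tmul_eq_smul_gen {l : ℕ} (b c : D.B) (p : QPath n d l) :
    P.tmul D.e D.a b p c = envTmul k b c • D.gen p := by
  rw [gen, P.tmul, P.tmul, ← map_smul, TensorProduct.smul_tmul', smul_eq_mul, envTmul_one, mul_one]

theorem mkQ_tmul_wedge {l : ℕ} (X : Env k D.B) (p : QPath n d l) :
    (tensorRel (k := k) D.e D.a l).mkQ (X ⊗ₜ[k] wedge k p) = X • D.gen p := by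
  rw [gen, P.tmul, ← map_smul, TensorProduct.smul_tmul', smul_eq_mul, envTmul_one, mul_one]

theorem env_left_smul_gen {l : ℕ} (s : ZMod n) (p : QPath n d l) :
    envTmul k (D.e s) 1 • D.gen p = if s = p.tgt D.a then D.gen p else 0 := by
  rw [← tmul_eq_smul_gen, P.tmul, gen, P.tmul]
  have h := (Submodule.Quotient.mk_eq_zero (tensorRel (k := k) D.e D.a l)).2
    (Submodule.subset_span (Or.inl ⟨s, p, rfl⟩))
  rw [Submodule.Quotient.mk_sub, sub_eq_zero] at h
  refine h.trans ?_
  split_ifs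
  · rfl
  · rw [TensorProduct.tmul_zero]; rfl

theorem env_right_smul_gen {l : ℕ} (s : ZMod n) (p : QPath n d l) :
    envTmul k 1 (D.e s) • D.gen p = if s = p.src then D.gen p else 0 := by
  rw [← tmul_eq_smul_gen, P.tmul, gen, P.tmul]
  have h := (Submodule.Quotient.mk_eq_zero (tensorRel (k := k) D.e D.a l)).2
    (Submodule.subset_span (Or.inr ⟨s, p, rfl⟩))
  rw [Submodule.Quotient.mk_sub, sub_eq_zero] at h
  refine h.trans ?_
  split_ifs
  · rfl
  · rw [TensorProduct.tmul_zero]; rfl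

theorem isAltFamily_gen {l : ℕ} (s : ZMod n) :
    IsAltFamily fun w : Fin l → Fin d => D.gen ⟨s, w⟩ := by
  intro c r h
  have h1 : (wedgeRel k n d l).mkQ (Finsupp.single ⟨s, c⟩ 1 + Finsupp.single
      ⟨s, c ∘ Equiv.swap ⟨r, Nat.lt_of_succ_lt h⟩ ⟨r + 1, h⟩⟩ 1) = 0 :=
    (Submodule.Quotient.mk_eq_zero _).2 (Submodule.subset_span ⟨s, c, r, h, rfl⟩)
  dsimp only
  rw [gen, gen, P.tmul, P.tmul, ← map_add, ← TensorProduct.tmul_add, wedge, wedge, ← map_add, h1,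
    TensorProduct.tmul_zero, map_zero]

/-- The linear map on `U_l` given by an alternating family for each starting vertex. -/
noncomputable def uLift {l : ℕ} {M : Type*} [AddCommGroup M] [Module k M]
    (m : ZMod n → (Fin l → Fin d) → M) (hm : ∀ s, IsAltFamily (m s)) : U k n d l →ₗ[k] M :=
  (wedgeRel k n d l).liftQ (Finsupp.linearCombination k fun p => m p.src p.word) <| by
    rw [wedgeRel, Submodule.span_le]
    rintro _ ⟨i, c, r, h, rfl⟩
    rw [SetLike.mem_coe, LinearMap.mem_ker, map_add, Finsupp.linearCombination_single,
      Finsupp.linearCombination_single, one_smul, one_smul]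
    exact hm i c r h

theorem uLift_wedge {l : ℕ} {M : Type*} [AddCommGroup M] [Module k M]
    (m : ZMod n → (Fin l → Fin d) → M) (hm : ∀ s, IsAltFamily (m s)) (p : QPath n d l) :
    uLift m hm (wedge k p) = m p.src p.word := by
  rw [uLift, wedge, ← LinearMap.comp_apply, Submodule.liftQ_mkQ, Finsupp.linearCombination_single,
    one_smul]

section

variable [NeZero n]

/-- The sum of the generators of `P_l` given by all paths with the same letters. -/
noncomputable def wgen {l : ℕ} (w : Fin l → Fin d) : D.PP l := ∑ s, D.gen ⟨s, w⟩

/-- The generator of a path is recovered from the vertex-free element `wgen` by cutting with the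
idempotent of the source. So the elements `wgen w` generate `P_l`, and vertices can be left out of
later computations. -/
theorem gen_eq {l : ℕ} (p : QPath n d l) : D.gen p = envTmul k 1 (D.e p.src) • D.wgen p.word := by
  rw [wgen, Finset.smul_sum, Finset.sum_eq_single p.src]
  · rw [env_right_smul_gen, if_pos rfl]
  · intro s _ hs
    rw [env_right_smul_gen, if_neg (Ne.symm hs)]
  · simp

theorem tmul_eq_smul_wgen {l : ℕ} (b c : D.B) (p : QPath n d l) :
    P.tmul D.e D.a b p c = envTmul k b (D.e p.src * c) • D.wgen p.word := by
  rw [tmul_eq_smul_gen, gen_eq, smul_smul, envTmul_mul, mul_one]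

theorem env_left_smul_wgen {l : ℕ} (s : ZMod n) (w : Fin l → Fin d) :
    envTmul k (D.e (s + D.wsum w)) 1 • D.wgen w = envTmul k 1 (D.e s) • D.wgen w := by
  have h := D.gen_eq ⟨s, w⟩
  rw [← h, wgen, Finset.smul_sum, Finset.sum_eq_single s]
  · rw [env_left_smul_gen]
    exact if_pos rfl
  · intro t _ ht
    rw [env_left_smul_gen, if_neg]
    intro h
    exact ht (add_right_cancel h).symm
  · simp

theorem isAltFamily_wgen {l : ℕ} : IsAltFamily (D.wgen (l := l)) := by
  intro c r h
  rw [wgen, wgen, ← Finset.sum_add_distrib]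
  exact Finset.sum_eq_zero fun s _ => D.isAltFamily_gen s c r h

theorem PP_induction {l : ℕ} {p : D.PP l → Prop} (y : D.PP l)
    (hadd : ∀ x y, p x → p y → p (x + y)) (hgen : ∀ (X : Env k D.B) w, p (X • D.wgen w)) : p y := by
  have h0 : p 0 := by
    have := hgen 0 fun _ => ⟨0, by have := D.two_le_d; omega⟩
    rwa [zero_smul] at this
  obtain ⟨y, rfl⟩ := Submodule.mkQ_surjective _ y
  induction y using TensorProduct.induction_on with
  | zero => rwa [map_zero]
  | add x y hx hy => rw [map_add]; exact hadd _ _ hx hy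
  | tmul X u =>
    obtain ⟨u, rfl⟩ := Submodule.mkQ_surjective _ u
    induction u using Finsupp.induction_linear with
    | zero => rwa [map_zero, TensorProduct.tmul_zero, map_zero]
    | add f g hf hg => rw [map_add, TensorProduct.tmul_add, map_add]; exact hadd _ _ hf hg
    | single q c =>
      rw [← mul_one c, ← smul_eq_mul, ← Finsupp.smul_single, map_smul, ← TensorProduct.smul_tmul]
      have h1 := D.mkQ_tmul_wedge (c • X) q
      rw [wedge] at h1
      rw [h1, gen_eq, smul_smul]
      exact hgen _ _

theorem PP_linearMap_ext {l : ℕ} {M : Type*} [AddCommGroup M] [Module (Env k D.B) M]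
    {f g : D.PP l →ₗ[Env k D.B] M} (h : ∀ w, f (D.wgen w) = g (D.wgen w)) : f = g := by
  refine LinearMap.ext fun y => ?_
  induction y using D.PP_induction with
  | hadd x y hx hy => rw [map_add, map_add, hx, hy]
  | hgen X w => rw [map_smul, map_smul, h]

/-! ### The universal property of `P_l` as a bimodule -/

section EnvLift

variable {l : ℕ} {M : Type*} [AddCommGroup M] [Module k M] [Module (Env k D.B) M]
  [IsScalarTower k (Env k D.B) M]

/-- The hypothesis `hm'` says that the target of a path is its source plus the weight of its word.
Together with alternation it accounts for all relations between the elements `wgen w`. The path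
starting at `s` is sent to `m w` cut by `e_s`, and the sum over `s` restores `m w`. -/
theorem exists_env_lift (m : (Fin l → Fin d) → M) (hm : IsAltFamily m)
    (hm' : ∀ s w, envTmul k (D.e (s + D.wsum w)) 1 • m w = envTmul k 1 (D.e s) • m w) :
    ∃ f : D.PP l →ₗ[Env k D.B] M, ∀ w, f (D.wgen w) = m w := by
  let m' : ZMod n → (Fin l → Fin d) → M := fun s w => envTmul k 1 (D.e s) • m w
  have hm'alt : ∀ s, IsAltFamily (m' s) := by
    intro s c r h
    rw [← smul_add, hm c r h, smul_zero]
  let φ : U k n d l →ₗ[k] M := uLift m' hm'alt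
  let ψ : Env k D.B ⊗[k] U k n d l →ₗ[Env k D.B] M :=
    TensorProduct.AlgebraTensorModule.lift
      ((LinearMap.toSpanSingleton (Env k D.B) (U k n d l →ₗ[k] M) φ))
  have hψ : ∀ X (p : QPath n d l), ψ (X ⊗ₜ wedge k p) = X • m' p.src p.word := by
    intro X p
    rw [TensorProduct.AlgebraTensorModule.lift_tmul, LinearMap.toSpanSingleton_apply,
      LinearMap.smul_apply, uLift_wedge]
  have hker : tensorRel (k := k) D.e D.a l ≤ LinearMap.ker ψ := by
    rw [tensorRel, Submodule.span_le]
    rintro _ (⟨s, p, rfl⟩ | ⟨s, p, rfl⟩)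
    · rw [SetLike.mem_coe, LinearMap.mem_ker, map_sub, hψ, sub_eq_zero]
      have h1 : envTmul k (D.e s) 1 • m' p.src p.word =
          if s = p.tgt D.a then m' p.src p.word else 0 := by
        have h2 : envTmul k (D.e s) 1 * envTmul k 1 (D.e p.src) =
            envTmul k 1 (D.e p.src) * envTmul k (D.e s) 1 := by
          rw [envTmul_mul, envTmul_mul, mul_one, one_mul, mul_one, one_mul]
        have h3 := hm' (s - D.wsum p.word) p.word
        rw [sub_add_cancel] at h3
        rw [smul_smul, h2, mul_smul, h3, smul_smul, envTmul_mul, mul_one, e_mul_e]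
        have h4 : s - D.wsum p.word = p.src ↔ s = p.tgt D.a := sub_eq_iff_eq_add
        simp only [h4]
        split_ifs
        · rfl
        · change envMk k D.B 1 0 • _ = _
          rw [map_zero, zero_smul]
      rw [h1]
      split_ifs
      · rw [hψ, envTmul_one, one_smul]
      · rw [TensorProduct.tmul_zero, map_zero]
    · rw [SetLike.mem_coe, LinearMap.mem_ker, map_sub, hψ, sub_eq_zero, smul_smul, envTmul_mul,
        mul_one, e_mul_e]
      by_cases h : p.src = s
      · rw [if_pos h, if_pos h.symm, hψ, envTmul_one, one_smul, ← h]
      · rw [if_neg h, if_neg (Ne.symm h), TensorProduct.tmul_zero, map_zero]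
        change envMk k D.B 1 0 • _ = _
        rw [map_zero, zero_smul]
  refine ⟨(tensorRel (k := k) D.e D.a l).liftQ ψ hker, fun w => ?_⟩
  have hgen : ∀ p : QPath n d l, (tensorRel (k := k) D.e D.a l).liftQ ψ hker (D.gen p) =
      m' p.src p.word := by
    intro p
    rw [gen, P.tmul, ← LinearMap.comp_apply, Submodule.liftQ_mkQ, hψ, envTmul_one, one_smul]
  rw [wgen, map_sum, Finset.sum_congr rfl fun s _ => hgen ⟨s, w⟩]
  change ∑ s, envMk k D.B 1 (D.e s) • m w = m w
  rw [← Finset.sum_smul, ← map_sum, sum_e, envMk_apply, envTmul_one, one_smul]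

/-- The bimodule map on `P_l` given by an alternating family of compatible elements. -/
noncomputable def envLift (m : (Fin l → Fin d) → M) (hm : IsAltFamily m)
    (hm' : ∀ s w, envTmul k (D.e (s + D.wsum w)) 1 • m w = envTmul k 1 (D.e s) • m w) :
    D.PP l →ₗ[Env k D.B] M := (D.exists_env_lift m hm hm').choose

theorem envLift_wgen (m : (Fin l → Fin d) → M) (hm : IsAltFamily m)
    (hm' : ∀ s w, envTmul k (D.e (s + D.wsum w)) 1 • m w = envTmul k 1 (D.e s) • m w)
    (w : Fin l → Fin d) : D.envLift m hm hm' (D.wgen w) = m w :=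
  (D.exists_env_lift m hm hm').choose_spec w

end EnvLift

end

end CyclicDatum

namespace CyclicDatum

open MvPolynomial McKay

universe u

variable {k : Type u} [Field k] {d n : ℕ} (D : CyclicDatum k d n)

/-! ### The spanning families of `P_l` over the base field -/

/-- Right multiplication by `e t` after multiplication by a polynomial, as a linear map. -/
noncomputable def mulLE (t : ZMod n) : MvPolynomial (Fin d) k →ₗ[k] D.B :=
  (LinearMap.mulRight k (D.e t)).comp D.mulL

/-- The map `f ⊗ g ↦ M_f ⊗ M_g e_t`, where `M_f` denotes the multiplication by `f`. -/
noncomputable def theta (t : ZMod n) :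
    MvPolynomial (Fin d) k ⊗[k] MvPolynomial (Fin d) k →ₗ[k] Env k D.B :=
  TensorProduct.lift ((envMk k D.B).compl₁₂ D.mulL (D.mulLE t))

theorem theta_tmul (t : ZMod n) (f g : MvPolynomial (Fin d) k) :
    D.theta t (f ⊗ₜ g) = envTmul k (D.mulL f) (D.mulL g * D.e t) := rfl

/-- The element `x_j ⊗ 1 - 1 ⊗ x_j` of the enveloping algebra. -/
noncomputable def Z (j : Fin d) : Env k D.B :=
  envTmul k (D.mulL (X j)) 1 - envTmul k 1 (D.mulL (X j))

/-- The element `x_j ⊗ 1 - 1 ⊗ x_j` of `S ⊗ S`. -/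
noncomputable def zt (k : Type u) [Field k] {d : ℕ} (j : Fin d) :
    MvPolynomial (Fin d) k ⊗[k] MvPolynomial (Fin d) k :=
  X j ⊗ₜ 1 - 1 ⊗ₜ X j

/-- Right multiplication in `B^e` puts `x_j` to the left of the second entry, away from the
idempotent `e_t`. So the vertex `t` is unaffected and only the commutative product in `S ⊗ S`
matters. -/
theorem theta_mul_Z (t : ZMod n) (j : Fin d)
    (F : MvPolynomial (Fin d) k ⊗[k] MvPolynomial (Fin d) k) :
    D.theta t F * D.Z j = D.theta t (zt k j * F) := by
  induction F using TensorProduct.induction_on with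
  | zero => rw [map_zero, zero_mul, mul_zero, map_zero]
  | add F G hF hG => rw [map_add, add_mul, hF, hG, mul_add, map_add]
  | tmul f g =>
    rw [zt, sub_mul, Algebra.TensorProduct.tmul_mul_tmul, Algebra.TensorProduct.tmul_mul_tmul,
      map_sub, theta_tmul, theta_tmul, theta_tmul, Z, mul_sub, envTmul_mul, envTmul_mul,
      one_mul, one_mul, mul_one, one_mul, mul_comm (X j) f, mulL_mul, mulL_mul, mul_assoc]

section

variable [NeZero n]

/-- The `k`-linear map `S ⊗ S → P_l`, `F ↦ F (x_{w 0} ∧ ⋯) e_t`. -/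
noncomputable def T {l : ℕ} (t : ZMod n) (w : Fin l → Fin d) :
    MvPolynomial (Fin d) k ⊗[k] MvPolynomial (Fin d) k →ₗ[k] D.PP l :=
  ((LinearMap.toSpanSingleton (Env k D.B) (D.PP l) (D.wgen w)).restrictScalars k).comp (D.theta t)

theorem T_apply {l : ℕ} (t : ZMod n) (w : Fin l → Fin d)
    (F : MvPolynomial (Fin d) k ⊗[k] MvPolynomial (Fin d) k) :
    D.T t w F = D.theta t F • D.wgen w := rfl

theorem isAltFamily_T {l : ℕ} (t : ZMod n)
    (F : MvPolynomial (Fin d) k ⊗[k] MvPolynomial (Fin d) k) :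
    IsAltFamily fun w : Fin l → Fin d => D.T t w F := by
  intro c r h
  dsimp only
  rw [T_apply, T_apply, ← smul_add, D.isAltFamily_wgen c r h, smul_zero]

theorem e_mul_eq_sum (s : ZMod n) (c : D.B) :
    D.e s * c = ∑ t, D.mulL (D.projLin (s - t) (D.comp t c)) * D.e t := by
  conv_lhs => rw [← D.sum_comp c, Finset.mul_sum]
  exact Finset.sum_congr rfl fun t _ => D.e_mul_mulL_mul_e s t _

/-- The left factor is seen only on the summand where the path ends, and the right factor is split
by the summand `t` on which it starts; the path then selects the part of weight `s - t`. -/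
theorem tmul_eq_sum_T {l : ℕ} (b c : D.B) (s : ZMod n) (w : Fin l → Fin d) :
    P.tmul D.e D.a b ⟨s, w⟩ c =
      ∑ t, D.T t w (D.comp (s + D.wsum w) b ⊗ₜ D.projLin (s - t) (D.comp t c)) := by
  have h1 : P.tmul D.e D.a b ⟨s, w⟩ c =
      envTmul k (D.mulL (D.comp (s + D.wsum w) b)) (D.e s * c) • D.wgen w := by
    rw [tmul_eq_smul_wgen]
    have h2 : ∀ b : D.B, envTmul k b (D.e s * c) • D.wgen w =
        envTmul k (b * D.e (s + D.wsum w)) (D.e s * c) • D.wgen w := by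
      intro b
      rw [show envTmul k (b * D.e (s + D.wsum w)) (D.e s * c) =
          envTmul k b (D.e s * c) * envTmul k (D.e (s + D.wsum w)) 1 by
        rw [envTmul_mul, one_mul], mul_smul, env_left_smul_wgen, smul_smul, envTmul_mul, mul_one,
        ← mul_assoc, e_mul_e, if_pos rfl]
    change envTmul k b (D.e s * c) • D.wgen w = _
    rw [h2, h2 (D.mulL _), mulL_comp_mul_e]
  rw [h1, e_mul_eq_sum, ← envMk_apply, map_sum, Finset.sum_smul]
  rfl

theorem PP_T_induction {l : ℕ} {p : D.PP l → Prop} (y : D.PP l)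
    (hadd : ∀ x y, p x → p y → p (x + y)) (hT : ∀ t w F, p (D.T t w F)) : p y := by
  have h0 : p 0 := by
    have := hT 0 (fun _ => ⟨0, by have := D.two_le_d; omega⟩) 0
    rwa [map_zero] at this
  have hsum : ∀ {ι : Type} (s : Finset ι) (f : ι → D.PP l), (∀ i, p (f i)) → p (∑ i ∈ s, f i) :=
    fun s f hf => Finset.sum_induction f p hadd h0 fun i _ => hf i
  induction y using D.PP_induction with
  | hadd x y hx hy => exact hadd x y hx hy
  | hgen Y w =>
    induction Y using env_induction with
    | h0 => rwa [zero_smul]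
    | hadd Y Y' hY hY' => rw [add_smul]; exact hadd _ _ hY hY'
    | htmul b c =>
      rw [wgen, Finset.smul_sum]
      refine hsum _ _ fun s => ?_
      rw [← tmul_eq_smul_gen, tmul_eq_sum_T]
      exact hsum _ _ fun t => hT _ _ _

/-! ### The universal property of `P_l` as a vector space -/

section KLift

variable {l : ℕ} {N : Type*} [AddCommGroup N] [Module k N]

/-- The map `b ⊗ c ↦ b_i ⊗ c_t`, where `b_i` is the polynomial by which `b` multiplies `T^i`. -/
noncomputable def envComp (i t : ZMod n) :
    Env k D.B →ₗ[k] MvPolynomial (Fin d) k ⊗[k] MvPolynomial (Fin d) k :=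
  envLift₂ ((TensorProduct.mk k _ _).compl₁₂ (D.comp i) (D.comp t))

theorem envComp_envTmul (i t : ZMod n) (b c : D.B) :
    D.envComp i t (envTmul k b c) = D.comp i b ⊗ₜ D.comp t c :=
  envLift₂_envTmul _ _ _

/-- This expresses that `P_l` is the direct sum over `t` of copies of `(S ⊗ S) ⊗ Λ^l`: the maps `T t
w` have no relations besides alternation. The lift `Λ` is dictated by `tmul_eq_sum_T`. -/
theorem exists_k_lift
    (L : ZMod n → (Fin l → Fin d) →
      MvPolynomial (Fin d) k ⊗[k] MvPolynomial (Fin d) k →ₗ[k] N)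
    (hL : ∀ t, IsAltFamily (L t)) :
    ∃ f : D.PP l →ₗ[k] N, ∀ t w F, f (D.T t w F) = L t w F := by
  let Λ : ZMod n → (Fin l → Fin d) → Env k D.B →ₗ[k] N := fun s w =>
    ∑ t, (L t w).comp (((D.projLin (s - t)).lTensor _).comp (D.envComp (s + D.wsum w) t))
  have hΛ : ∀ s w b c, Λ s w (envTmul k b c) =
      ∑ t, L t w (D.comp (s + D.wsum w) b ⊗ₜ D.projLin (s - t) (D.comp t c)) := by
    intro s w b c
    simp only [Λ, LinearMap.sum_apply, LinearMap.comp_apply, envComp_envTmul,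
      LinearMap.lTensor_tmul]
  have hΛalt : ∀ s, IsAltFamily (Λ s) := by
    intro s c r h
    have hw : D.wsum (c ∘ Equiv.swap ⟨r, Nat.lt_of_succ_lt h⟩ ⟨r + 1, h⟩) = D.wsum c :=
      D.wsum_comp_perm c _
    simp only [Λ, hw]
    rw [← Finset.sum_add_distrib]
    refine Finset.sum_eq_zero fun t _ => ?_
    rw [← LinearMap.add_comp, hL t c r h, LinearMap.zero_comp]
  let φ : U k n d l →ₗ[k] Env k D.B →ₗ[k] N := uLift Λ hΛalt
  let ψ : Env k D.B ⊗[k] U k n d l →ₗ[k] N := TensorProduct.lift φ.flip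
  have hψ : ∀ Y (p : QPath n d l), ψ (Y ⊗ₜ wedge k p) = Λ p.src p.word Y := by
    intro Y p
    rw [TensorProduct.lift.tmul, LinearMap.flip_apply, uLift_wedge]
  -- The map `ψ` is only `k`-linear while the relations span a sub-bimodule, so vanishing is proved
  -- for all multiples `Y • z` at once.
  have key : ∀ z ∈ tensorRel (k := k) D.e D.a l, ∀ Y : Env k D.B, ψ (Y • z) = 0 := by
    intro z hz
    induction hz using Submodule.span_induction with
    | zero => intro Y; rw [smul_zero, map_zero]
    | add x y _ _ hx hy => intro Y; rw [smul_add, map_add, hx, hy, add_zero]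
    | smul Y' x _ hx => intro Y; rw [smul_smul, hx]
    | mem z hz =>
      intro Y
      obtain ⟨s, p, rfl⟩ | ⟨s, p, rfl⟩ := hz
      · rw [smul_sub, TensorProduct.smul_tmul', TensorProduct.smul_tmul', map_sub, sub_eq_zero,
          smul_eq_mul, smul_eq_mul, envTmul_one, mul_one, hψ]
        have h1 : Λ p.src p.word (Y * envTmul k (D.e s) 1) =
            if s = p.tgt D.a then Λ p.src p.word Y else 0 := by
          induction Y using env_induction with
          | h0 => rw [zero_mul, map_zero, ite_self]
          | hadd Y Y' hY hY' => rw [add_mul, map_add, hY, hY', map_add]; split_ifs <;> simp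
          | htmul b c =>
            rw [envTmul_mul, one_mul, hΛ, hΛ]
            simp only [comp_mul_e]
            have h2 : p.src + D.wsum p.word = s ↔ s = p.tgt D.a := eq_comm
            simp only [h2]
            split_ifs with h3
            · rw [h3]; rfl
            · exact Finset.sum_eq_zero fun t _ => by rw [TensorProduct.zero_tmul, map_zero]
        rw [h1]
        split_ifs
        · rw [hψ]
        · rw [TensorProduct.tmul_zero, map_zero]
      · rw [smul_sub, TensorProduct.smul_tmul', TensorProduct.smul_tmul', map_sub, sub_eq_zero,
          smul_eq_mul, smul_eq_mul, envTmul_one, mul_one, hψ]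
        have h1 : Λ p.src p.word (Y * envTmul k 1 (D.e s)) =
            if s = p.src then Λ p.src p.word Y else 0 := by
          induction Y using env_induction with
          | h0 => rw [zero_mul, map_zero, ite_self]
          | hadd Y Y' hY hY' => rw [add_mul, map_add, hY, hY', map_add]; split_ifs <;> simp
          | htmul b c =>
            rw [envTmul_mul, mul_one, hΛ, hΛ]
            simp only [comp_e_mul, projLin_projLin, sub_left_inj]
            by_cases h3 : p.src = s
            · simp only [h3, if_true]
            · simp only [if_neg h3, if_neg (Ne.symm h3)]
              exact Finset.sum_eq_zero fun t _ => by rw [TensorProduct.tmul_zero, map_zero]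
        rw [h1]
        split_ifs
        · rw [hψ]
        · rw [TensorProduct.tmul_zero, map_zero]
  have hker : (tensorRel (k := k) D.e D.a l).restrictScalars k ≤ LinearMap.ker ψ := by
    intro z hz
    have := key z hz 1
    rwa [one_smul] at this
  let f : D.PP l →ₗ[k] N := ((tensorRel (k := k) D.e D.a l).restrictScalars k).liftQ ψ hker
  have hf : ∀ Y p, f (Y • D.gen p) = Λ p.src p.word Y := by
    intro Y p
    rw [← mkQ_tmul_wedge, ← hψ]
    rfl
  refine ⟨f, fun t w F => ?_⟩
  induction F using TensorProduct.induction_on with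
  | zero => rw [map_zero, map_zero, map_zero]
  | add F G hF hG => rw [map_add, map_add, map_add, hF, hG]
  | tmul g h =>
    rw [T_apply, wgen, Finset.smul_sum, map_sum]
    simp only [hf, theta_tmul, hΛ, comp_mulL, comp_mul_e]
    have h1 : ∀ s : ZMod n, (∑ t', L t' w (g ⊗ₜ D.projLin (s - t') (if t' = t then h else 0))) =
        L t w (g ⊗ₜ D.projLin (s - t) h) := by
      intro s
      rw [Finset.sum_eq_single t]
      · rw [if_pos rfl]
      · intro t' _ ht'
        rw [if_neg ht', map_zero, TensorProduct.tmul_zero, map_zero]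
      · simp
    simp only [h1]
    -- `wgen` sums over all sources, and with `t` fixed these correspond to all weight components of
    -- `h`.
    have h2 : ∑ s, D.projLin (s - t) h = h :=
      (Equiv.sum_comp (Equiv.subRight t) fun s => D.projLin s h).trans (D.sum_projLin h)
    rw [← map_sum, ← TensorProduct.tmul_sum, h2]

/-- The `k`-linear map on `P_l` given by an alternating family of linear maps on `S ⊗ S`. -/
noncomputable def kLift
    (L : ZMod n → (Fin l → Fin d) →
      MvPolynomial (Fin d) k ⊗[k] MvPolynomial (Fin d) k →ₗ[k] N)
    (hL : ∀ t, IsAltFamily (L t)) : D.PP l →ₗ[k] N := (D.exists_k_lift L hL).choose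

theorem kLift_T
    (L : ZMod n → (Fin l → Fin d) →
      MvPolynomial (Fin d) k ⊗[k] MvPolynomial (Fin d) k →ₗ[k] N)
    (hL : ∀ t, IsAltFamily (L t)) (t : ZMod n) (w : Fin l → Fin d)
    (F : MvPolynomial (Fin d) k ⊗[k] MvPolynomial (Fin d) k) :
    D.kLift L hL (D.T t w F) = L t w F := (D.exists_k_lift L hL).choose_spec t w F

end KLift

end

end CyclicDatum

/-! ### The Euler homotopy for polynomials in two sets of variables -/

section Euler

open MvPolynomial

universe u

variable (k : Type u) [Field k] (d : ℕ)

/-- The change of variables: polynomials in `z_j = x_j ⊗ 1 - 1 ⊗ x_j` with coefficients in the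
second factor of `S ⊗ S`. -/
noncomputable def changeVar : MvPolynomial (Fin d) (MvPolynomial (Fin d) k) ≃ₐ[k]
    MvPolynomial (Fin d) k ⊗[k] MvPolynomial (Fin d) k :=
  AlgEquiv.ofAlgHom
    (aevalTower Algebra.TensorProduct.includeRight fun j => CyclicDatum.zt k j)
    (Algebra.TensorProduct.lift (aeval fun j => X j + C (X j))
      (IsScalarTower.toAlgHom k (MvPolynomial (Fin d) k) _) fun _ _ => Commute.all _ _)
    (by
      apply Algebra.TensorProduct.ext
      · apply MvPolynomial.algHom_ext
        intro j
        simp [CyclicDatum.zt, aevalTower_C]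
      · apply MvPolynomial.algHom_ext
        intro j
        simp [MvPolynomial.algebraMap_eq, aevalTower_C])
    (by
      apply MvPolynomial.algHom_ext'
      · apply MvPolynomial.algHom_ext
        intro j
        simp [MvPolynomial.algebraMap_eq, aevalTower_C]
      · intro j
        simp [CyclicDatum.zt, MvPolynomial.algebraMap_eq])

theorem changeVar_X (j : Fin d) : changeVar k d (X j) = CyclicDatum.zt k j := by
  simp [changeVar]

theorem changeVar_C (f : MvPolynomial (Fin d) k) : changeVar k d (C f) = 1 ⊗ₜ f := by
  simp [changeVar]

/-- Multiplication `S ⊗ S → S` kills every `z_j` and is the identity on the second factor, so it is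
evaluation at `z = 0`. -/
theorem mul'_changeVar (p : MvPolynomial (Fin d) (MvPolynomial (Fin d) k)) :
    LinearMap.mul' k _ (changeVar k d p) = coeff 0 p := by
  have h : (Algebra.TensorProduct.lmul' k).comp (changeVar k d).toAlgHom =
      aevalTower (AlgHom.id k (MvPolynomial (Fin d) k)) fun _ => 0 := by
    apply MvPolynomial.algHom_ext'
    · apply MvPolynomial.algHom_ext
      intro j
      simp [MvPolynomial.algebraMap_eq, changeVar_C]
    · intro j
      simp [changeVar_X, CyclicDatum.zt]
  have h2 := DFunLike.congr_fun h p
  refine Eq.trans h2 ?_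
  clear h2
  rw [← constantCoeff_eq]
  induction p using MvPolynomial.induction_on with
  | C a => simp [aevalTower_C]
  | add p q hp hq => rw [map_add, map_add, hp, hq]
  | mul_X p j _ => simp

/-- The operator that divides a monomial of degree `r` by `l + r`. -/
noncomputable def eulerInvPoly (l : ℕ) : MvPolynomial (Fin d) (MvPolynomial (Fin d) k) →ₗ[k]
    MvPolynomial (Fin d) (MvPolynomial (Fin d) k) :=
  ((basisMonomials (Fin d) (MvPolynomial (Fin d) k)).constr (MvPolynomial (Fin d) k) fun u =>
    monomial u (C (((l : k) + (u.degree : k))⁻¹))).restrictScalars k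

theorem eulerInvPoly_monomial (l : ℕ) (u : Fin d →₀ ℕ) (c : MvPolynomial (Fin d) k) :
    eulerInvPoly k d l (monomial u c) = ((l : k) + (u.degree : k))⁻¹ • monomial u c := by
  have h : monomial u c = c • basisMonomials (Fin d) (MvPolynomial (Fin d) k) u := by
    simp [smul_monomial]
  rw [eulerInvPoly, LinearMap.restrictScalars_apply, h, map_smul, Module.Basis.constr_basis,
    coe_basisMonomials, smul_monomial, smul_monomial, smul_monomial, smul_eq_mul, smul_eq_mul,
    mul_one, smul_eq_C_mul, mul_comm]

/-- Multiplying by a variable while lowering the shift keeps the denominator `l + 1 + r`. This is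
why the scaling commutes with the differential. -/
theorem eulerInvPoly_X_mul (l : ℕ) (j : Fin d)
    (p : MvPolynomial (Fin d) (MvPolynomial (Fin d) k)) :
    eulerInvPoly k d l (X j * p) = X j * eulerInvPoly k d (l + 1) p := by
  induction p using MvPolynomial.induction_on' with
  | add p q hp hq => rw [mul_add, map_add, hp, hq, map_add, mul_add]
  | monomial u c =>
    have h : (X j : MvPolynomial (Fin d) (MvPolynomial (Fin d) k)) * monomial u c =
        monomial (Finsupp.single j 1 + u) c := by
      rw [X, monomial_mul, one_mul]
    rw [h, eulerInvPoly_monomial, eulerInvPoly_monomial, mul_smul_comm, h, map_add,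
      Finsupp.degree_single]
    push_cast
    rw [add_assoc]

/-- Monomials of degree `r` are eigenvectors of the shifted Euler operator with eigenvalue `l + r`,
which vanishes only for `l = r = 0`. -/
theorem eulerInvPoly_euler [CharZero k] (l : ℕ)
    (p : MvPolynomial (Fin d) (MvPolynomial (Fin d) k)) :
    eulerInvPoly k d l ((l : k) • p + ∑ j, X j * pderiv j p) =
      if l = 0 then p - C (coeff 0 p) else p := by
  classical
  induction p using MvPolynomial.induction_on' with
  | add p q hp hq =>
    have h : (l : k) • (p + q) + ∑ j, X j * pderiv j (p + q) =
        ((l : k) • p + ∑ j, X j * pderiv j p) + ((l : k) • q + ∑ j, X j * pderiv j q) := by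
      simp only [map_add, mul_add, smul_add, Finset.sum_add_distrib]
      abel
    rw [h, map_add, hp, hq]
    split_ifs
    · rw [coeff_add, map_add]; ring
    · rfl
  | monomial u c =>
    have h1 : ∑ j, X j * pderiv j (monomial u c) = (u.degree : k) • monomial u c := by
      rw [(isHomogeneous_monomial c rfl).sum_X_mul_pderiv, Nat.cast_smul_eq_nsmul]
    rw [h1, ← add_smul, map_smul, eulerInvPoly_monomial, smul_smul]
    -- In the degenerate case both sides vanish: the Euler operator kills the constant, and the
    -- right side subtracts it.
    by_cases hu : (l : k) + u.degree = 0
    · have hu' : l + u.degree = 0 := by exact_mod_cast hu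
      have hl : l = 0 := by omega
      have hu0 : u = 0 := by
        rw [← Finsupp.degree_eq_zero_iff]; omega
      rw [hu, zero_mul, zero_smul, if_pos hl, hu0, coeff_monomial, if_pos rfl]
      exact (sub_self _).symm
    · rw [mul_inv_cancel₀ hu, one_smul]
      split_ifs with hl
      · have hu0 : u ≠ 0 := by
          rintro rfl
          simp [hl] at hu
        rw [coeff_monomial, if_neg hu0, map_zero, sub_zero]
      · rfl

/-- The derivation of `S ⊗ S` with respect to `z_j`. -/
noncomputable def pd (j : Fin d) : MvPolynomial (Fin d) k ⊗[k] MvPolynomial (Fin d) k →ₗ[k]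
    MvPolynomial (Fin d) k ⊗[k] MvPolynomial (Fin d) k :=
  (changeVar k d).toLinearMap ∘ₗ ((pderiv j).toLinearMap.restrictScalars k) ∘ₗ
    (changeVar k d).symm.toLinearMap

/-- The inverse of the Euler operator of `S ⊗ S` shifted by `l`. -/
noncomputable def eulerInv (l : ℕ) : MvPolynomial (Fin d) k ⊗[k] MvPolynomial (Fin d) k →ₗ[k]
    MvPolynomial (Fin d) k ⊗[k] MvPolynomial (Fin d) k :=
  (changeVar k d).toLinearMap ∘ₗ eulerInvPoly k d l ∘ₗ (changeVar k d).symm.toLinearMap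

theorem pd_changeVar (j : Fin d) (p : MvPolynomial (Fin d) (MvPolynomial (Fin d) k)) :
    pd k d j (changeVar k d p) = changeVar k d (pderiv j p) := by
  change changeVar k d (pderiv j ((changeVar k d).symm (changeVar k d p))) = _
  rw [AlgEquiv.symm_apply_apply]

theorem eulerInv_changeVar (l : ℕ) (p : MvPolynomial (Fin d) (MvPolynomial (Fin d) k)) :
    eulerInv k d l (changeVar k d p) = changeVar k d (eulerInvPoly k d l p) := by
  change changeVar k d (eulerInvPoly k d l ((changeVar k d).symm (changeVar k d p))) = _
  rw [AlgEquiv.symm_apply_apply]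

theorem pd_zt_mul (i j : Fin d) (F : MvPolynomial (Fin d) k ⊗[k] MvPolynomial (Fin d) k) :
    pd k d j (CyclicDatum.zt k i * F) =
      (if j = i then F else 0) + CyclicDatum.zt k i * pd k d j F := by
  obtain ⟨p, rfl⟩ := (changeVar k d).surjective F
  rw [← changeVar_X, ← map_mul, pd_changeVar, pd_changeVar, Derivation.leibniz, pderiv_X,
    smul_eq_mul, smul_eq_mul, map_add, map_mul, add_comm]
  congr 1
  by_cases h : j = i
  · subst h
    simp
  · rw [if_neg h, Pi.single_eq_of_ne (Ne.symm h), mul_zero, map_zero]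

theorem eulerInv_zt_mul (l : ℕ) (j : Fin d)
    (F : MvPolynomial (Fin d) k ⊗[k] MvPolynomial (Fin d) k) :
    eulerInv k d l (CyclicDatum.zt k j * F) = CyclicDatum.zt k j * eulerInv k d (l + 1) F := by
  obtain ⟨p, rfl⟩ := (changeVar k d).surjective F
  rw [← changeVar_X, ← map_mul, eulerInv_changeVar, eulerInv_changeVar, eulerInvPoly_X_mul, map_mul]

theorem eulerInv_euler [CharZero k] (l : ℕ)
    (F : MvPolynomial (Fin d) k ⊗[k] MvPolynomial (Fin d) k) :
    eulerInv k d l ((l : k) • F + ∑ j, CyclicDatum.zt k j * pd k d j F) =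
      if l = 0 then F - 1 ⊗ₜ LinearMap.mul' k _ F else F := by
  obtain ⟨p, rfl⟩ := (changeVar k d).surjective F
  simp only [← changeVar_X, pd_changeVar, ← map_mul, ← map_sum, ← map_smul, ← map_add,
    eulerInv_changeVar, eulerInvPoly_euler, mul'_changeVar, ← changeVar_C]
  split_ifs
  · rw [map_sub]
  · rfl

end Euler

namespace CyclicDatum

open MvPolynomial McKay

universe u

variable {k : Type u} [Field k] {d n : ℕ} (D : CyclicDatum k d n)

/-! ### The differential and the augmentation -/

theorem mulL_X_mul_e (j : Fin d) (s : ZMod n) :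
    D.mulL (X j) * D.e s = D.e (s + D.a j) * D.mulL (X j) := D.arrow_eq' s j

section

variable [NeZero n]

/-- Whether `x_j` is attached at the end or at the start of the path, the difference between target
and source grows by `a_j`. -/
theorem env_left_smul_Z {l : ℕ} (s : ZMod n) (j : Fin d) (w : Fin l → Fin d) :
    envTmul k (D.e (s + (D.wsum w + D.a j))) 1 • D.Z j • D.wgen w =
      envTmul k 1 (D.e s) • D.Z j • D.wgen w := by
  have h1 : envTmul k (D.e (s + (D.wsum w + D.a j))) 1 • envTmul k (D.mulL (X j)) 1 • D.wgen w =
      envTmul k 1 (D.e s) • envTmul k (D.mulL (X j)) 1 • D.wgen w := by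
    rw [smul_smul, envTmul_mul, ← add_assoc, ← mulL_X_mul_e, ← envTmul_mul, mul_smul,
      env_left_smul_wgen, smul_smul, smul_smul, envTmul_mul, envTmul_mul, one_mul, mul_one, mul_one,
      one_mul]
  have h2 : envTmul k (D.e (s + (D.wsum w + D.a j))) 1 • envTmul k 1 (D.mulL (X j)) • D.wgen w =
      envTmul k 1 (D.e s) • envTmul k 1 (D.mulL (X j)) • D.wgen w := by
    rw [smul_smul, smul_smul, envTmul_mul, envTmul_mul, mulL_X_mul_e, mul_one, mul_one,
      show s + (D.wsum w + D.a j) = (s + D.a j) + D.wsum w by abel,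
      show envTmul k (D.e (s + D.a j + D.wsum w)) (D.mulL (X j)) =
        envTmul k 1 (D.mulL (X j)) * envTmul k (D.e (s + D.a j + D.wsum w)) 1 by
        rw [envTmul_mul, one_mul, one_mul],
      mul_smul, env_left_smul_wgen, smul_smul, envTmul_mul, mul_one]
  rw [Z, sub_smul, smul_sub, smul_sub, h1, h2]

/-- The differential `P_{l+1} → P_l`. -/
noncomputable def diff (l : ℕ) : D.PP (l + 1) →ₗ[Env k D.B] D.PP l :=
  D.envLift (fun w => ∑ i : Fin (l + 1), (-1 : ℤ) ^ (i : ℕ) • D.Z (w i) • D.wgen (w ∘ i.succAbove))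
    (isAltFamily_sum_succAbove (f := fun j c => D.Z j • D.wgen c) fun j c r h => by
      dsimp only
      rw [← smul_add, D.isAltFamily_wgen c r h, smul_zero])
    (fun s w => by
      rw [Finset.smul_sum, Finset.smul_sum]
      refine Finset.sum_congr rfl fun i _ => ?_
      rw [smul_comm, smul_comm (envTmul k 1 (D.e s)), ← D.wsum_succAbove w i, env_left_smul_Z])

theorem diff_wgen {l : ℕ} (w : Fin (l + 1) → Fin d) :
    D.diff l (D.wgen w) =
      ∑ i : Fin (l + 1), (-1 : ℤ) ^ (i : ℕ) • D.Z (w i) • D.wgen (w ∘ i.succAbove) :=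
  D.envLift_wgen _ _ _ w

theorem diff_T {l : ℕ} (t : ZMod n) (w : Fin (l + 1) → Fin d)
    (F : MvPolynomial (Fin d) k ⊗[k] MvPolynomial (Fin d) k) :
    D.diff l (D.T t w F) =
      ∑ i : Fin (l + 1), (-1 : ℤ) ^ (i : ℕ) • D.T t (w ∘ i.succAbove) (zt k (w i) * F) := by
  rw [T_apply, map_smul, diff_wgen, Finset.smul_sum]
  refine Finset.sum_congr rfl fun i _ => ?_
  rw [smul_comm, smul_smul, theta_mul_Z, T_apply]

/-- Cutting `Z` by idempotents turns multiplication by `x_j` into the arrow at the required vertex: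
in the first term at the end of the shortened path, in the second at the original source. -/
theorem isKoszulDifferential_diff : IsKoszulDifferential D.e D.arrow D.a D.diff := by
  intro l b b' p
  rw [tmul_eq_smul_wgen, map_smul, diff_wgen, Finset.smul_sum]
  refine Finset.sum_congr rfl fun i _ => ?_
  rw [smul_comm]
  congr 1
  rw [Z, sub_smul, smul_sub]
  congr 1
  · rw [tmul_eq_smul_wgen, arrow_eq, smul_smul, envTmul_mul, one_mul]
    change _ = envTmul k (b * (D.mulL (X (p.word i)) *
      D.e (p.src + D.wsum (p.word ∘ i.succAbove)))) (D.e p.src * b') • D.wgen _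
    rw [show envTmul k (b * (D.mulL (X (p.word i)) *
        D.e (p.src + D.wsum (p.word ∘ i.succAbove)))) (D.e p.src * b') =
        envTmul k (b * D.mulL (X (p.word i))) (D.e p.src * b') *
        envTmul k (D.e (p.src + D.wsum (p.word ∘ i.succAbove))) 1 by
      rw [envTmul_mul, one_mul, mul_assoc], mul_smul, env_left_smul_wgen, smul_smul, envTmul_mul,
      mul_one, ← mul_assoc (D.e p.src), e_mul_e, if_pos rfl]
  · rw [tmul_eq_smul_wgen, smul_smul, envTmul_mul, mul_one, ← mul_assoc, ← mul_assoc, e_mul_arrow,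
      if_pos rfl, arrow_eq]

theorem diff_diff {l : ℕ} (y : D.PP (l + 2)) : D.diff l (D.diff (l + 1) y) = 0 := by
  induction y using D.PP_T_induction with
  | hadd x y hx hy => rw [map_add, map_add, hx, hy, add_zero]
  | hT t w F =>
    rw [diff_T, map_sum]
    simp only [map_zsmul, diff_T]
    refine sum_succAbove_succAbove
      (f := fun i j c => D.T t c (zt k j * (zt k i * F))) (fun i j c => ?_) w
    rw [mul_left_comm]

/-- The augmentation `P_0 → B`. -/
noncomputable def aug : D.PP 0 →ₗ[k] D.B :=
  D.kLift (fun t _ => (D.mulLE t).comp (LinearMap.mul' k _)) fun _ _ r h => absurd h (by omega)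

theorem aug_T (t : ZMod n) (w : Fin 0 → Fin d)
    (F : MvPolynomial (Fin d) k ⊗[k] MvPolynomial (Fin d) k) :
    D.aug (D.T t w F) = D.mulL (LinearMap.mul' k _ F) * D.e t :=
  D.kLift_T _ _ t w F

theorem aug_tmul (b b' : D.B) (p : QPath n d 0) :
    D.aug (P.tmul D.e D.a b p b') = b * D.e p.src * b' := by
  obtain ⟨s, w⟩ := p
  rw [tmul_eq_sum_T, map_sum]
  simp only [aug_T, LinearMap.mul'_apply, mulL_mul, mul_assoc]
  rw [← Finset.mul_sum, ← e_mul_eq_sum, ← mul_assoc, show D.wsum w = 0 by simp [wsum], add_zero,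
    ← mul_assoc b, ← mulL_comp_mul_e D b s, mul_assoc]

theorem isAugmentation_aug : IsAugmentation D.e D.a D.aug := D.aug_tmul

theorem aug_wgen (X : Env k D.B) (w : Fin 0 → Fin d) (b c : D.B) :
    D.aug (envTmul k b c • X • D.wgen w) = b * D.aug (X • D.wgen w) * c := by
  induction X using env_induction with
  | h0 => simp
  | hadd X Y hX hY => rw [add_smul, smul_add, map_add, hX, hY, map_add, mul_add, add_mul]
  | htmul b' c' =>
    have h : ∀ b c, D.aug (envTmul k b c • D.wgen w) = b * c := by
      intro b c
      rw [wgen, Finset.smul_sum, map_sum]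
      simp only [← tmul_eq_smul_gen, aug_tmul]
      rw [← Finset.sum_mul, ← Finset.mul_sum, sum_e, mul_one]
    rw [smul_smul, envTmul_mul, h, h]
    simp only [mul_assoc]

theorem aug_smul (b c : D.B) (y : D.PP 0) : D.aug (envTmul k b c • y) = b * D.aug y * c := by
  induction y using D.PP_induction with
  | hadd x y hx hy => rw [smul_add, map_add, hx, hy, map_add, mul_add, add_mul]
  | hgen X w => exact D.aug_wgen X w b c

theorem aug_surjective : Function.Surjective D.aug := by
  intro b
  refine ⟨envTmul k b 1 • D.wgen Fin.elim0, ?_⟩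
  rw [wgen, Finset.smul_sum, map_sum]
  simp only [← tmul_eq_smul_gen, aug_tmul, mul_one]
  rw [← Finset.mul_sum, sum_e, mul_one]

theorem aug_diff (y : D.PP 1) : D.aug (D.diff 0 y) = 0 := by
  induction y using D.PP_T_induction with
  | hadd x y hx hy => rw [map_add, map_add, hx, hy, add_zero]
  | hT t w F =>
    rw [diff_T, map_sum]
    refine Finset.sum_eq_zero fun i _ => ?_
    have h : LinearMap.mul' k _ (zt k (w i) * F) = 0 := by
      have : Algebra.TensorProduct.lmul' k (zt k (w i) * F) = 0 := by
        rw [map_mul, zt, map_sub, Algebra.TensorProduct.lmul'_apply_tmul,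
          Algebra.TensorProduct.lmul'_apply_tmul, mul_one, one_mul, sub_self, zero_mul]
      exact this
    rw [map_zsmul, aug_T, h, map_zero, zero_mul, smul_zero]

/-! ### Exactness -/

/-- With a letter put in front, a transposition of the word becomes a transposition of the shifted
positions. -/
theorem isAltFamily_cons_pd {l : ℕ} (t : ZMod n) :
    IsAltFamily fun w : Fin l → Fin d =>
      ∑ j, (D.T t (Fin.cons j w : Fin (l + 1) → Fin d)).comp (pd k d j) := by
  intro c r h
  dsimp only
  rw [← Finset.sum_add_distrib]
  refine Finset.sum_eq_zero fun j _ => ?_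
  have h1 : (Fin.cons j (c ∘ Equiv.swap ⟨r, Nat.lt_of_succ_lt h⟩ ⟨r + 1, h⟩) :
      Fin (l + 1) → Fin d) = (Fin.cons j c : Fin (l + 1) → Fin d) ∘
      Equiv.swap (Fin.succ ⟨r, Nat.lt_of_succ_lt h⟩) (Fin.succ ⟨r + 1, h⟩) := by
    funext x
    refine Fin.cases ?_ (fun x => ?_) x
    · rw [Function.comp_apply, Equiv.swap_apply_of_ne_of_ne (Fin.succ_ne_zero _).symm
        (Fin.succ_ne_zero _).symm, Fin.cons_zero, Fin.cons_zero]
    · rw [Function.comp_apply, (Fin.succ_injective l).swap_apply, Fin.cons_succ, Fin.cons_succ,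
        Function.comp_apply]
  refine LinearMap.ext fun F => ?_
  rw [h1, LinearMap.add_apply, LinearMap.comp_apply, LinearMap.comp_apply,
    (D.isAltFamily_T t (pd k d j F)).comp_swap _ (by simp [Fin.ext_iff]), add_neg_cancel,
    LinearMap.zero_apply]

/-- The homotopy `F (x_{w 0} ∧ ⋯) ↦ ∑ j, ∂_j F (x_j ∧ x_{w 0} ∧ ⋯)`. -/
noncomputable def homot (l : ℕ) : D.PP l →ₗ[k] D.PP (l + 1) :=
  D.kLift (fun t w => ∑ j, (D.T t (Fin.cons j w : Fin (l + 1) → Fin d)).comp (pd k d j))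
    D.isAltFamily_cons_pd

theorem homot_T {l : ℕ} (t : ZMod n) (w : Fin l → Fin d)
    (F : MvPolynomial (Fin d) k ⊗[k] MvPolynomial (Fin d) k) :
    D.homot l (D.T t w F) = ∑ j, D.T t (Fin.cons j w : Fin (l + 1) → Fin d) (pd k d j F) := by
  refine (D.kLift_T _ D.isAltFamily_cons_pd t w F).trans ?_
  rw [LinearMap.sum_apply]
  rfl

/-- The operator on `P_l` induced by the inverse of the shifted Euler operator. -/
noncomputable def scale (l : ℕ) : D.PP l →ₗ[k] D.PP l :=
  D.kLift (fun t w => (D.T t w).comp (eulerInv k d l)) <| by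
    intro t c r h
    refine LinearMap.ext fun F => ?_
    exact D.isAltFamily_T t (eulerInv k d l F) c r h

theorem scale_T {l : ℕ} (t : ZMod n) (w : Fin l → Fin d)
    (F : MvPolynomial (Fin d) k ⊗[k] MvPolynomial (Fin d) k) :
    D.scale l (D.T t w F) = D.T t w (eulerInv k d l F) := D.kLift_T _ _ t w F

/-- The differential trades one wedge factor for one factor `z_j`, so it preserves the total degree
that determines the scaling. -/
theorem scale_diff {l : ℕ} (y : D.PP (l + 1)) :
    D.scale l (D.diff l y) = D.diff l (D.scale (l + 1) y) := by
  induction y using D.PP_T_induction with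
  | hadd x y hx hy => simp only [map_add, hx, hy]
  | hT t w F =>
    rw [diff_T, scale_T, diff_T, map_sum]
    refine Finset.sum_congr rfl fun i _ => ?_
    rw [map_zsmul, scale_T, eulerInv_zt_mul]

theorem diff_T_cons {l : ℕ} (t : ZMod n) (j : Fin d) (w : Fin (l + 1) → Fin d)
    (F : MvPolynomial (Fin d) k ⊗[k] MvPolynomial (Fin d) k) :
    D.diff (l + 1) (D.T t (Fin.cons j w : Fin (l + 2) → Fin d) F) = D.T t w (zt k j * F) -
      ∑ i : Fin (l + 1), (-1 : ℤ) ^ (i : ℕ) •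
        D.T t (Fin.cons j (w ∘ i.succAbove) : Fin (l + 1) → Fin d) (zt k (w i) * F) := by
  rw [diff_T, Fin.sum_univ_succ, sub_eq_add_neg, ← Finset.sum_neg_distrib]
  congr 1
  · rw [Fin.val_zero, pow_zero, one_smul]
    rfl
  · refine Finset.sum_congr rfl fun i _ => ?_
    have h : (Fin.cons j w : Fin (l + 2) → Fin d) ∘ i.succ.succAbove =
        Fin.cons j (w ∘ i.succAbove) := by
      funext x
      refine Fin.cases ?_ (fun x => ?_) x
      · simp
      · simp
    rw [h, Fin.cons_succ, Fin.val_succ, pow_succ, mul_neg_one, neg_smul]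

theorem T_natCast_smul {l : ℕ} (m : ℕ) (t : ZMod n) (w : Fin l → Fin d)
    (F : MvPolynomial (Fin d) k ⊗[k] MvPolynomial (Fin d) k) :
    D.T t w ((m : k) • F) = m • D.T t w F := by
  rw [Nat.cast_smul_eq_nsmul, map_nsmul]

/-- Cartan's formula. In `δ h`, omitting the new letter gives `∑ z_j ∂_j F`. In `h δ`, the Leibniz
rule produces `F` once for each of the `l + 1` letters, the two signs from omitting a letter and
moving it to the front cancelling. The remaining terms of the two compositions are opposite. -/
theorem diff_homot_add (l : ℕ) (t : ZMod n) (w : Fin (l + 1) → Fin d)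
    (F : MvPolynomial (Fin d) k ⊗[k] MvPolynomial (Fin d) k) :
    D.diff (l + 1) (D.homot (l + 1) (D.T t w F)) + D.homot l (D.diff l (D.T t w F)) =
      D.T t w (((l + 1 : ℕ) : k) • F + ∑ j, zt k j * pd k d j F) := by
  have hR : D.T t w (((l + 1 : ℕ) : k) • F + ∑ j, zt k j * pd k d j F) =
      (l + 1) • D.T t w F + ∑ j, D.T t w (zt k j * pd k d j F) := by
    rw [LinearMap.map_add, T_natCast_smul, map_sum]
  rw [hR, homot_T, map_sum, diff_T, map_sum]
  simp only [diff_T_cons, map_zsmul, homot_T, pd_zt_mul, map_add, Finset.sum_add_distrib,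
    Finset.sum_sub_distrib, smul_add]
  have h1 : ∀ i : Fin (l + 1), (-1 : ℤ) ^ (i : ℕ) • ∑ j, D.T t
      (Fin.cons j (w ∘ i.succAbove) : Fin (l + 1) → Fin d) (if j = w i then F else 0) =
      D.T t w F := by
    intro i
    rw [Finset.sum_eq_single (w i), if_pos rfl, (D.isAltFamily_T t F).cons, smul_smul, ← mul_pow]
    · simp
    · intro j _ hj
      rw [if_neg hj, map_zero]
    · simp
  have h2 : (∑ j, ∑ i : Fin (l + 1), (-1 : ℤ) ^ (i : ℕ) •
      D.T t (Fin.cons j (w ∘ i.succAbove) : Fin (l + 1) → Fin d) (zt k (w i) * pd k d j F)) =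
      ∑ i : Fin (l + 1), (-1 : ℤ) ^ (i : ℕ) • ∑ j,
      D.T t (Fin.cons j (w ∘ i.succAbove) : Fin (l + 1) → Fin d) (zt k (w i) * pd k d j F) := by
    rw [Finset.sum_comm]
    exact Finset.sum_congr rfl fun i _ => Finset.smul_sum.symm
  rw [h2]
  simp only [h1, Finset.sum_const, Finset.card_univ, Fintype.card_fin]
  abel

/-- In wedge degree at least `1` the Cartan operator is inverted by `scale`. For a cycle only `δ h`
contributes, and `scale` passes through `δ`, so the cycle is a boundary. -/
theorem exact_diff [CharZero k] (l : ℕ) : Function.Exact (D.diff (l + 1)) (D.diff l) := by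
  intro y
  constructor
  · intro hy
    have key : ∀ y, D.scale (l + 1) (D.diff (l + 1) (D.homot (l + 1) y) +
        D.homot l (D.diff l y)) = y := by
      intro y
      induction y using D.PP_T_induction with
      | hadd x y hx hy =>
        simp only [map_add] at hx hy ⊢
        conv_rhs => rw [← hx, ← hy]
        abel
      | hT t w F =>
        rw [diff_homot_add, scale_T, eulerInv_euler, if_neg (Nat.succ_ne_zero l)]
    have h := key y
    rw [hy, map_zero, add_zero, scale_diff] at h
    exact ⟨_, h⟩
  · rintro ⟨z, rfl⟩
    exact D.diff_diff z

/-- A `k`-linear section of the augmentation. -/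
noncomputable def augSection : D.B →ₗ[k] D.PP 0 :=
  ∑ t, (D.T t Fin.elim0).comp ((TensorProduct.mk k _ _ 1).comp (D.comp t))

theorem augSection_mulL_mul_e (f : MvPolynomial (Fin d) k) (t : ZMod n) :
    D.augSection (D.mulL f * D.e t) = D.T t Fin.elim0 (1 ⊗ₜ f) := by
  rw [augSection, LinearMap.sum_apply, Finset.sum_eq_single t]
  · simp only [LinearMap.comp_apply, comp_mul_e, comp_mulL, if_true]
    rfl
  · intro s _ hs
    simp only [LinearMap.comp_apply, comp_mul_e, if_neg hs, map_zero]
  · simp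

/-- In wedge degree `0` the Euler operator is invertible only up to the constants in `z`, and the
missing part is the section applied to the augmentation. It vanishes on the kernel of `ε`. -/
theorem exact_aug [CharZero k] : Function.Exact (D.diff 0) D.aug := by
  intro y
  constructor
  · intro hy
    have key : ∀ y, D.scale 0 (D.diff 0 (D.homot 0 y)) = y - D.augSection (D.aug y) := by
      intro y
      induction y using D.PP_T_induction with
      | hadd x y hx hy => simp only [map_add, hx, hy]; abel
      | hT t w F =>
        have h1 : D.diff 0 (D.homot 0 (D.T t w F)) =
            D.T t w (((0 : ℕ) : k) • F + ∑ j, zt k j * pd k d j F) := by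
          have h0 : ((0 : ℕ) : k) • F + ∑ j, zt k j * pd k d j F = ∑ j, zt k j * pd k d j F := by
            rw [Nat.cast_zero, zero_smul, zero_add]
          rw [h0, homot_T, map_sum, map_sum]
          refine Finset.sum_congr rfl fun j _ => ?_
          rw [diff_T, Fin.sum_univ_one, Fin.val_zero, pow_zero, one_smul, Fin.cons_zero,
            Subsingleton.elim (_ ∘ _) w]
        rw [h1, scale_T, eulerInv_euler, if_pos rfl, map_sub, aug_T, augSection_mulL_mul_e,
          Subsingleton.elim w Fin.elim0]
    have h := key y
    rw [hy, map_zero, sub_zero, scale_diff] at h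
    exact ⟨_, h⟩
  · rintro ⟨z, rfl⟩
    exact D.aug_diff z

end

end CyclicDatum

namespace CyclicDatum

open MvPolynomial McKay

universe u

variable {k : Type u} [Field k] {d n : ℕ} (D : CyclicDatum k d n)

/-! ### Elementary properties of `P_l` -/

theorem tgt_eq {l : ℕ} (s : ZMod n) (w : Fin l → Fin d) :
    QPath.tgt D.a (⟨s, w⟩ : QPath n d l) = s + D.wsum w := rfl

theorem tmul_add_left {l : ℕ} (b b' c : D.B) (p : QPath n d l) :
    P.tmul D.e D.a (b + b') p c = P.tmul D.e D.a b p c + P.tmul (k := k) D.e D.a b' p c := by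
  simp only [tmul_eq_smul_gen, ← envMk_apply, map_add, LinearMap.add_apply, add_smul]

theorem tmul_add_right {l : ℕ} (b c c' : D.B) (p : QPath n d l) :
    P.tmul D.e D.a b p (c + c') = P.tmul D.e D.a b p c + P.tmul (k := k) D.e D.a b p c' := by
  simp only [tmul_eq_smul_gen, ← envMk_apply, map_add, add_smul]

theorem tmul_smul_left {l : ℕ} (r : k) (b c : D.B) (p : QPath n d l) :
    P.tmul D.e D.a (r • b) p c = r • P.tmul (k := k) D.e D.a b p c := by
  simp only [tmul_eq_smul_gen, ← envMk_apply, map_smul, LinearMap.smul_apply, smul_assoc]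

theorem tmul_smul_right {l : ℕ} (r : k) (b c : D.B) (p : QPath n d l) :
    P.tmul D.e D.a b p (r • c) = r • P.tmul (k := k) D.e D.a b p c := by
  simp only [tmul_eq_smul_gen, ← envMk_apply, map_smul, smul_assoc]

theorem tmul_zero_left {l : ℕ} (c : D.B) (p : QPath n d l) :
    P.tmul (k := k) D.e D.a 0 p c = 0 := by
  simp only [tmul_eq_smul_gen, ← envMk_apply, map_zero, LinearMap.zero_apply, zero_smul]

theorem tmul_zero_right {l : ℕ} (b : D.B) (p : QPath n d l) :
    P.tmul (k := k) D.e D.a b p 0 = 0 := by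
  simp only [tmul_eq_smul_gen, ← envMk_apply, map_zero, zero_smul]

/-- The grading of `P_l`. -/
noncomputable abbrev grP (l : ℕ) : ℤ → Submodule k (D.PP l) := P.grading D.gradingB D.e D.a l

theorem tmul_mem_grP {l : ℕ} {i j m : ℤ} {b c : D.B} (p : QPath n d l) (hb : b ∈ D.gradingB i)
    (hc : c ∈ D.gradingB j) (h : i + p.deg D.a + j = m) :
    P.tmul D.e D.a b p c ∈ D.grP l m :=
  Submodule.subset_span ⟨i, j, p, h, b, hb, c, hc, rfl⟩

theorem smul_mem_grP {l : ℕ} {i m j : ℤ} {b c : D.B} (hb : b ∈ D.gradingB i) {x : D.PP l}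
    (hx : x ∈ D.grP l m) (hc : c ∈ D.gradingB j) : envTmul k b c • x ∈ D.grP l (i + m + j) := by
  induction hx using Submodule.span_induction with
  | zero => rw [smul_zero]; exact Submodule.zero_mem _
  | add x y _ _ hx hy => rw [smul_add]; exact Submodule.add_mem _ hx hy
  | smul r x _ hx => rw [smul_comm]; exact Submodule.smul_mem _ _ hx
  | mem x hx =>
    obtain ⟨i', j', p, h, b', hb', c', hc', rfl⟩ := hx
    rw [tmul_eq_smul_gen, smul_smul, envTmul_mul, ← tmul_eq_smul_gen]
    exact D.tmul_mem_grP p (D.mul_mem_gradingB hb hb') (D.mul_mem_gradingB hc' hc)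
      (by rw [← h]; ring)

section

variable [NeZero n]

/-! ### Finiteness and projectivity -/

theorem finite_PP (l : ℕ) : Module.Finite (Env k D.B) (D.PP l) := by
  refine ⟨Submodule.fg_def.2 ⟨Set.range (D.wgen (l := l)), Set.finite_range _, ?_⟩⟩
  rw [eq_top_iff]
  intro y _
  induction y using D.PP_induction with
  | hadd x y hx hy => exact Submodule.add_mem _ (hx trivial) (hy trivial)
  | hgen X w => exact Submodule.smul_mem _ _ (Submodule.subset_span ⟨w, rfl⟩)

/-- The quotient map from `B^e ⊗ U_l`, which is free because `U_l` is a vector space, is split by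
inserting the idempotents `e_{tgt} ⊗ e_{src}` of each path. -/
theorem projective_PP (l : ℕ) : Module.Projective (Env k D.B) (D.PP l) := by
  let m : (Fin l → Fin d) → Env k D.B ⊗[k] U k n d l := fun w =>
    ∑ s, envTmul k (D.e (s + D.wsum w)) (D.e s) ⊗ₜ wedge k ⟨s, w⟩
  have hm : IsAltFamily m := by
    intro c r h
    have hw : D.wsum (c ∘ Equiv.swap ⟨r, Nat.lt_of_succ_lt h⟩ ⟨r + 1, h⟩) = D.wsum c :=
      D.wsum_comp_perm c _
    simp only [m, hw]
    rw [← Finset.sum_add_distrib]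
    refine Finset.sum_eq_zero fun s _ => ?_
    have h1 : (wedgeRel k n d l).mkQ (Finsupp.single ⟨s, c⟩ 1 + Finsupp.single
        ⟨s, c ∘ Equiv.swap ⟨r, Nat.lt_of_succ_lt h⟩ ⟨r + 1, h⟩⟩ 1) = 0 :=
      (Submodule.Quotient.mk_eq_zero _).2 (Submodule.subset_span ⟨s, c, r, h, rfl⟩)
    rw [← TensorProduct.tmul_add, wedge, wedge, ← map_add, h1, TensorProduct.tmul_zero]
  have hm' : ∀ s w, envTmul k (D.e (s + D.wsum w)) 1 • m w = envTmul k 1 (D.e s) • m w := by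
    intro s w
    simp only [m, Finset.smul_sum, TensorProduct.smul_tmul', smul_eq_mul, envTmul_mul, one_mul,
      mul_one, e_mul_e]
    refine Finset.sum_congr rfl fun t _ => ?_
    by_cases h : t = s
    · rw [h, if_pos rfl, if_pos rfl]
    · rw [if_neg h, if_neg fun h' => h (add_right_cancel h').symm, ← envMk_apply, ← envMk_apply,
        map_zero, map_zero, LinearMap.zero_apply]
  refine Module.Projective.of_split (D.envLift m hm hm') (tensorRel (k := k) D.e D.a l).mkQ
    (D.PP_linearMap_ext fun w => ?_)
  rw [LinearMap.comp_apply, envLift_wgen, LinearMap.id_apply]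
  simp only [m]
  rw [map_sum, wgen]
  refine Finset.sum_congr rfl fun s _ => ?_
  rw [mkQ_tmul_wedge, show envTmul k (D.e (s + D.wsum w)) (D.e s) =
    envTmul k (D.e (s + D.wsum w)) 1 * envTmul k 1 (D.e s) by rw [envTmul_mul, mul_one, mul_one],
    mul_smul, env_right_smul_gen, if_pos rfl, env_left_smul_gen]
  exact if_pos rfl

/-- A word of more than `d` letters repeats one, so its wedge vanishes. -/
theorem subsingleton_PP [CharZero k] {l : ℕ} (hl : d < l) : Subsingleton (D.PP l) := by
  refine ⟨fun x y => ?_⟩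
  have h : ∀ y : D.PP l, y = 0 := by
    intro y
    induction y using D.PP_induction with
    | hadd x y hx hy => rw [hx, hy, add_zero]
    | hgen X w =>
      rw [D.isAltFamily_wgen.eq_zero (k := k), smul_zero]
      intro hw
      have := Fintype.card_le_of_injective w hw
      simp at this
      omega
  rw [h x, h y]

/-! ### The grading of `P_l` -/

/-- The formula for single arrows telescopes along the path. Consequently the degree depends only on
the source and the multiset of letters, which makes it well defined on wedges. -/
theorem deg_spec {l : ℕ} (p : QPath n d l) :
    n * p.deg D.a = p.src.val + ∑ r, (D.a (p.word r) : ℤ) - (p.tgt D.a).val := by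
  obtain ⟨s, w⟩ := p
  induction l generalizing s with
  | zero => simp [QPath.deg, QPath.tgt]
  | succ l ih =>
    have h1 := ih s (fun r => w r.succ)
    have h2 : QPath.deg D.a ⟨s, w⟩ =
        arrowDeg D.a (s + ∑ r : Fin l, (D.a (w r.succ) : ZMod n)) (w 0) +
          QPath.deg D.a ⟨s, fun r => w r.succ⟩ := by
      simp only [QPath.deg, Finset.sum_filter]
      rw [Fin.sum_univ_succ]
      congr 1
      · congr 2
        rw [Fin.sum_univ_succ]
        simp
      · refine Finset.sum_congr rfl fun r _ => ?_
        congr 2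
        rw [Fin.sum_univ_succ]
        simp
    rw [h2, mul_add, h1, arrowDeg_spec]
    have h3 : QPath.tgt D.a (⟨s, w⟩ : QPath n d (l + 1)) =
        s + ∑ r : Fin l, (D.a (w r.succ) : ZMod n) + D.a (w 0) := by
      rw [QPath.tgt, Fin.sum_univ_succ]; ring
    rw [h3, Fin.sum_univ_succ, QPath.tgt]
    ring

theorem eq_of_n_mul_eq {x y : ℤ} (h : n * x = n * y) : x = y :=
  mul_left_cancel₀ (by exact_mod_cast NeZero.ne n) h

theorem deg_comp_perm {l : ℕ} (s : ZMod n) (w : Fin l → Fin d) (σ : Equiv.Perm (Fin l)) :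
    QPath.deg D.a ⟨s, w ∘ σ⟩ = QPath.deg D.a (⟨s, w⟩ : QPath n d l) := by
  refine eq_of_n_mul_eq (n := n) ?_
  rw [deg_spec, deg_spec]
  have h1 : ∑ r, (D.a ((w ∘ σ) r) : ℤ) = ∑ r, (D.a (w r) : ℤ) :=
    Equiv.sum_comp σ fun r => (D.a (w r) : ℤ)
  have h2 : QPath.tgt D.a (⟨s, w ∘ σ⟩ : QPath n d l) = QPath.tgt D.a ⟨s, w⟩ :=
    congrArg (s + ·) (D.wsum_comp_perm w σ)
  rw [h2]
  dsimp only
  rw [h1]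

theorem deg_eq_omit_left {l : ℕ} (s : ZMod n) (w : Fin (l + 1) → Fin d) (i : Fin (l + 1)) :
    QPath.deg D.a (⟨s, w⟩ : QPath n d (l + 1)) =
      arrowDeg D.a (s + D.wsum (w ∘ i.succAbove)) (w i) +
        QPath.deg D.a (⟨s, w ∘ i.succAbove⟩ : QPath n d l) := by
  refine eq_of_n_mul_eq (n := n) ?_
  rw [mul_add, deg_spec, deg_spec, arrowDeg_spec, tgt_eq, tgt_eq, ← D.wsum_succAbove w i,
    Fin.sum_univ_succAbove _ i, add_assoc s]
  simp only [Function.comp_apply]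
  ring

theorem deg_eq_omit_right {l : ℕ} (s : ZMod n) (w : Fin (l + 1) → Fin d) (i : Fin (l + 1)) :
    QPath.deg D.a (⟨s, w⟩ : QPath n d (l + 1)) =
      QPath.deg D.a (⟨s + D.a (w i), w ∘ i.succAbove⟩ : QPath n d l) + arrowDeg D.a s (w i) := by
  refine eq_of_n_mul_eq (n := n) ?_
  rw [mul_add, deg_spec, deg_spec, arrowDeg_spec, tgt_eq, tgt_eq, ← D.wsum_succAbove w i,
    Fin.sum_univ_succAbove _ i, add_assoc s, add_comm (D.wsum _)]
  simp only [Function.comp_apply]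
  ring

/-- The degree of the element `x^u (x_{w 0} ∧ ⋯) x^v e_t` of `P_l`. -/
noncomputable def tDeg {l : ℕ} (t : ZMod n) (w : Fin l → Fin d) (u v : Fin d →₀ ℕ) : ℤ :=
  D.monDeg (t + D.wt v + D.wsum w) u + QPath.deg D.a (⟨t + D.wt v, w⟩ : QPath n d l) + D.monDeg t v

/-- A product of basis elements is nonzero only if the three paths compose. This identifies the
images under `T t w` of tensors of monomials as homogeneous elements of degree `tDeg`. -/
theorem tmul_mon {l : ℕ} (i t s : ZMod n) (w : Fin l → Fin d) (u v : Fin d →₀ ℕ) :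
    P.tmul D.e D.a (D.mon i u) ⟨s, w⟩ (D.mon t v) =
      if i = s + D.wsum w ∧ s = t + D.wt v then
        D.T t w (monomial u 1 ⊗ₜ monomial v 1) else 0 := by
  rw [tmul_eq_sum_T, Finset.sum_eq_single t]
  · rw [comp_mon, comp_mon, if_pos rfl, projLin_monomial]
    have h1 : (D.wt v : ZMod n) = s - t ↔ s = t + D.wt v := by
      rw [eq_sub_iff_add_eq, add_comm, eq_comm]
    simp only [h1]
    by_cases h2 : s + D.wsum w = i
    · rw [if_pos h2]
      by_cases h3 : s = t + D.wt v
      · rw [if_pos h3, if_pos ⟨h2.symm, h3⟩]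
      · rw [if_neg h3, if_neg (fun h => h3 h.2), TensorProduct.tmul_zero, map_zero]
    · rw [if_neg h2, TensorProduct.zero_tmul, map_zero]
      exact (if_neg fun h => h2 h.1.symm).symm
  · intro t' _ ht'
    rw [comp_mon, comp_mon, if_neg ht', map_zero, TensorProduct.tmul_zero, map_zero]
  · simp

/-- The basis of `S ⊗ S` consisting of tensors of monomials. -/
noncomputable def tensorBasis (k : Type u) [Field k] (d : ℕ) :
    Module.Basis ((Fin d →₀ ℕ) × (Fin d →₀ ℕ)) k
      (MvPolynomial (Fin d) k ⊗[k] MvPolynomial (Fin d) k) :=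
  (basisMonomials (Fin d) k).tensorProduct (basisMonomials (Fin d) k)

theorem tensorBasis_apply (u v : Fin d →₀ ℕ) :
    tensorBasis k d (u, v) = monomial u 1 ⊗ₜ monomial v 1 := by
  rw [tensorBasis, Module.Basis.tensorProduct_apply, coe_basisMonomials]

/-- The map on `S ⊗ S` that describes the homogeneous projection of `P_l`. -/
noncomputable def projT {l : ℕ} (m : ℤ) (t : ZMod n) (w : Fin l → Fin d) :
    MvPolynomial (Fin d) k ⊗[k] MvPolynomial (Fin d) k →ₗ[k] D.PP l :=
  (tensorBasis k d).constr k fun x =>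
    if D.tDeg t w x.1 x.2 = m then D.T t w (tensorBasis k d x) else 0

theorem projT_monomial {l : ℕ} (m : ℤ) (t : ZMod n) (w : Fin l → Fin d) (u v : Fin d →₀ ℕ) :
    D.projT m t w (monomial u 1 ⊗ₜ monomial v 1) =
      if D.tDeg t w u v = m then D.T t w (monomial u 1 ⊗ₜ monomial v 1) else 0 := by
  rw [← tensorBasis_apply, projT, Module.Basis.constr_basis]

/-- The degree does not change under permutation of the letters, so selecting by degree is
compatible with the wedge relations. -/
theorem isAltFamily_projT {l : ℕ} (m : ℤ) (t : ZMod n) :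
    IsAltFamily (D.projT (l := l) m t) := by
  intro c r h
  refine (tensorBasis k d).ext fun x => ?_
  have h1 : D.tDeg t (c ∘ Equiv.swap ⟨r, Nat.lt_of_succ_lt h⟩ ⟨r + 1, h⟩) x.1 x.2 =
      D.tDeg t c x.1 x.2 := by
    rw [tDeg, tDeg, deg_comp_perm, wsum_comp_perm]
  rw [LinearMap.add_apply, projT, projT, Module.Basis.constr_basis, Module.Basis.constr_basis, h1,
    LinearMap.zero_apply]
  split_ifs
  · exact D.isAltFamily_T t _ c r h
  · exact add_zero 0

/-- The homogeneous projection of `P_l` onto its part of degree `m`. -/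
noncomputable def projP (l : ℕ) (m : ℤ) : D.PP l →ₗ[k] D.PP l :=
  D.kLift (D.projT m) (D.isAltFamily_projT m)

theorem projP_T {l : ℕ} (m : ℤ) (t : ZMod n) (w : Fin l → Fin d) (u v : Fin d →₀ ℕ) :
    D.projP l m (D.T t w (monomial u 1 ⊗ₜ monomial v 1)) =
      if D.tDeg t w u v = m then D.T t w (monomial u 1 ⊗ₜ monomial v 1) else 0 := by
  rw [← projT_monomial]
  exact D.kLift_T _ _ t w _

theorem projP_tmul {l : ℕ} (m : ℤ) {i j : ℤ} {b c : D.B} (p : QPath n d l)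
    (hb : b ∈ D.gradingB i) (hc : c ∈ D.gradingB j) :
    D.projP l m (P.tmul D.e D.a b p c) =
      if i + p.deg D.a + j = m then P.tmul D.e D.a b p c else 0 := by
  obtain ⟨s, w⟩ := p
  refine D.gradingB_induction (p := fun b => D.projP l m (P.tmul D.e D.a b ⟨s, w⟩ c) =
    if i + QPath.deg D.a ⟨s, w⟩ + j = m then P.tmul D.e D.a b ⟨s, w⟩ c else 0) ?_ ?_ ?_ ?_ hb
  · rw [tmul_zero_left, map_zero, ite_self]
  · intro b b' hb hb'
    rw [tmul_add_left, map_add, hb, hb']; split_ifs <;> simp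
  · intro r b hb
    rw [tmul_smul_left, map_smul, hb]; split_ifs <;> simp
  intro i' u hi
  refine D.gradingB_induction (p := fun c => D.projP l m (P.tmul D.e D.a (D.mon i' u) ⟨s, w⟩ c) =
    if i + QPath.deg D.a ⟨s, w⟩ + j = m then P.tmul D.e D.a (D.mon i' u) ⟨s, w⟩ c else 0)
    ?_ ?_ ?_ ?_ hc
  · rw [tmul_zero_right, map_zero, ite_self]
  · intro b b' hb hb'
    rw [tmul_add_right, map_add, hb, hb']; split_ifs <;> simp
  · intro r b hb
    rw [tmul_smul_right, map_smul, hb]; split_ifs <;> simp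
  intro t v hj
  rw [tmul_mon]
  by_cases h1 : i' = s + D.wsum w ∧ s = t + D.wt v
  · rw [if_pos h1, projP_T, tDeg, ← h1.2, ← h1.1, hi, hj]
  · rw [if_neg h1, map_zero, ite_self]

theorem projP_of_mem {l : ℕ} (m m' : ℤ) (x : D.PP l) (hx : x ∈ D.grP l m) :
    D.projP l m' x = if m = m' then x else 0 := by
  induction hx using Submodule.span_induction with
  | zero => rw [map_zero, ite_self]
  | add x y _ _ hx hy => rw [map_add, hx, hy]; split_ifs <;> simp
  | smul c x _ hx => rw [map_smul, hx]; split_ifs <;> simp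
  | mem x hx =>
    obtain ⟨i, j, p, h, b, hb, c, hc, rfl⟩ := hx
    rw [D.projP_tmul m' p hb hc, h]

theorem iSup_grP (l : ℕ) : ⨆ m, D.grP l m = ⊤ := by
  refine (Submodule.eq_top_iff').2 fun y => ?_
  induction y using D.PP_T_induction with
  | hadd x y hx hy => exact Submodule.add_mem _ hx hy
  | hT t w F =>
    have hF : F ∈ Submodule.span k (Set.range (tensorBasis k d)) := by
      rw [Module.Basis.span_eq]; trivial
    induction hF using Submodule.span_induction with
    | zero => rw [map_zero]; exact Submodule.zero_mem _
    | add x y _ _ hx hy => rw [map_add]; exact Submodule.add_mem _ hx hy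
    | smul c x _ hx => rw [map_smul]; exact Submodule.smul_mem _ _ hx
    | mem x hx =>
      obtain ⟨⟨u, v⟩, rfl⟩ := hx
      have h := D.tmul_mon (t + D.wt v + D.wsum w) t (t + D.wt v) w u v
      rw [if_pos ⟨rfl, rfl⟩] at h
      rw [tensorBasis_apply, ← h]
      exact Submodule.mem_iSup_of_mem _ (D.tmul_mem_grP _ (D.mon_mem _ _) (D.mon_mem _ _) rfl)

theorem isInternal_grP (l : ℕ) : DirectSum.IsInternal (D.grP l) :=
  isInternal_of_proj (D.projP l) D.projP_of_mem (D.iSup_grP l)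

theorem diff_mem_grP {l : ℕ} {m : ℤ} {x : D.PP (l + 1)} (hx : x ∈ D.grP (l + 1) m) :
    D.diff l x ∈ D.grP l m := by
  induction hx using Submodule.span_induction with
  | zero => rw [map_zero]; exact Submodule.zero_mem _
  | add x y _ _ hx hy => rw [map_add]; exact Submodule.add_mem _ hx hy
  | smul r x _ hx => rw [LinearMap.map_smul_of_tower]; exact Submodule.smul_mem _ _ hx
  | mem x hx =>
    obtain ⟨i, j, p, h, b, hb, c, hc, rfl⟩ := hx
    obtain ⟨s, w⟩ := p
    rw [D.isKoszulDifferential_diff]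
    refine Submodule.sum_mem _ fun r _ => zsmul_mem (Submodule.sub_mem _ ?_ ?_) _
    · refine D.tmul_mem_grP _ (D.mul_mem_gradingB hb (D.arrow_mem _ _)) hc ?_
      have h1 := D.deg_eq_omit_left s w r
      rw [wsum] at h1
      simp only [Function.comp_apply] at h1
      rw [h1] at h
      rw [← h]
      ring
    · refine D.tmul_mem_grP _ hb (D.mul_mem_gradingB (D.arrow_mem _ _) hc) ?_
      rw [← h, D.deg_eq_omit_right s w r]
      ring

theorem aug_mem_gradingB {m : ℤ} {x : D.PP 0} (hx : x ∈ D.grP 0 m) : D.aug x ∈ D.gradingB m := by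
  induction hx using Submodule.span_induction with
  | zero => rw [map_zero]; exact Submodule.zero_mem _
  | add x y _ _ hx hy => rw [map_add]; exact Submodule.add_mem _ hx hy
  | smul r x _ hx => rw [map_smul]; exact Submodule.smul_mem _ _ hx
  | mem x hx =>
    obtain ⟨i, j, p, h, b, hb, c, hc, rfl⟩ := hx
    rw [aug_tmul, ← h, show p.deg D.a = 0 by simp [QPath.deg]]
    exact D.mul_mem_gradingB (D.mul_mem_gradingB hb (D.e_mem _)) hc

theorem isGradedProjectiveResolution [CharZero k] :
    IsGradedProjectiveResolution (X := P k D.e D.a) D.gradingB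
      (P.grading D.gradingB D.e D.a) D.diff D.aug where
  internal := D.isInternal_grP
  smul_mem := fun _ _ _ _ _ hb _ hx _ hc => D.smul_mem_grP hb hx hc
  finite := D.finite_PP
  projective := D.projective_PP
  bounded := ⟨d, fun _ hl => D.subsingleton_PP hl⟩
  δ_mem := fun _ _ _ hx => D.diff_mem_grP hx
  ε_mem := fun _ _ hx => D.aug_mem_gradingB hx
  ε_smul := D.aug_smul
  ε_surjective := D.aug_surjective
  exact_zero := D.exact_aug
  exact_succ := D.exact_diff

end

end CyclicDatum

/-! ### The orientation of words -/

section Orientation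

variable {d : ℕ}

/-- The determinant of the word `c`: the sign of `c` if it is a permutation of all letters, and `0`
otherwise. -/
def wordDet {m : ℕ} (h : m = d) (c : Fin m → Fin d) : ℤ :=
  ((1 : Matrix (Fin d) (Fin d) ℤ).submatrix c (Fin.cast h)).det

theorem wordDet_comp_perm {m : ℕ} (h : m = d) (c : Fin m → Fin d) (σ : Equiv.Perm (Fin m)) :
    wordDet h (c ∘ σ) = Equiv.Perm.sign σ * wordDet h c :=
  Matrix.det_permute σ ((1 : Matrix (Fin d) (Fin d) ℤ).submatrix c (Fin.cast h))

theorem wordDet_eq_zero {m : ℕ} (h : m = d) {c : Fin m → Fin d} (hc : ¬ Function.Injective c) :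
    wordDet h c = 0 := by
  simp only [Function.Injective, not_forall] at hc
  obtain ⟨i, j, hcij, hij⟩ := hc
  refine Matrix.det_zero_of_row_eq hij ?_
  funext x
  rw [Matrix.submatrix_apply, Matrix.submatrix_apply, hcij]

theorem wordDet_mul_self {m : ℕ} (h : m = d) {c : Fin m → Fin d} (hc : Function.Injective c) :
    wordDet h c * wordDet h c = 1 := by
  subst h
  have hb : Function.Bijective c := Finite.injective_iff_bijective.1 hc
  have h1 : wordDet rfl c = (Equiv.Perm.sign (Equiv.ofBijective c hb) : ℤ) := by
    have h2 := wordDet_comp_perm rfl (id : Fin m → Fin m) (Equiv.ofBijective c hb)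
    have h3 : wordDet rfl (id : Fin m → Fin m) = 1 := Matrix.det_one
    rw [h3, mul_one] at h2
    exact h2
  rw [h1]
  rcases Int.units_eq_one_or (Equiv.Perm.sign (Equiv.ofBijective c hb)) with h | h <;> simp [h]

theorem wordDet_comp_cast {m m' : ℕ} (e : m = m') (h : m = d) (h' : m' = d) (c : Fin m' → Fin d) :
    wordDet h (c ∘ Fin.cast e) = wordDet h' c := by
  subst e
  rfl

/-- For `d + 1` letters in `d` variables, the coefficient of each `V j` is the expansion along the
first column of a determinant with two equal columns. -/
theorem sum_wordDet_succAbove {N : Type*} [AddCommGroup N] {m : ℕ} (h : m = d)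
    (W : Fin (m + 1) → Fin d) (V : Fin d → N) :
    ∑ r : Fin (m + 1), ((-1 : ℤ) ^ (r : ℕ) * wordDet h (W ∘ r.succAbove)) • V (W r) = 0 := by
  have key : ∀ j : Fin d, ∑ r : Fin (m + 1),
      (-1 : ℤ) ^ (r : ℕ) * (if W r = j then 1 else 0) * wordDet h (W ∘ r.succAbove) = 0 := by
    intro j
    -- Row `r` is the indicator vector of the letter `W r`, preceded by a second copy of its entry
    -- `j`.
    let A : Matrix (Fin (m + 1)) (Fin (m + 1)) ℤ := fun r c =>
      Fin.cases (if W r = j then 1 else 0)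
        (fun c => (1 : Matrix (Fin d) (Fin d) ℤ) (W r) (Fin.cast h c)) c
    have hA : A.det = 0 := by
      refine Matrix.det_zero_of_column_eq (i := 0) (j := Fin.succ (Fin.cast h.symm j))
        (Fin.succ_ne_zero _).symm fun r => ?_
      simp [A, Matrix.one_apply]
    refine Eq.trans ?_ hA
    rw [Matrix.det_succ_column_zero]
    rfl
  have h1 : ∀ r : Fin (m + 1), ((-1 : ℤ) ^ (r : ℕ) * wordDet h (W ∘ r.succAbove)) • V (W r) =
      ∑ j, ((-1 : ℤ) ^ (r : ℕ) * (if W r = j then 1 else 0) * wordDet h (W ∘ r.succAbove)) •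
        V j := by
    intro r
    rw [Finset.sum_eq_single (W r)]
    · rw [if_pos rfl, mul_one]
    · intro j _ hj
      rw [if_neg (Ne.symm hj), mul_zero, zero_mul, zero_smul]
    · simp
  rw [Finset.sum_congr rfl fun r _ => h1 r, Finset.sum_comm]
  refine Finset.sum_eq_zero fun j _ => ?_
  rw [← Finset.sum_smul, key, zero_smul]

variable {p q : ℕ}

/-- The determinant of the concatenation of two words. -/
def orient (h : p + q = d) (w : Fin p → Fin d) (w' : Fin q → Fin d) : ℤ :=
  wordDet h (Fin.append w w')

theorem isAltFamily_orient_left (h : p + q = d) (w' : Fin q → Fin d) :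
    IsAltFamily fun w : Fin p → Fin d => orient h w w' := by
  intro c r hr
  have h1 : Fin.append (c ∘ Equiv.swap ⟨r, Nat.lt_of_succ_lt hr⟩ ⟨r + 1, hr⟩) w' =
      Fin.append c w' ∘ Equiv.swap (Fin.castAdd q ⟨r, Nat.lt_of_succ_lt hr⟩)
        (Fin.castAdd q ⟨r + 1, hr⟩) := by
    funext x
    refine Fin.addCases (fun x => ?_) (fun x => ?_) x
    · rw [Function.comp_apply, (Fin.castAdd_injective p q).swap_apply, Fin.append_left,
        Fin.append_left, Function.comp_apply]
    · rw [Function.comp_apply, Equiv.swap_apply_of_ne_of_ne, Fin.append_right, Fin.append_right]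
      · simp [Fin.ext_iff]; omega
      · simp [Fin.ext_iff]; omega
  dsimp only
  rw [orient, orient, h1, wordDet_comp_perm, Equiv.Perm.sign_swap (by simp [Fin.ext_iff])]
  simp

theorem isAltFamily_orient_right (h : p + q = d) (w : Fin p → Fin d) :
    IsAltFamily fun w' : Fin q → Fin d => orient h w w' := by
  intro c r hr
  have h1 : Fin.append w (c ∘ Equiv.swap ⟨r, Nat.lt_of_succ_lt hr⟩ ⟨r + 1, hr⟩) =
      Fin.append w c ∘ Equiv.swap (Fin.natAdd p ⟨r, Nat.lt_of_succ_lt hr⟩)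
        (Fin.natAdd p ⟨r + 1, hr⟩) := by
    funext x
    refine Fin.addCases (fun x => ?_) (fun x => ?_) x
    · rw [Function.comp_apply, Equiv.swap_apply_of_ne_of_ne, Fin.append_left, Fin.append_left]
      · simp [Fin.ext_iff]; omega
      · simp [Fin.ext_iff]; omega
    · rw [Function.comp_apply, (Fin.natAdd_injective q p).swap_apply, Fin.append_right,
        Fin.append_right, Function.comp_apply]
  dsimp only
  rw [orient, orient, h1, wordDet_comp_perm, Equiv.Perm.sign_swap (by simp [Fin.ext_iff])]
  simp

/-- The expansion for the concatenated word, separated according to the half that contains the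
omitted letter. The factor `(-1)^(p + 1)` appears because positions in the second half begin at `p +
1`. -/
theorem sum_orient_succAbove {N : Type*} [AddCommGroup N] (h : p + 1 + q = d)
    (h' : p + (q + 1) = d) (w : Fin (p + 1) → Fin d) (w' : Fin (q + 1) → Fin d) (V : Fin d → N) :
    ∑ i : Fin (p + 1), ((-1 : ℤ) ^ (i : ℕ) * orient h' (w ∘ i.succAbove) w') • V (w i) +
      (-1 : ℤ) ^ (p + 1) •
        ∑ i : Fin (q + 1), ((-1 : ℤ) ^ (i : ℕ) * orient h w (w' ∘ i.succAbove)) • V (w' i) = 0 := by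
  have h0 := sum_wordDet_succAbove h (Fin.append w w' : Fin (p + 1 + (q + 1)) → Fin d) V
  change ∑ r : Fin (p + 1 + (q + 1)), _ = _ at h0
  rw [Fin.sum_univ_add] at h0
  rw [← h0, Finset.smul_sum]
  congr 1
  · refine Finset.sum_congr rfl fun i _ => ?_
    have e : p + 1 + q = p + (q + 1) := by omega
    have h1 : (Fin.append w w' : Fin (p + 1 + (q + 1)) → Fin d) ∘
        Fin.succAbove (n := p + 1 + q) (Fin.castAdd (q + 1) i) =
        Fin.append (w ∘ i.succAbove) w' ∘ Fin.cast e := by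
      funext x
      obtain ⟨z, rfl⟩ : ∃ z : Fin (p + (q + 1)), x = Fin.cast e.symm z := ⟨Fin.cast e x, rfl⟩
      refine Fin.addCases (fun z => ?_) (fun z => ?_) z
      · have h2 : Fin.succAbove (n := p + 1 + q) (Fin.castAdd (q + 1) i)
            (Fin.cast e.symm (Fin.castAdd (q + 1) z)) = Fin.castAdd (q + 1) (i.succAbove z) := by
          simp only [Fin.ext_iff, Fin.succAbove, Fin.lt_def, Fin.val_castSucc, Fin.val_cast,
            Fin.val_castAdd]
          split_ifs <;> simp
        simp only [Function.comp_apply]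
        rw [h2, Fin.append_left, Fin.cast_cast, Fin.cast_eq_self, Fin.append_left]
        rfl
      · have h2 : Fin.succAbove (n := p + 1 + q) (Fin.castAdd (q + 1) i)
            (Fin.cast e.symm (Fin.natAdd p z)) = Fin.natAdd (p + 1) z := by
          have := i.2
          simp only [Fin.ext_iff, Fin.succAbove, Fin.lt_def, Fin.val_castSucc, Fin.val_cast,
            Fin.val_castAdd, Fin.val_natAdd]
          rw [if_neg (by omega)]
          simp
          omega
        simp only [Function.comp_apply]
        rw [h2, Fin.append_right, Fin.cast_cast, Fin.cast_eq_self, Fin.append_right]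
    have h3 := congrArg (wordDet h) h1
    rw [wordDet_comp_cast e h h'] at h3
    rw [Fin.append_left, orient, ← h3]
    rfl
  · refine Finset.sum_congr rfl fun i _ => ?_
    have h1 : (Fin.append w w' : Fin (p + 1 + (q + 1)) → Fin d) ∘
        Fin.succAbove (n := p + 1 + q) (Fin.natAdd (p + 1) i) =
        Fin.append w (w' ∘ i.succAbove) := by
      funext x
      refine Fin.addCases (fun z => ?_) (fun z => ?_) x
      · have h2 : Fin.succAbove (n := p + 1 + q) (Fin.natAdd (p + 1) i)
            (Fin.castAdd q z) = Fin.castAdd (q + 1) z := by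
          have := z.2
          simp only [Fin.ext_iff, Fin.succAbove, Fin.lt_def, Fin.val_castSucc,
            Fin.val_castAdd, Fin.val_natAdd]
          rw [if_pos (by omega)]
          simp
        simp only [Function.comp_apply]
        rw [h2, Fin.append_left, Fin.append_left]
      · have h2 : Fin.succAbove (n := p + 1 + q) (Fin.natAdd (p + 1) i)
            (Fin.natAdd (p + 1) z) = Fin.natAdd (p + 1) (i.succAbove z) := by
          simp only [Fin.ext_iff, Fin.succAbove, Fin.lt_def, Fin.val_castSucc, Fin.val_natAdd]
          split_ifs <;> first | omega | (simp <;> omega)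
        simp only [Function.comp_apply]
        rw [h2, Fin.append_right, Fin.append_right]
        rfl
    have h3 := congrArg (wordDet h) h1
    rw [Fin.append_right, orient, ← h3, smul_smul, ← mul_assoc, ← pow_add]
    rfl

theorem injective_append_of_orient_ne_zero {h : p + q = d} {w : Fin p → Fin d} {w' : Fin q → Fin d}
    (hne : orient h w w' ≠ 0) : Function.Injective (Fin.append w w') := by
  by_contra hc
  exact hne (wordDet_eq_zero h hc)

theorem bijective_append_of_orient_ne_zero {h : p + q = d} {w : Fin p → Fin d} {w' : Fin q → Fin d}
    (hne : orient h w w' ≠ 0) : Function.Bijective (Fin.append w w') :=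
  (Fintype.bijective_iff_injective_and_card _).2
    ⟨injective_append_of_orient_ne_zero hne, by simp [h]⟩

theorem sum_add_sum_of_orient_ne_zero {h : p + q = d} {w : Fin p → Fin d} {w' : Fin q → Fin d}
    (hne : orient h w w' ≠ 0) {N : Type*} [AddCommMonoid N] (f : Fin d → N) :
    ∑ i, f (w i) + ∑ i, f (w' i) = ∑ j, f j := by
  rw [← (bijective_append_of_orient_ne_zero hne).sum_comp f, Fin.sum_univ_add]
  simp only [Fin.append_left, Fin.append_right]

theorem range_eq_compl_of_orient_ne_zero {h : p + q = d} {w : Fin p → Fin d} {w' : Fin q → Fin d}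
    (hne : orient h w w' ≠ 0) : Set.range w' = (Set.range w)ᶜ := by
  have hb := bijective_append_of_orient_ne_zero hne
  ext x
  constructor
  · rintro ⟨i, rfl⟩ ⟨j, hj⟩
    have h1 : Fin.append w w' (Fin.castAdd q j) = Fin.append w w' (Fin.natAdd p i) := by
      rw [Fin.append_left, Fin.append_right, hj]
    have h2 := Fin.ext_iff.1 (hb.1 h1)
    have := j.2
    simp at h2
    omega
  · intro hx
    obtain ⟨y, rfl⟩ := hb.2 x
    revert hx
    refine Fin.addCases (fun z => ?_) (fun z => ?_) y
    · rw [Fin.append_left]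
      exact fun hx => absurd ⟨z, rfl⟩ hx
    · rw [Fin.append_right]
      exact fun _ => ⟨z, rfl⟩

theorem orient_mul_self {h : p + q = d} {w : Fin p → Fin d} {w' : Fin q → Fin d}
    (hw : Function.Injective w) (hw' : Function.Injective w')
    (hr : Set.range w' = (Set.range w)ᶜ) : orient h w w' * orient h w w' = 1 := by
  refine wordDet_mul_self h fun x y => ?_
  have hd : ∀ i j, w i ≠ w' j := by
    intro i j hij
    have h1 : w' j ∈ (Set.range w)ᶜ := hr ▸ ⟨j, rfl⟩
    exact h1 ⟨i, hij⟩
  refine Fin.addCases (fun x => ?_) (fun x => ?_) x <;>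
    refine Fin.addCases (fun y => ?_) (fun y => ?_) y <;>
    simp only [Fin.append_left, Fin.append_right] <;> intro hxy
  · rw [hw hxy]
  · exact absurd hxy (hd _ _)
  · exact absurd hxy.symm (hd _ _)
  · rw [hw' hxy]

theorem exists_strictMono_range_eq_compl (h : p + q = d) {w : Fin p → Fin d}
    (hw : Function.Injective w) :
    ∃ w' : Fin q → Fin d, StrictMono w' ∧ Set.range w' = (Set.range w)ᶜ := by
  classical
  have hc : (Finset.univ.image w)ᶜ.card = q := by
    rw [Finset.card_compl, Finset.card_image_of_injective _ hw]
    simp only [Fintype.card_fin, Finset.card_univ]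
    omega
  refine ⟨(Finset.univ.image w)ᶜ.orderEmbOfFin hc, OrderEmbedding.strictMono _, ?_⟩
  rw [Finset.range_orderEmbOfFin]
  simp

end Orientation

namespace CyclicDatum

open MvPolynomial McKay

universe u

variable {k : Type u} [Field k] {d n : ℕ} (D : CyclicDatum k d n)

section

variable [NeZero n]

/-! ### Independence of the grading of the enveloping algebra -/

/-- Each piece lies in the span of those tensors of basis elements that have the given total degree,
and these spans are independent. -/
theorem iSupIndep_envGrading : iSupIndep (envGrading D.gradingB) := by
  let b : Module.Basis _ k (Env k D.B) :=
    D.basisB.tensorProduct (D.basisB.map (MulOpposite.opLinearEquiv k))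
  have hb : ∀ x y, b (x, y) = envTmul k (D.basisB x) (D.basisB y) := fun x y =>
    Module.Basis.tensorProduct_apply _ _ _ _
  let deg : (Σ _ : ZMod n, Fin d →₀ ℕ) × (Σ _ : ZMod n, Fin d →₀ ℕ) → ℤ := fun x =>
    D.monDeg x.1.1 x.1.2 + D.monDeg x.2.1 x.2.2
  refine iSupIndep.mono (isInternal_span_basis b deg).submodule_iSupIndep fun m => ?_
  rw [envGrading, Submodule.span_le]
  rintro _ ⟨i, j, hij, x, hx, y, hy, rfl⟩
  rw [SetLike.mem_coe, ← envMk_apply]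
  refine D.gradingB_induction (p := fun x => envMk k D.B x y ∈
    Submodule.span k (b '' {i | deg i = m})) ?_ ?_ ?_ ?_ hx
  · rw [map_zero]; exact Submodule.zero_mem _
  · intro x x' h h'
    rw [map_add]; exact Submodule.add_mem _ h h'
  · intro c x h
    rw [map_smul]; exact Submodule.smul_mem _ _ h
  intro i' u hi
  refine D.gradingB_induction (p := fun y => envMk k D.B (D.mon i' u) y ∈
    Submodule.span k (b '' {i | deg i = m})) ?_ ?_ ?_ ?_ hy
  · rw [map_zero]; exact Submodule.zero_mem _
  · intro x x' h h'
    rw [map_add]; exact Submodule.add_mem _ h h'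
  · intro c x h
    rw [map_smul]; exact Submodule.smul_mem _ _ h
  intro j' v hj
  refine Submodule.subset_span ⟨(⟨i', u⟩, ⟨j', v⟩), ?_, ?_⟩
  · change D.monDeg i' u + D.monDeg j' v = m
    rw [hi, hj, hij]
  · rw [hb, basisB_apply, basisB_apply, envMk_apply]

/-! ### The pairing -/

/-- The element `∑ s, e_s ⊗ e_{s + c}` of the enveloping algebra. -/
noncomputable def Om (c : ZMod n) : Env k D.B := ∑ s, envTmul k (D.e s) (D.e (s + c))

theorem Om_mul (c : ZMod n) (b b' : D.B) :
    D.Om c * envTmul k b b' = ∑ s, envTmul k (D.e s * b) (b' * D.e (s + c)) := by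
  simp only [Om, Finset.sum_mul, envTmul_mul]

theorem mul_Om (c : ZMod n) (b b' : D.B) :
    envTmul k b b' * D.Om c = ∑ s, envTmul k (b * D.e s) (D.e (s + c) * b') := by
  simp only [Om, Finset.mul_sum, envTmul_mul]

theorem envFlip_Om (c : ZMod n) : envFlip (D.Om c) = D.Om (-c) := by
  rw [Om, map_sum, Om]
  refine Eq.trans ?_
    (Equiv.sum_comp (Equiv.addRight c) fun s => envTmul k (D.e s) (D.e (s + -c)))
  refine Finset.sum_congr rfl fun s _ => ?_
  simp only [envFlip_envTmul, Equiv.coe_addRight, add_neg_cancel_right]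

theorem env_left_e_mul_Om (s c : ZMod n) :
    envTmul k (D.e s) 1 * D.Om c = envTmul k (D.e s) (D.e (s + c)) := by
  rw [mul_Om, Finset.sum_eq_single s]
  · rw [e_mul_e, if_pos rfl, mul_one]
  · intro t _ ht
    rw [e_mul_e, if_neg (Ne.symm ht), ← envMk_apply, map_zero, LinearMap.zero_apply]
  · simp

theorem env_right_e_mul_Om (s c : ZMod n) :
    envTmul k 1 (D.e (s + c)) * D.Om c = envTmul k (D.e s) (D.e (s + c)) := by
  rw [mul_Om, Finset.sum_eq_single s]
  · rw [e_mul_e, if_pos rfl, one_mul]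
  · intro t _ ht
    rw [e_mul_e, if_neg fun h => ht (add_right_cancel h), ← envMk_apply, map_zero]
  · simp

theorem Om_mul_env_left_e (s c : ZMod n) :
    D.Om c * envTmul k (D.e s) 1 = envTmul k (D.e s) (D.e (s + c)) := by
  rw [Om_mul, Finset.sum_eq_single s]
  · rw [e_mul_e, if_pos rfl, one_mul]
  · intro t _ ht
    rw [e_mul_e, if_neg ht, ← envMk_apply, map_zero, LinearMap.zero_apply]
  · simp

theorem Om_mul_env_right_e (s c : ZMod n) :
    D.Om c * envTmul k 1 (D.e (s + c)) = envTmul k (D.e s) (D.e (s + c)) := by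
  rw [Om_mul, Finset.sum_eq_single s]
  · rw [e_mul_e, if_pos rfl, mul_one]
  · intro t _ ht
    rw [e_mul_e, if_neg fun h => ht (add_right_cancel h).symm, ← envMk_apply, map_zero]
  · simp

/-- `Om (-wsum w)` is the sum of all `e_{tgt} ⊗ e_{src}` over paths with word `w`, so it acts as the
identity on their sum. In the duality proofs this absorbs the idempotent produced by the pairing. -/
theorem Om_smul_wgen {l : ℕ} (w : Fin l → Fin d) : D.Om (-D.wsum w) • D.wgen w = D.wgen w := by
  have h : D.Om (-D.wsum w) = ∑ s, envTmul k 1 (D.e s) * envTmul k (D.e (s + D.wsum w)) 1 := by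
    rw [Om, ← Equiv.sum_comp (Equiv.addRight (D.wsum w))]
    refine Finset.sum_congr rfl fun s _ => ?_
    rw [envTmul_mul, one_mul, one_mul, Equiv.coe_addRight, add_neg_cancel_right]
  rw [h, Finset.sum_smul]
  simp only [mul_smul, env_left_smul_wgen]
  simp only [smul_smul, envTmul_mul, e_mul_e, if_true, mul_one]
  rw [← Finset.sum_smul]
  simp only [← envMk_apply]
  rw [← map_sum, sum_e, envMk_apply, envTmul_one, one_smul]

omit [NeZero n] in
theorem envFlip_Z (j : Fin d) : envFlip (D.Z j) = - D.Z j := by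
  rw [Z, map_sub, envFlip_envTmul, envFlip_envTmul, neg_sub]

theorem Om_mul_Z (c : ZMod n) (j : Fin d) : D.Om c * D.Z j = D.Z j * D.Om (D.a j + c) := by
  rw [Z, mul_sub, sub_mul, Om_mul, Om_mul, mul_Om, mul_Om]
  congr 1
  · rw [← Equiv.sum_comp (Equiv.addRight (D.a j : ZMod n))]
    refine Finset.sum_congr rfl fun s _ => ?_
    rw [Equiv.coe_addRight, ← mulL_X_mul_e, one_mul, mul_one, add_assoc]
  · refine Finset.sum_congr rfl fun s _ => ?_
    rw [mulL_X_mul_e, one_mul, mul_one, add_assoc, add_comm c]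

theorem envFlip_Z_mul_Om (j : Fin d) (c : ZMod n) :
    envFlip (D.Z j * D.Om c) = - (D.Z j * D.Om (D.a j - c)) := by
  rw [envFlip_mul, envFlip_Om, envFlip_Z, mul_neg, Om_mul_Z, sub_eq_add_neg]

/-- The signs in the duality isomorphism. -/
def dualSign (d p : ℕ) : ℤ := (-1) ^ ∑ m ∈ Finset.range p, (m + 1 + d)

omit [NeZero n] in
-- This recursion is forced by the differentials: `(-1)^(p + 1)` comes from `sum_orient_succAbove`
-- and `(-1)^d` from the shift of the dual complex.
theorem dualSign_succ (p : ℕ) : dualSign d (p + 1) = dualSign d p * (-1) ^ (p + 1 + d) := by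
  rw [dualSign, dualSign, Finset.sum_range_succ, pow_add]

omit [NeZero n] in
theorem dualSign_mul_self (p : ℕ) : dualSign d p * dualSign d p = 1 := by
  rw [dualSign, ← pow_add, Even.neg_one_pow]
  use ∑ m ∈ Finset.range p, (m + 1 + d)

section Pairing

variable {p q : ℕ} (h : p + q = d)

omit [NeZero n] in
theorem wsum_add_wsum {w : Fin p → Fin d} {w' : Fin q → Fin d} (hne : orient h w w' ≠ 0) :
    D.wsum w + D.wsum w' = 0 := by
  rw [wsum, wsum, sum_add_sum_of_orient_ne_zero hne fun j => (D.a j : ZMod n), sum_a_cast]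

/-- The coefficient at the complement of the word `w'`. -/
noncomputable def coeffMap (w' : Fin q → Fin d) : D.PP p →ₗ[Env k D.B] Env k D.B :=
  D.envLift (fun w => (dualSign d p * orient h w w') • D.Om (D.wsum w'))
    (fun c r hr => by
      dsimp only
      rw [← add_smul, ← mul_add, isAltFamily_orient_left h w' c r hr, mul_zero, zero_smul])
    (fun s w => by
      by_cases hne : orient h w w' = 0
      · rw [hne, mul_zero, zero_smul, smul_zero, smul_zero]
      · have h1 := D.wsum_add_wsum h hne
        rw [smul_comm, smul_comm (envTmul k 1 (D.e s)), smul_eq_mul, smul_eq_mul,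
          env_left_e_mul_Om, add_assoc, h1, add_zero]
        have h2 := D.env_right_e_mul_Om (s + D.wsum w) (D.wsum w')
        rw [add_assoc, h1, add_zero] at h2
        rw [h2])

theorem coeffMap_wgen (w' : Fin q → Fin d) (w : Fin p → Fin d) :
    D.coeffMap h w' (D.wgen w) = (dualSign d p * orient h w w') • D.Om (D.wsum w') :=
  D.envLift_wgen _ _ _ w

theorem isAltFamily_coeffMap (x : D.PP p) :
    IsAltFamily fun w' : Fin q → Fin d => envFlip (D.coeffMap h w' x) := by
  intro c r hr
  dsimp only
  have hw : D.wsum (c ∘ Equiv.swap ⟨r, Nat.lt_of_succ_lt hr⟩ ⟨r + 1, hr⟩) = D.wsum c :=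
    D.wsum_comp_perm c _
  rw [← map_add]
  have key : D.coeffMap h c x +
      D.coeffMap h (c ∘ Equiv.swap ⟨r, Nat.lt_of_succ_lt hr⟩ ⟨r + 1, hr⟩) x = 0 := by
    induction x using D.PP_induction with
    | hadd x y hx hy =>
      rw [map_add, map_add, add_add_add_comm, hx, hy, add_zero]
    | hgen X w =>
      rw [map_smul, map_smul, ← smul_add, coeffMap_wgen, coeffMap_wgen, hw, ← add_smul, ← mul_add,
        isAltFamily_orient_right h w c r hr, mul_zero, zero_smul, smul_zero]
  rw [key, map_zero]

/-- After the flip this is the end point condition that lets the values at the words `w'` extend to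
a bimodule map on `P_q`. -/
theorem coeffMap_mul_env_e (w' : Fin q → Fin d) (x : D.PP p) (s : ZMod n) :
    D.coeffMap h w' x * envTmul k 1 (D.e (s + D.wsum w')) =
      D.coeffMap h w' x * envTmul k (D.e s) 1 := by
  induction x using D.PP_induction with
  | hadd x y hx hy => rw [map_add, add_mul, hx, hy, add_mul]
  | hgen X w =>
    rw [map_smul, coeffMap_wgen, smul_eq_mul, mul_assoc, mul_assoc, smul_mul_assoc, smul_mul_assoc,
      Om_mul_env_right_e, Om_mul_env_left_e]

/-- The duality map `P_p → (P_q)^∨` as a function. -/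
noncomputable def dualFun (x : D.PP p) : D.PP q →ₗ[Env k D.B] Env k D.B :=
  D.envLift (fun w' => envFlip (D.coeffMap h w' x)) (D.isAltFamily_coeffMap h x) (fun s w' => by
    have h1 := congrArg envFlip (D.coeffMap_mul_env_e h w' x s)
    rw [envFlip_mul, envFlip_mul, envFlip_envTmul, envFlip_envTmul] at h1
    exact h1)

theorem dualFun_wgen (x : D.PP p) (w' : Fin q → Fin d) :
    D.dualFun h x (D.wgen w') = envFlip (D.coeffMap h w' x) :=
  D.envLift_wgen _ _ _ w'

/-- The duality map `P_p → (P_q)^∨`. -/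
noncomputable def dualHom : D.PP p →+ (D.PP q →ₗ[Env k D.B] Env k D.B) where
  toFun := D.dualFun h
  map_zero' := D.PP_linearMap_ext fun w' => by
    rw [dualFun_wgen, map_zero, map_zero, LinearMap.zero_apply]
  map_add' x y := D.PP_linearMap_ext fun w' => by
    rw [LinearMap.add_apply, dualFun_wgen, dualFun_wgen, dualFun_wgen, map_add, map_add]

theorem dualHom_wgen (x : D.PP p) (w' : Fin q → Fin d) :
    D.dualHom h x (D.wgen w') = envFlip (D.coeffMap h w' x) := D.dualFun_wgen h x w'

theorem dualHom_smul (X : Env k D.B) (x : D.PP p) (y : D.PP q) :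
    D.dualHom h (X • x) y = D.dualHom h x y * envFlip X := by
  induction y using D.PP_induction with
  | hadd y y' hy hy' => rw [map_add, hy, hy', map_add, add_mul]
  | hgen Y w' =>
    rw [(D.dualHom h (X • x)).map_smul, (D.dualHom h x).map_smul, dualHom_wgen, dualHom_wgen,
      (D.coeffMap h w').map_smul, smul_eq_mul, smul_eq_mul, smul_eq_mul, envFlip_mul, mul_assoc]

theorem dualHom_smul_field (r : k) (x : D.PP p) (y : D.PP q) :
    D.dualHom h (r • x) y = r • D.dualHom h x y := by
  have h1 : r • x = (r • (1 : Env k D.B)) • x := by rw [smul_assoc, one_smul]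
  have h2 : envFlip (r • (1 : Env k D.B)) = r • (1 : Env k D.B) := by
    rw [LinearMap.map_smul envFlip, ← envTmul_one, envFlip_envTmul]
  rw [h1, dualHom_smul, h2, Algebra.mul_smul_comm, mul_one]

/-- Sorting an injective word costs a sign, and words with repeated letters contribute zero. -/
theorem span_wgen_strictMono [CharZero k] (l : ℕ) :
    Submodule.span (Env k D.B) (Set.range fun w : {w : Fin l → Fin d // StrictMono w} =>
      D.wgen w.1) = ⊤ := by
  rw [Submodule.eq_top_iff']
  intro y
  induction y using D.PP_induction with
  | hadd x y hx hy => exact Submodule.add_mem _ hx hy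
  | hgen X w =>
    refine Submodule.smul_mem _ _ ?_
    by_cases hw : Function.Injective w
    · have hs : StrictMono (w ∘ Tuple.sort w) :=
        (Tuple.monotone_sort w).strictMono_of_injective (hw.comp (Tuple.sort w).injective)
      have h1 : w = (w ∘ Tuple.sort w) ∘ (Tuple.sort w).symm := by
        funext x; simp
      rw [h1, D.isAltFamily_wgen.comp_perm]
      exact zsmul_mem (Submodule.subset_span
        (Set.mem_range_self (⟨_, hs⟩ : {w : Fin l → Fin d // StrictMono w}))) _
    · rw [D.isAltFamily_wgen.eq_zero (k := k) hw]
      exact Submodule.zero_mem _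

/-- For `x = ∑ X_w wgen w` over increasing words, the pairing with the increasing complement of `w`
isolates `X_w Om (-wsum w)` up to sign. If this is zero, so is `X_w wgen w`, since `Om (-wsum w)`
fixes `wgen w`. -/
theorem dualHom_injective [CharZero k] : Function.Injective (D.dualHom h) := by
  classical
  rw [injective_iff_map_eq_zero]
  intro x hx
  have hx' : x ∈ Submodule.span (Env k D.B) (Set.range fun w : {w : Fin p → Fin d // StrictMono w} =>
      D.wgen w.1) := by
    rw [span_wgen_strictMono]; trivial
  obtain ⟨X, rfl⟩ := (Submodule.mem_span_range_iff_exists_fun _).1 hx'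
  refine Finset.sum_eq_zero fun w _ => ?_
  obtain ⟨w', hw'mono, hw'⟩ := exists_strictMono_range_eq_compl h w.2.injective
  have hsq := orient_mul_self (h := h) w.2.injective hw'mono.injective hw'
  have h1 : D.coeffMap h w' (∑ w, X w • D.wgen w.1) = 0 := by
    rw [← envFlip_envFlip (D.coeffMap h w' _), ← dualHom_wgen, hx, LinearMap.zero_apply, map_zero]
  rw [map_sum, Finset.sum_eq_single w] at h1
  · rw [map_smul, coeffMap_wgen, smul_comm] at h1
    have h2 := congrArg (fun z => (dualSign d p * orient h w.1 w') • z) h1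
    rw [smul_smul, smul_zero, mul_mul_mul_comm, hsq, dualSign_mul_self, one_mul, one_smul,
      smul_eq_mul] at h2
    have hne : orient h w.1 w' ≠ 0 := by
      intro h0
      rw [h0, mul_zero] at hsq
      exact zero_ne_one hsq
    have h3 : D.wsum w' = - D.wsum w.1 := by
      rw [eq_neg_iff_add_eq_zero, add_comm, D.wsum_add_wsum h hne]
    rw [← Om_smul_wgen, smul_smul, ← h3, h2, zero_smul]
  · intro v _ hv
    rw [map_smul, coeffMap_wgen]
    have h0 : orient h v.1 w' = 0 := by
      by_contra hne
      have h4 := range_eq_compl_of_orient_ne_zero hne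
      rw [hw', compl_inj_iff] at h4
      exact hv (Subtype.ext ((StrictMono.range_inj w.2 v.2).1 h4).symm)
    rw [h0, mul_zero, zero_smul, smul_zero]
  · simp

/-- A bimodule map is determined by its values on increasing words, and these values serve as
coefficients at the complementary words. The superfluous factor `Om` returns inside `f`, where it
fixes the generator. -/
theorem dualHom_surjective [CharZero k] : Function.Surjective (D.dualHom h) := by
  classical
  intro f
  have hc : ∀ w : {w : Fin p → Fin d // StrictMono w}, ∃ w' : Fin q → Fin d,
      StrictMono w' ∧ Set.range w' = (Set.range w.1)ᶜ := fun w =>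
    exists_strictMono_range_eq_compl h w.2.injective
  choose c hcmono hcr using hc
  refine ⟨∑ w, (dualSign d p * orient h w.1 (c w)) • envFlip (f (D.wgen (c w))) • D.wgen w.1, ?_⟩
  refine LinearMap.ext_on_range (D.span_wgen_strictMono q) fun w' => ?_
  obtain ⟨v, hvmono, hv⟩ := exists_strictMono_range_eq_compl (by omega : q + p = d) w'.2.injective
  have hcv : c ⟨v, hvmono⟩ = w'.1 := by
    refine (StrictMono.range_inj (hcmono _) w'.2).1 ?_
    rw [hcr, hv, compl_compl]
  rw [dualHom_wgen, map_sum, Finset.sum_eq_single ⟨v, hvmono⟩]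
  · have hr : Set.range w'.1 = (Set.range v)ᶜ := by rw [hv, compl_compl]
    have hsq := orient_mul_self (h := h) hvmono.injective w'.2.injective hr
    have hne : orient h v w'.1 ≠ 0 := by
      intro h0
      rw [h0, mul_zero] at hsq
      exact zero_ne_one hsq
    rw [hcv, map_zsmul, map_zsmul, (D.coeffMap h w'.1).map_smul, coeffMap_wgen,
      smul_comm (envFlip _), map_zsmul, smul_smul, mul_mul_mul_comm, hsq,
      dualSign_mul_self, one_mul, one_smul, smul_eq_mul, envFlip_mul, envFlip_envFlip, envFlip_Om,
      ← smul_eq_mul, ← f.map_smul, Om_smul_wgen]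
  · intro w _ hw
    rw [map_zsmul, (D.coeffMap h w'.1).map_smul, coeffMap_wgen]
    have h0 : orient h w.1 w'.1 = 0 := by
      by_contra hne
      have h4 := range_eq_compl_of_orient_ne_zero hne
      refine hw (Subtype.ext ((StrictMono.range_inj w.2 hvmono).1 ?_))
      rw [hv, h4, compl_compl]
    rw [h0, mul_zero, zero_smul, smul_zero, smul_zero]
  · simp

/-- The duality isomorphism `P_p ≃ (P_q)^∨`. -/
noncomputable def dualEquiv [CharZero k] : D.PP p ≃+ (D.PP q →ₗ[Env k D.B] Env k D.B) :=
  AddEquiv.ofBijective (D.dualHom h) ⟨D.dualHom_injective h, D.dualHom_surjective h⟩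

/-! ### The duality isomorphism respects the gradings -/

theorem dualHom_tmul (b c b' c' : D.B) (s s' : ZMod n) (w : Fin p → Fin d) (w' : Fin q → Fin d) :
    D.dualHom h (P.tmul D.e D.a b ⟨s, w⟩ c) (P.tmul D.e D.a b' ⟨s', w'⟩ c') =
      (dualSign d p * orient h w w') • if s = s' + D.wsum w' then
        envTmul k (b' * D.e s * c) (b * D.e s' * c') else 0 := by
  rw [tmul_eq_smul_wgen, tmul_eq_smul_wgen, dualHom_smul, map_smul, dualHom_wgen, coeffMap_wgen,
    map_zsmul, envFlip_Om, envFlip_envTmul, smul_comm _ (_ : ℤ), smul_mul_assoc, smul_eq_mul]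
  congr 1
  dsimp only
  rw [mul_Om, Finset.sum_mul, Finset.sum_eq_single s]
  · rw [envTmul_mul]
    have h1 : b * (D.e (s + -D.wsum w') * (D.e s' * c')) =
        if s = s' + D.wsum w' then b * D.e s' * c' else 0 := by
      have h2 : s + -D.wsum w' = s' ↔ s = s' + D.wsum w' := by
        rw [← sub_eq_add_neg, sub_eq_iff_eq_add]
      rw [← mul_assoc (D.e _), e_mul_e]
      simp only [h2]
      split_ifs
      · rw [mul_assoc]
      · rw [zero_mul, mul_zero]
    rw [h1, ← mul_assoc (b' * D.e s), mul_assoc b', e_mul_e, if_pos rfl]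
    split_ifs
    · rfl
    · rw [← envMk_apply, map_zero]
  · intro t _ ht
    rw [envTmul_mul, ← mul_assoc (b' * D.e t), mul_assoc b', e_mul_e, if_neg ht, mul_zero, zero_mul,
      ← envMk_apply, map_zero, LinearMap.zero_apply]
  · simp

/-- Two complementary composable paths close up to a cycle that uses every variable once. Its weight
is `∑ a_j = n`, and the end point terms cancel, so `n * degree = n`. This produces the Gorenstein
parameter `1`. -/
theorem deg_add_deg {w : Fin p → Fin d} {w' : Fin q → Fin d} (hne : orient h w w' ≠ 0)
    {s s' : ZMod n} (hs : s = s' + D.wsum w') :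
    QPath.deg D.a (⟨s, w⟩ : QPath n d p) + QPath.deg D.a (⟨s', w'⟩ : QPath n d q) = 1 := by
  refine eq_of_n_mul_eq (n := n) ?_
  have h1 : s' = s + D.wsum w := by
    rw [hs, add_assoc, add_comm (D.wsum w'), D.wsum_add_wsum h hne, add_zero]
  rw [mul_add, deg_spec, deg_spec, tgt_eq, tgt_eq, ← h1, ← hs]
  have h2 := sum_add_sum_of_orient_ne_zero hne fun j => (D.a j : ℤ)
  rw [← Nat.cast_sum Finset.univ D.a, D.sum_eq] at h2
  dsimp only
  linarith

omit [NeZero n] in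
theorem map_smul_field (f : D.PP q →ₗ[Env k D.B] Env k D.B) (r : k) (y : D.PP q) :
    f (r • y) = r • f y := by
  have h1 : r • y = (r • (1 : Env k D.B)) • y := by rw [smul_assoc, one_smul]
  rw [h1, f.map_smul, smul_eq_mul, Algebra.smul_mul_assoc, one_mul]

theorem dualHom_mem {m i : ℤ} {x : D.PP p} {y : D.PP q} (hx : x ∈ D.grP p m)
    (hy : y ∈ D.grP q i) : D.dualHom h x y ∈ envGrading D.gradingB (i + (m - 1)) := by
  induction hx using Submodule.span_induction with
  | zero => rw [map_zero, LinearMap.zero_apply]; exact Submodule.zero_mem _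
  | add x y _ _ hx hy => rw [map_add, LinearMap.add_apply]; exact Submodule.add_mem _ hx hy
  | smul r x _ hx =>
    rw [dualHom_smul_field]
    exact Submodule.smul_mem _ _ hx
  | mem x hx =>
    obtain ⟨i1, j1, ⟨s, w⟩, h1, b, hb, c, hc, rfl⟩ := hx
    induction hy using Submodule.span_induction with
    | zero => rw [map_zero]; exact Submodule.zero_mem _
    | add x y _ _ hx hy => rw [map_add]; exact Submodule.add_mem _ hx hy
    | smul r x _ hx => rw [map_smul_field]; exact Submodule.smul_mem _ _ hx
    | mem y hy =>
      obtain ⟨i2, j2, ⟨s', w'⟩, h2, b', hb', c', hc', rfl⟩ := hy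
      rw [dualHom_tmul]
      by_cases hne : orient h w w' = 0
      · rw [hne, mul_zero, zero_smul]; exact Submodule.zero_mem _
      · refine zsmul_mem ?_ _
        split_ifs with hs
        · have h3 := D.deg_add_deg h hne hs
          refine Submodule.subset_span ⟨i2 + 0 + j1, i1 + 0 + j2, ?_, _,
            D.mul_mem_gradingB (D.mul_mem_gradingB hb' (D.e_mem s)) hc, _,
            D.mul_mem_gradingB (D.mul_mem_gradingB hb (D.e_mem s')) hc', rfl⟩
          linarith
        · exact Submodule.zero_mem _

theorem projP_mem {l : ℕ} (m : ℤ) (x : D.PP l) :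
    D.projP l m x ∈ D.grP l m ∧ x - D.projP l m x ∈ ⨆ j, ⨆ (_ : j ≠ m), D.grP l j := by
  have hx : x ∈ ⨆ m, D.grP l m := by rw [iSup_grP]; trivial
  induction hx using Submodule.iSup_induction' with
  | zero =>
    rw [map_zero, sub_zero]
    exact ⟨Submodule.zero_mem _, Submodule.zero_mem _⟩
  | add x y _ _ hx hy =>
    rw [map_add, add_sub_add_comm]
    exact ⟨Submodule.add_mem _ hx.1 hy.1, Submodule.add_mem _ hx.2 hy.2⟩
  | mem j x hx =>
    rw [D.projP_of_mem j m x hx]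
    by_cases hj : j = m
    · subst hj
      rw [if_pos rfl, sub_self]
      exact ⟨hx, Submodule.zero_mem _⟩
    · rw [if_neg hj, sub_zero]
      exact ⟨Submodule.zero_mem _, Submodule.mem_iSup_of_mem j (Submodule.mem_iSup_of_mem hj hx)⟩

theorem dualHom_mem_iSup {m i : ℤ} {x : D.PP p} {y : D.PP q}
    (hx : x ∈ ⨆ j, ⨆ (_ : j ≠ m), D.grP p j) (hy : y ∈ D.grP q i) :
    D.dualHom h x y ∈ ⨆ j, ⨆ (_ : j ≠ i + (m - 1)), envGrading D.gradingB j := by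
  induction hx using Submodule.iSup_induction' with
  | zero => rw [map_zero, LinearMap.zero_apply]; exact Submodule.zero_mem _
  | add x y _ _ hx hy => rw [map_add, LinearMap.add_apply]; exact Submodule.add_mem _ hx hy
  | mem j x hx =>
    by_cases hj : j = m
    · simp only [hj, ne_eq, not_true_eq_false, iSup_false, Submodule.mem_bot] at hx
      rw [hx, map_zero, LinearMap.zero_apply]
      exact Submodule.zero_mem _
    · simp only [ne_eq, hj, not_false_eq_true, iSup_pos] at hx
      exact Submodule.mem_iSup_of_mem (i + (j - 1)) (Submodule.mem_iSup_of_mem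
        (by intro h; apply hj; linarith) (D.dualHom_mem h hx hy))

/-- For the nontrivial direction, the part of `x` outside degree `m` is sent, on homogeneous
arguments, both into degree `i + (m - 1)` and into the sum of the other degrees. Independence makes
its image zero, and injectivity then makes the part itself zero. -/
theorem dualHom_mem_dualGrading_iff [CharZero k] (m : ℤ) (x : D.PP p) :
    D.dualHom h x ∈ dualGrading D.gradingB (D.grP q) (m - 1) ↔ x ∈ D.grP p m := by
  refine ⟨fun hx => ?_, fun hx i y hy => D.dualHom_mem h hx hy⟩
  obtain ⟨h1, h2⟩ := D.projP_mem m x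
  have h3 : D.dualHom h (x - D.projP p m x) = 0 := by
    refine LinearMap.ext fun y => ?_
    have hy : y ∈ ⨆ i, D.grP q i := by rw [iSup_grP]; trivial
    induction hy using Submodule.iSup_induction' with
    | zero => rw [map_zero, map_zero]
    | add y y' _ _ hy hy' => rw [map_add, hy, hy', map_add]
    | mem i y hy =>
      have h4 := (iSupIndep_def.1 D.iSupIndep_envGrading) (i + (m - 1))
      rw [Submodule.disjoint_def] at h4
      refine h4 _ ?_ (D.dualHom_mem_iSup h h2 hy)
      rw [map_sub, LinearMap.sub_apply]
      exact Submodule.sub_mem _ (hx i y hy) (D.dualHom_mem h h1 hy)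
  have h5 := (injective_iff_map_eq_zero (D.dualHom h)).1 (D.dualHom_injective h) _ h3
  rw [sub_eq_zero.1 h5]
  exact h1

end Pairing

/-! ### The duality isomorphism respects the differentials -/

/-- The overall minus sign arises because the flip exchanges the two terms of `x_j ⊗ 1 - 1 ⊗ x_j`.
-/
theorem dualHom_diff_wgen_left {p q : ℕ} (h : p + (q + 1) = d) (w : Fin (p + 1) → Fin d)
    (w' : Fin (q + 1) → Fin d) :
    D.dualHom h (D.diff p (D.wgen w)) (D.wgen w') = - (dualSign d p •
      ∑ i : Fin (p + 1), ((-1 : ℤ) ^ (i : ℕ) * orient h (w ∘ i.succAbove) w') •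
        (D.Z (w i) * D.Om (D.a (w i) - D.wsum w'))) := by
  rw [dualHom_wgen, diff_wgen, map_sum, map_sum, Finset.smul_sum, ← Finset.sum_neg_distrib]
  refine Finset.sum_congr rfl fun i _ => ?_
  rw [map_zsmul, (D.coeffMap h w').map_smul, coeffMap_wgen, map_zsmul,
    smul_comm (D.Z (w i)), map_zsmul, smul_eq_mul, envFlip_Z_mul_Om, smul_neg, smul_neg, smul_smul,
    smul_smul, mul_left_comm]

theorem dualHom_diff_wgen_right {p q : ℕ} (h : p + q = d) (w : Fin p → Fin d)
    (w' : Fin (q + 1) → Fin d) :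
    D.dualHom h (D.wgen w) (D.diff q (D.wgen w')) = dualSign d p •
      ∑ i : Fin (q + 1), ((-1 : ℤ) ^ (i : ℕ) * orient h w (w' ∘ i.succAbove)) •
        (D.Z (w' i) * D.Om (D.a (w' i) - D.wsum w')) := by
  rw [diff_wgen, map_sum, Finset.smul_sum]
  refine Finset.sum_congr rfl fun i _ => ?_
  have h1 : -D.wsum (w' ∘ i.succAbove) = D.a (w' i) - D.wsum w' := by
    rw [← D.wsum_succAbove w' i]
    ring
  rw [map_zsmul, (D.dualHom h (D.wgen w)).map_smul, dualHom_wgen, coeffMap_wgen, map_zsmul,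
    smul_comm (D.Z (w' i)), smul_eq_mul, envFlip_Om, smul_smul, smul_smul, mul_left_comm, h1]

theorem dualHom_diff (p q : ℕ) (h : p + 1 + q = d) (h' : p + (q + 1) = d) (x : D.PP (p + 1)) :
    D.dualHom h' (D.diff p x) = (-1 : ℤ) ^ d • (D.dualHom h x).comp (D.diff q) := by
  refine D.PP_linearMap_ext fun w' => ?_
  rw [LinearMap.smul_apply, LinearMap.comp_apply]
  induction x using D.PP_induction with
  | hadd x y hx hy =>
    calc D.dualHom h' (D.diff p (x + y)) (D.wgen w')
        = D.dualHom h' (D.diff p x) (D.wgen w') + D.dualHom h' (D.diff p y) (D.wgen w') :=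
          congrArg (fun f => f (D.wgen w')) ((congrArg (D.dualHom h') ((D.diff p).map_add x y)).trans
            ((D.dualHom h').map_add _ _))
      _ = (-1 : ℤ) ^ d • D.dualHom h x (D.diff q (D.wgen w')) +
            (-1 : ℤ) ^ d • D.dualHom h y (D.diff q (D.wgen w')) := congrArg₂ (· + ·) hx hy
      _ = (-1 : ℤ) ^ d • (D.dualHom h x (D.diff q (D.wgen w')) +
            D.dualHom h y (D.diff q (D.wgen w'))) := (smul_add _ _ _).symm
      _ = (-1 : ℤ) ^ d • D.dualHom h (x + y) (D.diff q (D.wgen w')) :=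
          congrArg (fun f => (-1 : ℤ) ^ d • f (D.diff q (D.wgen w')))
            ((D.dualHom h).map_add x y).symm
  | hgen X w =>
    -- Both sides of the claim are combinations of the same elements, indexed by the omitted letter,
    -- so the expansion identity applies with these as coefficients.
    have hsum := sum_orient_succAbove h h' w w' fun j => D.Z j * D.Om (D.a j - D.wsum w')
    have h2 : (-1 : ℤ) ^ d * (-1) ^ d = 1 := by
      rw [← pow_add, Even.neg_one_pow ⟨d, rfl⟩]
    have h3 : D.dualHom h' (D.diff p (X • D.wgen w)) (D.wgen w') =
        D.dualHom h' (D.diff p (D.wgen w)) (D.wgen w') * envFlip X :=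
      (congrArg (fun z => D.dualHom h' z (D.wgen w')) ((D.diff p).map_smul X (D.wgen w))).trans
        (D.dualHom_smul h' X _ _)
    rw [h3, D.dualHom_smul h X (D.wgen w), ← smul_mul_assoc,
      D.dualHom_diff_wgen_left h', D.dualHom_diff_wgen_right h, eq_neg_of_add_eq_zero_left hsum,
      smul_neg, neg_neg, smul_smul, smul_smul, dualSign_succ, pow_add (-1 : ℤ) (p + 1) d]
    congr 2
    linear_combination (-(dualSign d p * (-1) ^ (p + 1))) * h2

/-- The complex `P` is isomorphic to its shifted and twisted dual. -/
noncomputable def shiftedSelfDuality [CharZero k] :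
    ShiftedSelfDuality (X := P k D.e D.a) d D.gradingB (P.grading D.gradingB D.e D.a) D.diff where
  vanish := fun _ hl => D.subsingleton_PP hl
  φ := fun _ _ h => D.dualEquiv h
  φ_smul := fun _ _ h b c x y => by
    -- The flip turns `b ⊗ c` into `c ⊗ b`, which is the prescribed bimodule structure on the dual.
    refine (D.dualHom_smul h (envTmul k b c) x y).trans ?_
    rw [envFlip_envTmul]
    rfl
  φ_mem_iff := fun _ _ h m x => D.dualHom_mem_dualGrading_iff h m x
  φ_comm := fun p q h x => D.dualHom_diff p q h _ x

end

end CyclicDatum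

/-! ### The main theorem -/

theorem mainTheorem8 {k : Type*} [Field k] [IsAlgClosed k] [CharZero k] {d n : ℕ}
    (D : CyclicDatum k d n) :
    -- `B = End_{S^G}(T)` is the skew group algebra `S * G`, acting on `T = S`
    (∃ Φ : SkewMonoidAlgebra (MvPolynomial (Fin d) k) D.G ≃+* D.B,
      ∀ (γ : D.G) (s t : MvPolynomial (Fin d) k),
        Φ (SkewMonoidAlgebra.single γ s) t = s * (γ • t)) ∧
    IsPositivelyGradedAlgebra D.gradingB ∧
    -- the complex `P` is a graded projective resolution of `B` and `P ≅ P^∨[d](-1)`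
    (∃ (δ : ∀ l, McKay.P k D.e D.a (l + 1) →ₗ[Env k D.B] McKay.P k D.e D.a l)
      (ε : McKay.P k D.e D.a 0 →ₗ[k] D.B),
      McKay.IsKoszulDifferential D.e D.arrow D.a δ ∧
      McKay.IsAugmentation D.e D.a ε ∧
      IsGradedProjectiveResolution (X := McKay.P k D.e D.a) D.gradingB (McKay.P.grading D.gradingB D.e D.a) δ ε ∧
      Nonempty (ShiftedSelfDuality (X := McKay.P k D.e D.a) d D.gradingB (McKay.P.grading D.gradingB D.e D.a) δ)) ∧
    IsBimoduleCalabiYauGorensteinOne d D.gradingB := by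
  have : NeZero n := ⟨D.n_pos.ne'⟩
  exact ⟨D.exists_skew_equiv, D.isPositivelyGraded,
    ⟨D.diff, D.aug, D.isKoszulDifferential_diff, D.isAugmentation_aug,
      D.isGradedProjectiveResolution, ⟨D.shiftedSelfDuality⟩⟩,
    D.two_le_d, D.isPositivelyGraded, McKay.P k D.e D.a, inferInstance, inferInstance,
    inferInstance, inferInstance, McKay.P.grading D.gradingB D.e D.a, D.diff, D.aug,
    D.isGradedProjectiveResolution, ⟨D.shiftedSelfDuality⟩⟩
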